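/- \textbf{Theorem.} Let $n\ge 0$ and $[n]=\{1,\dots,n\}$. A \emph{planar forest labelled by $[n]$} is a finite sequence of planar rooted trees (the root is a leaf, no vertex lies in exactly two edges, the ascending edges at each vertex are linearly ordered) whose non-root leaves are labelled bijectively by $[n]$; let $PF_n$ be the set of these forests. For $\tau\in PF_n$ let $E(\tau)$ be its set of internal edges (those with at least two leaves above them), and for $e\in E(\tau)$ let $\mathcal L(\tau,e)\subset[n]$ be the set of labels above $e$. Let $r_e(\tau)$ be obtained from $\tau$ by reversing the order of the ascending edges at the upper end of $e$ and at all vertices above it, and let $d_e(\tau)$ be obtained by collapsing $e$, the ascending edges at its upper end taking the place of $e$ in their order (if $e$ is the edge at a root, its tree is replaced by the sequence of the trees growing at the upper end of $e$). Let $L$ be the set of subsets of $[n]$ that are neither empty nor singletons, so that $|L|=2^n-n-1$, and let $1_e\in(\mathbb Z/2)^L$ have its only non-zero entry in the coordinate $\mathcal L(\tau,e)$. Let $\widehat D_n$ (the complex of Ilin--Kamnitzer--Li--Przytycki--Rybnikov) be the quotient space of $\bigsqcup_{\tau\in PF_n}\{\tau\}\times[0,1]^{E(\tau)}$ by $(\tau,(t,1))\sim(d_e(\tau),t)$,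 by $(\tau,(t,0))\sim(r_e(\tau),(t,0))$ (for $e\in E(\tau)$, the second entry being the coordinate of $e$), and by $(\tau,t)\sim(\tau',t)$ whenever $\tau'$ is a permutation of the sequence of trees $\tau$. Let $M_n$ be the quotient space of $\bigsqcup_{\tau\in PF_n}\{\tau\}\times[0,1]^{E(\tau)}\times(\mathbb Z/2)^L$ by $(\tau,(t,1),s)\sim(d_e(\tau),t,s)$, by $(\tau,(t,0),s)\sim(r_e(\tau),(t,0),s+1_e)$, and by $(\tau,t,s)\sim(\tau',t,s)$ whenever $\tau'$ is a permutation of the trees of $\tau$; thus $M_n$ consists of copies of $\widehat D_n$ indexed by $(\mathbb Z/2)^L$, cut and reglued along the hyperplanes. In both spaces take as cubes the $[-1,1]^{E(\tau)}$ obtained from a subcube $[0,1]^{E(\tau)}$ and its images under compositions of the flips $r_e$ ($s$ changing to $s+\sum 1_e$ in $M_n$). Then: (1) $\widehat D_n$ is a nonpositively curved (NPC) cube complex, i.e. it is obtained from cubes by gluing faces isometrically and the link of each vertex is a flag simplicial complex. (2) The map $P:M_n\to\widehat D_n$, $(\tau,t,s)\mapsto(\tau,t)$, is a covering map of finite degree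 $2^{2^n-n-1}$, and it maps cubes to cubes. (3) $M_n$ is a compact special cube complex. That is, $M_n$ is compact and an NPC cube complex; each hyperplane is two-sided (extending an orientation of a dual edge across squares never gives one edge both orientations); and, calling two hyperplanes \emph{intersecting} (resp. \emph{osculating}) if they have distinct oriented dual edges with the same initial vertex which form (resp. do not form) a corner of a square, no hyperplane intersects itself, no hyperplane osculates with itself, and no two hyperplanes both intersect and osculate. -/

import Mathlib

/-! ## Cube complexes, hyperplanes, specialness -/

namespace CubeCx

/-- The interval `[-1,1]`. -/
abbrev J : Type := Set.Icc (-1 : ℝ) 1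

/-- The reflection `x ↦ -x` of `[-1,1]`. -/
def J.neg (x : J) : J := ⟨-x.1, by have := x.2.1; have := x.2.2; constructor <;> linarith⟩

/-- The end point `-1`. -/
def J.bot : J := ⟨-1, by norm_num⟩

/-- The end point `1`. -/
def J.top : J := ⟨1, by norm_num⟩

/-- The `k`-cube `[-1,1]^k`. -/
abbrev Cube (k : ℕ) : Type := Fin k → J

/-- The isometry of cubes which permutes the coordinates by `σ` and then changes the sign of the
coordinates in `{i | ε i}`. Every isometry of Euclidean cubes `[-1,1]^k → [-1,1]^l` has this form
(and forces `k = l`). -/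
def cubeIso {k l : ℕ} (σ : Fin l ≃ Fin k) (ε : Fin l → Bool) (x : Cube k) : Cube l :=
  fun i => if ε i then (x (σ i)).neg else x (σ i)

/-- The open cube `(-1,1)^k`. -/
def openCube (k : ℕ) : Set (Cube k) := {x | ∀ i, -1 < (x i).1 ∧ (x i).1 < 1}

/-- The data of a cube complex structure on `X`: for each `k`, the set of the (parametrized)
`k`-cubes `[-1,1]^k → X`. One and the same geometric cube of `X` occurs with all of its
parametrizations, which differ by isometries of `[-1,1]^k`. -/
structure Cubulation (X : Type*) where
  /-- the parametrized `k`-cubes -/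
  cubes : ∀ k : ℕ, Set (Cube k → X)

variable {X : Type*}

/-- `Q` makes `X` a cube complex: `X` is obtained from a collection of cubes by gluing faces via
isometries, with the quotient topology; no cube is folded onto itself, and the open cubes
partition `X`. -/
structure IsCubeComplex [TopologicalSpace X] (Q : Cubulation X) : Prop where
  /-- reparametrizing a cube by an isometry gives a parametrization of the same cube -/
  isometry_mem : ∀ {k : ℕ} (φ : Cube k → X), φ ∈ Q.cubes k →
    ∀ (σ : Fin k ≃ Fin k) (ε : Fin k → Bool), (fun x => φ (cubeIso σ ε x)) ∈ Q.cubes k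
  /-- codimension one faces of cubes are cubes -/
  face_mem : ∀ {k : ℕ} (φ : Cube (k + 1) → X), φ ∈ Q.cubes (k + 1) →
    ∀ (i : Fin (k + 1)) (c : J), c = J.bot ∨ c = J.top →
      (fun x : Cube k => φ (Fin.insertNth (α := fun _ => J) i c x)) ∈ Q.cubes k
  /-- the cubes cover `X` -/
  cover : ∀ p : X, ∃ (k : ℕ) (φ : Cube k → X), φ ∈ Q.cubes k ∧ p ∈ Set.range φ
  /-- open cubes are embedded -/
  injOn_openCube : ∀ {k : ℕ} (φ : Cube k → X), φ ∈ Q.cubes k → Set.InjOn φ (openCube k)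
  /-- two cubes whose open cubes meet are the same cube -/
  eq_of_meet : ∀ {k l : ℕ} (φ : Cube k → X) (ψ : Cube l → X), φ ∈ Q.cubes k → ψ ∈ Q.cubes l →
    ∀ x ∈ openCube k, ∀ y ∈ openCube l, φ x = ψ y →
      ∃ (σ : Fin l ≃ Fin k) (ε : Fin l → Bool), φ = fun z => ψ (cubeIso σ ε z)
  /-- `X` has the quotient topology -/
  isOpen_iff : ∀ U : Set X, IsOpen U ↔ ∀ (k : ℕ) (φ : Cube k → X), φ ∈ Q.cubes k → IsOpen (φ ⁻¹' U)

namespace Cubulation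

variable (Q : Cubulation X)

/-- Oriented 1-cubes. -/
def OEdge : Type _ := {e : Cube 1 → X // e ∈ Q.cubes 1}

variable {Q}

/-- The initial 0-cube of an oriented 1-cube. -/
def OEdge.origin (e : Q.OEdge) : X := e.1 (fun _ => J.bot)

/-- `e'` is the oriented 1-cube `e` with the reverse orientation. -/
def IsReverse (e e' : Q.OEdge) : Prop := e'.1 = fun x => e.1 (fun i => (x i).neg)

/-- The corner of the cube `φ` at `(-1,…,-1)`. (The other corners of the cube appear as this corner
of other parametrizations.) -/
def corner {k : ℕ} (φ : Cube k → X) : X := φ (fun _ => J.bot)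

/-- The `i`-th directed edge of the cube `φ` issuing from its corner `(-1,…,-1)`. -/
def cornerEdge {k : ℕ} (φ : Cube k → X) (i : Fin k) : Cube 1 → X :=
  fun x => φ (Function.update (fun _ => J.bot) i (x 0))

/-- `e₁`, `e₂` form a corner of a 2-cube. -/
def FormCorner (e₁ e₂ : Q.OEdge) : Prop :=
  ∃ φ ∈ Q.cubes 2, cornerEdge φ 0 = e₁.1 ∧ cornerEdge φ 1 = e₂.1

variable (Q)

/-- Nonpositive curvature: the link of every 0-cube is a flag simplicial complex. The vertices of
the link of `v` are the oriented 1-cubes issuing from `v`; its simplices are the corners at `v` of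
cubes. -/
structure NPC : Prop where
  /-- the vertices of each simplex of a link are distinct -/
  link_edges_injective : ∀ {k : ℕ}, ∀ φ ∈ Q.cubes k, Function.Injective (cornerEdge φ)
  /-- a simplex of a link is determined by its vertices -/
  link_simplex_unique : ∀ {k : ℕ}, ∀ φ ∈ Q.cubes k, ∀ ψ ∈ Q.cubes k,
    corner φ = corner ψ → cornerEdge φ = cornerEdge ψ → φ = ψ
  /-- every finite clique of a link spans a simplex -/
  link_flag : ∀ p ∈ Q.cubes 0, ∀ (k : ℕ) (e : Fin k → Q.OEdge), Function.Injective e →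
    (∀ i, (e i).origin = corner p) → (∀ i j, i ≠ j → FormCorner (e i) (e j)) →
      ∃ φ ∈ Q.cubes k, corner φ = corner p ∧ ∀ i, cornerEdge φ i = (e i).1

variable {Q}

/-- `e'` lies opposite to `e` in some 2-cube, with the same direction. -/
def Opposite (e e' : Q.OEdge) : Prop :=
  ∃ φ ∈ Q.cubes 2, (e.1 = fun x => φ ![x 0, J.bot]) ∧ (e'.1 = fun x => φ ![x 0, J.top])

variable (Q)

/-- Hyperplanes. A hyperplane is a connected component of the union of all midcubes, glued along
common faces; it is given by the 1-cubes dual to it, i.e. by a class of 1-cubes under the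
equivalence relation generated by being opposite in a 2-cube (for unoriented 1-cubes). -/
def Hyperplane : Type _ := Quot (fun e e' : Q.OEdge => Opposite e e' ∨ IsReverse e e')

variable {Q}

/-- The (oriented) 1-cube `e` is dual to the hyperplane `H`. -/
def Dual (e : Q.OEdge) (H : Q.Hyperplane) : Prop := Quot.mk _ e = H

/-- Extending an orientation of a dual 1-cube through 2-cubes never gives a dual 1-cube both of its
orientations. -/
def TwoSided (H : Q.Hyperplane) : Prop :=
  ∀ e e' : Q.OEdge, Dual e H → IsReverse e e' → ¬ Relation.EqvGen Opposite e e'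

/-- Two hyperplanes intersect. -/
def Intersect (H₁ H₂ : Q.Hyperplane) : Prop :=
  ∃ e₁ e₂ : Q.OEdge, Dual e₁ H₁ ∧ Dual e₂ H₂ ∧ e₁ ≠ e₂ ∧ FormCorner e₁ e₂

/-- Two hyperplanes osculate. -/
def Osculate (H₁ H₂ : Q.Hyperplane) : Prop :=
  ∃ e₁ e₂ : Q.OEdge, Dual e₁ H₁ ∧ Dual e₂ H₂ ∧ e₁ ≠ e₂ ∧ e₁.origin = e₂.origin ∧
    ¬ FormCorner e₁ e₂

/-- Two hyperplanes inter-osculate. -/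
def InterOsculate (H₁ H₂ : Q.Hyperplane) : Prop := Intersect H₁ H₂ ∧ Osculate H₁ H₂

variable (Q)

/-- Special cube complexes. -/
structure Special : Prop where
  npc : Q.NPC
  two_sided : ∀ H : Q.Hyperplane, TwoSided H
  embedded : ∀ H : Q.Hyperplane, ¬ Intersect H H
  no_self_osculation : ∀ H : Q.Hyperplane, ¬ Osculate H H
  no_inter_osculation : ∀ H₁ H₂ : Q.Hyperplane, ¬ InterOsculate H₁ H₂

end Cubulation

end CubeCx

/-! ## Planar forests -/

namespace Cactus

open CubeCx

/-- Finite sequences of planar rooted trees with leaves labelled by `Fin n`. Such a sequence is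
empty, or its first tree is a single edge from the root to a leaf labelled `a`, or the edge at the
root of its first tree is internal and `children` is the sequence of the trees which
grow, in their order, at the upper end of that edge; `rest` is the sequence of the other trees. -/
inductive Forest (n : ℕ) : Type
  | nil : Forest n
  | leaf (a : Fin n) (rest : Forest n) : Forest n
  | node (children rest : Forest n) : Forest n

namespace Forest

variable {n : ℕ}

/-- The labels of the leaves in the order of a depth-first search. -/
def leaves : Forest n → List (Fin n)
  | nil => []
  | leaf a r => a :: r.leaves
  | node c r => c.leaves ++ r.leaves

/-- The set of the labels of the leaves. -/
def labels (f : Forest n) : Finset (Fin n) := f.leaves.toFinset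

/-- The sequence of the trees of a forest, each of them as a forest with one tree. -/
def trees : Forest n → List (Forest n)
  | nil => []
  | leaf a r => leaf a nil :: r.trees
  | node c r => node c nil :: r.trees

/-- No vertex lies in exactly two edges: at the upper end of an internal edge at least two edges
ascend. -/
def Branching : Forest n → Prop
  | nil => True
  | leaf _ r => r.Branching
  | node c r => 2 ≤ c.trees.length ∧ c.Branching ∧ r.Branching

/-- The internal edges. An internal edge `e` is recorded as the set `𝓛(e)` of the labels of the
leaves above it; in a forest with `Branching` whose leaves have distinct labels, `e` is determined
by this set. -/
def edges : Forest n → Finset (Finset (Fin n))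
  | nil => ∅
  | leaf _ r => r.edges
  | node c r => insert c.labels (c.edges ∪ r.edges)

/-- Concatenation of sequences of trees. -/
def append : Forest n → Forest n → Forest n
  | nil, g => g
  | leaf a r, g => leaf a (r.append g)
  | node c r, g => node c (r.append g)

/-- The mirror image: the order of the trees, and the order of the ascending edges at every vertex,
is reversed. -/
def mirror : Forest n → Forest n
  | nil => nil
  | leaf a r => r.mirror.append (leaf a nil)
  | node c r => r.mirror.append (node c.mirror nil)

/-- The composition of the (commuting) flips `r_e` for the internal edges `e ∈ S`; in particular
`r_e` itself is `reflect {e}`: at the upper end of `e`, and at all vertices above it, the order of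
the ascending edges is reversed. -/
def reflect (S : Finset (Finset (Fin n))) : Forest n → Forest n
  | nil => nil
  | leaf a r => leaf a (r.reflect S)
  | node c r =>
    if c.labels ∈ S then node (c.reflect S).mirror (r.reflect S)
    else node (c.reflect S) (r.reflect S)

/-- The deletion `d_e`: the edge `e` is collapsed and the trees at its upper end take its place. -/
def delete (e : Finset (Fin n)) : Forest n → Forest n
  | nil => nil
  | leaf a r => leaf a (r.delete e)
  | node c r => if c.labels = e then c.append r else node (c.delete e) (r.delete e)

/-! Facts showing that these operations preserve labelled planar forests. -/

theorem leaves_append (f g : Forest n) : (f.append g).leaves = f.leaves ++ g.leaves := by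
  induction f with
  | nil => rfl
  | leaf a r ih => simp [append, leaves, ih]
  | node c r _ ih => simp [append, leaves, ih]

theorem leaves_mirror (f : Forest n) : f.mirror.leaves = f.leaves.reverse := by
  induction f with
  | nil => rfl
  | leaf a r ih => simp [mirror, leaves, leaves_append, ih]
  | node c r ihc ih => simp [mirror, leaves, leaves_append, ih, ihc]

theorem leaves_reflect (S : Finset (Finset (Fin n))) (f : Forest n) :
    (f.reflect S).leaves.Perm f.leaves := by
  induction f with
  | nil => rfl
  | leaf a r ih => simpa [reflect, leaves] using ih
  | node c r ihc ih =>
    unfold reflect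
    split
    · simp only [leaves, leaves_mirror]
      exact ((List.reverse_perm _).trans ihc).append ih
    · exact ihc.append ih

theorem leaves_delete (e : Finset (Fin n)) (f : Forest n) : (f.delete e).leaves = f.leaves := by
  induction f with
  | nil => rfl
  | leaf a r ih => simp [delete, leaves, ih]
  | node c r ihc ih =>
    unfold delete
    split
    · simp [leaves, leaves_append]
    · simp [leaves, ihc, ih]

theorem labels_mirror (f : Forest n) : f.mirror.labels = f.labels := by
  simp [labels, leaves_mirror]

theorem labels_reflect (S : Finset (Finset (Fin n))) (f : Forest n) :
    (f.reflect S).labels = f.labels :=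
  List.toFinset_eq_of_perm _ _ (leaves_reflect S f)

theorem labels_delete (e : Finset (Fin n)) (f : Forest n) : (f.delete e).labels = f.labels := by
  simp [labels, leaves_delete]

theorem trees_append (f g : Forest n) : (f.append g).trees = f.trees ++ g.trees := by
  induction f with
  | nil => rfl
  | leaf a r ih => simp [append, trees, ih]
  | node c r _ ih => simp [append, trees, ih]

theorem length_trees_mirror (f : Forest n) : f.mirror.trees.length = f.trees.length := by
  induction f with
  | nil => rfl
  | leaf a r ih => simp [mirror, trees, trees_append, ih]
  | node c r _ ih => simp [mirror, trees, trees_append, ih]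

theorem length_trees_reflect (S : Finset (Finset (Fin n))) (f : Forest n) :
    (f.reflect S).trees.length = f.trees.length := by
  induction f with
  | nil => rfl
  | leaf a r ih => simp [reflect, trees, ih]
  | node c r _ ih => unfold reflect; split <;> simp [trees, ih]

theorem edges_append (f g : Forest n) : (f.append g).edges = f.edges ∪ g.edges := by
  induction f with
  | nil => simp [append, edges]
  | leaf a r ih => simp [append, edges, ih]
  | node c r _ ih => simp [append, edges, ih]

theorem edges_mirror (f : Forest n) : f.mirror.edges = f.edges := by
  induction f with
  | nil => rfl
  | leaf a r ih => simp [mirror, edges, edges_append, ih]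
  | node c r ihc ih =>
    simp only [mirror, edges, edges_append, ih, ihc, labels_mirror]
    ext; simp; tauto

theorem edges_reflect (S : Finset (Finset (Fin n))) (f : Forest n) :
    (f.reflect S).edges = f.edges := by
  induction f with
  | nil => rfl
  | leaf a r ih => simp [reflect, edges, ih]
  | node c r ihc ih =>
    unfold reflect
    split <;> simp [edges, edges_mirror, labels_mirror, labels_reflect, ihc, ih]

theorem edges_delete_subset (e : Finset (Fin n)) (f : Forest n) :
    (f.delete e).edges ⊆ f.edges := by
  induction f with
  | nil => simp [delete]
  | leaf a r ih => simpa [delete, edges] using ih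
  | node c r ihc ih =>
    unfold delete
    split
    · rw [edges_append]
      exact Finset.subset_insert _ _
    · simp only [edges, labels_delete]
      exact Finset.insert_subset_insert _ (Finset.union_subset_union ihc ih)

theorem mem_edges_iff (f : Forest n) (A : Finset (Fin n)) :
    A ∈ f.edges ↔ ∃ T ∈ f.trees, A ∈ T.edges := by
  induction f with
  | nil => simp [edges, trees]
  | leaf a r ih => simp [edges, trees, ih]
  | node c r _ ih => simp [edges, trees, ih, or_assoc]

theorem edges_eq_of_perm {f g : Forest n} (h : f.trees.Perm g.trees) : f.edges = g.edges := by
  ext A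
  rw [mem_edges_iff f, mem_edges_iff g]
  simp only [h.mem_iff]

theorem branching_append {f g : Forest n} (hf : f.Branching) (hg : g.Branching) :
    (f.append g).Branching := by
  induction f with
  | nil => exact hg
  | leaf a r ih => exact ih hf
  | node c r _ ih => exact ⟨hf.1, hf.2.1, ih hf.2.2⟩

theorem branching_mirror {f : Forest n} (hf : f.Branching) : f.mirror.Branching := by
  induction f with
  | nil => exact hf
  | leaf a r ih => exact branching_append (ih hf) trivial
  | node c r ihc ih =>
    exact branching_append (ih hf.2.2)
      ⟨by rw [length_trees_mirror]; exact hf.1, ihc hf.2.1, trivial⟩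

theorem branching_reflect (S : Finset (Finset (Fin n))) {f : Forest n} (hf : f.Branching) :
    (f.reflect S).Branching := by
  induction f with
  | nil => exact hf
  | leaf a r ih => exact ih hf
  | node c r ihc ih =>
    unfold reflect
    split
    · exact ⟨by rw [length_trees_mirror, length_trees_reflect]; exact hf.1,
        branching_mirror (ihc hf.2.1), ih hf.2.2⟩
    · exact ⟨by rw [length_trees_reflect]; exact hf.1, ihc hf.2.1, ih hf.2.2⟩

theorem length_trees_delete {f : Forest n} (hf : f.Branching) (e : Finset (Fin n)) :
    f.trees.length ≤ (f.delete e).trees.length := by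
  induction f with
  | nil => rfl
  | leaf a r ih => simpa [delete, trees] using ih hf
  | node c r _ ih =>
    have h := ih hf.2.2
    have h2 := hf.1
    unfold delete
    split
    · simp only [trees, trees_append, List.length_cons, List.length_append]; omega
    · simpa [trees] using h

theorem branching_delete (e : Finset (Fin n)) {f : Forest n} (hf : f.Branching) :
    (f.delete e).Branching := by
  induction f with
  | nil => exact hf
  | leaf a r ih => exact ih hf
  | node c r ihc ih =>
    unfold delete
    split
    · exact branching_append hf.2.1 hf.2.2
    · exact ⟨hf.1.trans (length_trees_delete hf.2.1 e), ihc hf.2.1, ih hf.2.2⟩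

end Forest

/-- `PF_n`: the planar forests labelled by `[n]`; every label belongs to exactly one leaf. -/
@[ext] structure PF (n : ℕ) : Type where
  /-- the underlying sequence of planar trees -/
  forest : Forest n
  branching : forest.Branching
  nodup : forest.leaves.Nodup
  complete : ∀ a, a ∈ forest.leaves

namespace PF

variable {n : ℕ}

/-- `E(τ)`, the set of internal edges. -/
abbrev E (τ : PF n) : Finset (Finset (Fin n)) := τ.forest.edges

/-- The composition of the flips `r_e`, `e ∈ S`. -/
def reflect (τ : PF n) (S : Finset (Finset (Fin n))) : PF n where
  forest := τ.forest.reflect S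
  branching := Forest.branching_reflect S τ.branching
  nodup := (Forest.leaves_reflect S τ.forest).nodup_iff.2 τ.nodup
  complete a := (Forest.leaves_reflect S τ.forest).mem_iff.2 (τ.complete a)

/-- The flip `r_e`. -/
abbrev flip (τ : PF n) (e : Finset (Fin n)) : PF n := τ.reflect {e}

/-- The deletion `d_e`. -/
def delete (τ : PF n) (e : Finset (Fin n)) : PF n where
  forest := τ.forest.delete e
  branching := Forest.branching_delete e τ.branching
  nodup := by rw [Forest.leaves_delete]; exact τ.nodup
  complete a := by rw [Forest.leaves_delete]; exact τ.complete a

/-- `τ'` is obtained from `τ` by a permutation of the sequence of trees. -/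
def SameTrees (τ τ' : PF n) : Prop := τ.forest.trees.Perm τ'.forest.trees

theorem E_reflect (τ : PF n) (S : Finset (Finset (Fin n))) : (τ.reflect S).E = τ.E :=
  Forest.edges_reflect S τ.forest

theorem E_reflect_subset (τ : PF n) (S : Finset (Finset (Fin n))) : (τ.reflect S).E ⊆ τ.E :=
  (τ.E_reflect S).subset

theorem E_delete_subset (τ : PF n) (e : Finset (Fin n)) : (τ.delete e).E ⊆ τ.E :=
  Forest.edges_delete_subset e τ.forest

theorem SameTrees.E_eq {τ τ' : PF n} (h : τ.SameTrees τ') : τ'.E = τ.E :=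
  (Forest.edges_eq_of_perm h).symm

end PF

/-! ## The complexes -/

section Gluing

variable {n : ℕ} (G : Type) [AddCommGroup G] (w : Finset (Fin n) → G)

/-- The disjoint union of the subcubes `{τ} × [0,1]^{E(τ)} × {s}`, for `τ ∈ PF_n` and `s ∈ G`. -/
abbrev Subcubes (n : ℕ) (G : Type) : Type :=
  Σ p : PF n × G, (p.1.E → Set.Icc (0 : ℝ) 1)

variable {G}

/-- The gluing conditions. -/
inductive Glue : Subcubes n G → Subcubes n G → Prop
  /-- `(τ, (t,1), s) ∼ (d_e(τ), t, s)` -/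
  | outward (τ : PF n) (s : G) (t : τ.E → Set.Icc (0 : ℝ) 1) (e : τ.E) (h : (t e).1 = 1) :
      Glue ⟨(τ, s), t⟩ ⟨(τ.delete e, s), fun f => t ⟨f.1, τ.E_delete_subset e f.2⟩⟩
  /-- `(τ, t, s) ∼ (τ', t, s)` if `τ'` is a permutation of the trees of `τ` -/
  | perm (τ τ' : PF n) (s : G) (t : τ.E → Set.Icc (0 : ℝ) 1) (h : τ.SameTrees τ') :
      Glue ⟨(τ, s), t⟩ ⟨(τ', s), fun f => t ⟨f.1, h.E_eq.subset f.2⟩⟩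
  /-- `(τ, (t,0), s) ∼ (r_e(τ), (t,0), s + w_e)` -/
  | inward (τ : PF n) (s : G) (t : τ.E → Set.Icc (0 : ℝ) 1) (e : τ.E) (h : (t e).1 = 0) :
      Glue ⟨(τ, s), t⟩ ⟨(τ.flip e, s + w e), fun f => t ⟨f.1, τ.E_reflect_subset {e.1} f.2⟩⟩

/-- The space obtained by gluing the subcubes, with the quotient topology. -/
def Glued : Type := Quot (Glue w)

instance : TopologicalSpace (Glued w) := inferInstanceAs (TopologicalSpace (Quot (Glue w)))

/-- The coordinates in which a point of `[-1,1]^{E(τ)}` is negative. -/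
noncomputable def negCoords {τ : PF n} (x : τ.E → J) : Finset (Finset (Fin n)) :=
  (Finset.univ.filter fun e => (x e).1 < 0).map (Function.Embedding.subtype _)

/-- The absolute value `[-1,1] → [0,1]`. -/
def absJ (x : J) : Set.Icc (0 : ℝ) 1 := ⟨|x.1|, abs_nonneg _, abs_le.2 ⟨x.2.1, x.2.2⟩⟩

/-- The cube `[-1,1]^{E(τ)}` with positive subcube `(τ, [0,1]^{E(τ)}, s)`. Its other subcubes are
those labelled by `r_{e_1} ⋯ r_{e_m}(τ)` and `s + w_{e_1} + ⋯ + w_{e_m}`, with `{e_1, …, e_m}` the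
set of the negative coordinates. -/
noncomputable def cubeMap (τ : PF n) (s : G) (x : τ.E → J) : Glued w :=
  Quot.mk _ ⟨(τ.reflect (negCoords x), s + ∑ e ∈ negCoords x, w e),
    fun f => absJ (x ⟨f.1, τ.E_reflect_subset (negCoords x) f.2⟩)⟩

/-- The cubes of the glued space. -/
noncomputable def gluedCubes : Cubulation (Glued w) where
  cubes k := {φ | ∃ (τ : PF n) (s : G) (b : τ.E ≃ Fin k),
    φ = fun x => cubeMap w τ s (fun e => x (b e))}

end Gluing

/-- The cube complex `D̂_n`: the subcubes `{τ} × [0,1]^{E(τ)}` for `τ ∈ PF_n` (the parameter ranges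
over a one-point set), glued by `(τ, (t,1)) ∼ (d_e(τ), t)`, `(τ, (t,0)) ∼ (r_e(τ), (t,0))`, and by
permutations of the trees of `τ`. -/
abbrev Dhat (n : ℕ) : Type := Glued (n := n) (G := Unit) (fun _ => 0)

/-- The cubes of `D̂_n`. -/
noncomputable abbrev DhatCubes (n : ℕ) : Cubulation (Dhat n) := gluedCubes _

/-- `L`: the subsets of `[n]` which are neither empty nor singletons. -/
abbrev L (n : ℕ) : Type := {A : Finset (Fin n) // A.Nonempty ∧ A.card ≠ 1}

/-- `1_e ∈ (ℤ/2)^L`: the only non-zero entry is in the coordinate `𝓛(e)`. -/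
def unitVec {n : ℕ} (e : Finset (Fin n)) : L n → ZMod 2 := fun A => if A.1 = e then 1 else 0

/-- The complex `M_n`: copies of `D̂_n` indexed by `(ℤ/2)^L`, cut and reglued along the
hyperplanes, that is, the subcubes `{τ} × [0,1]^{E(τ)} × {s}` glued by
`(τ, (t,1), s) ∼ (d_e(τ), t, s)`, `(τ, (t,0), s) ∼ (r_e(τ), (t,0), s + 1_e)`, and by permutations of
the trees of `τ`. -/
abbrev M (n : ℕ) : Type := Glued (n := n) (G := L n → ZMod 2) unitVec

/-- The cubes of `M_n`. -/
noncomputable abbrev MCubes (n : ℕ) : Cubulation (M n) := gluedCubes _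

/-- The map `P : M_n → D̂_n`, `(τ, t, s) ↦ (τ, t)`. -/
def P (n : ℕ) : M n → Dhat n :=
  Quot.map (fun x => ⟨(x.1.1, ()), x.2⟩) (by
    rintro _ _ (⟨τ, s, t, e, h⟩ | ⟨τ, τ', s, t, h⟩ | ⟨τ, s, t, e, h⟩)
    · exact Glue.outward τ () t e h
    · exact Glue.perm τ τ' () t h
    · exact Glue.inward τ () t e h)

end Cactus

/-! A planar forest is encoded by its laminar family E(τ) of label sets and by the values `ord i j`
in ℤ/2, which record whether leaf i stands before leaf j. Up to a permutation of its trees, a forest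
is determined by E(τ) and by `ord` on the pairs contained in a common member of E(τ)
(`Forest.perm_trees_of_ord_eq`). Conversely, a laminar family of sets with at least two elements,
each carrying an order, comes from a forest as soon as, whenever A ⊆ B, the set A is an interval of
B with the induced order (`PF.exists_of_compatible`). Deletions do not change `ord`; flips along S
add the number mod 2 of members of S that contain both i and j (`PF.ord_reflect`).

Both complexes are instances of `Glued w` with w e + w e = 0, and are treated together. The
equivalence relation generated by the gluing has a closed form (`mk_eq_iff`, and `cubeMap_eq_iff`
for points of the cubes [-1,1]^E): coordinates, read as 1 at label sets that are not edges, agree up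
to sign changes on a set D; the indices differ by the sum of w over D; and the orders differ by the
parity count of D on pairs contained in a common set whose coordinate is not ±1. Together with the
parity lemma `PF.eq_empty_of_countBoth`, this yields the cube complex axioms. The vertices
correspond to the elements of G, and a cube at a vertex is a family of ordered label sets as above.
Since the conditions on such a family concern only two members at a time, the links are flag.

The group (ℤ/2)^L acts on M_n by translating s, and P is the quotient map. The continuous functions
`coordFun` and `orderFun` on M_n change only by signs under translation. At each point those that do
not vanish detect every non-zero translation, so the action is free and properly discontinuous;
hence P is a covering whose fibres have the size of the group.

For specialness, follow a dual edge with label set A through squares. Crossing a square flips along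
some B ≠ A that does not cross A. Hence A, the sum of the order on A and the `twist` of the index s,
and the entries of s at all sets crossing A are invariants of the hyperplane (`SameClass`). With s
given, they determine the oriented edge, so a hyperplane has at most one oriented dual edge at each
vertex; this excludes self-intersection and self-osculation. The entry of s at A survives squares
but changes under reversal: two-sidedness. Finally, the invariants show that compatibility of the
orders at one vertex forces it at every other vertex where both hyperplanes have dual edges, so
there is no inter-osculation. -/

/-! ## The order of the entries of a list -/

section Order

variable {α : Type*} [DecidableEq α]

/-- `1` if `i` stands before `j` in `l`, and `0` otherwise. -/
def List.ord (l : List α) (i j : α) : ZMod 2 := if l.idxOf i < l.idxOf j then 1 else 0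

theorem List.ord_append_left {l m : List α} {i j : α} (hi : i ∈ l) (hj : j ∈ l) :
    (l ++ m).ord i j = l.ord i j := by
  simp [List.ord, List.idxOf_append, hi, hj]

theorem List.ord_append_right {l m : List α} {i j : α} (hi : i ∉ l) (hj : j ∉ l) :
    (l ++ m).ord i j = m.ord i j := by
  simp [List.ord, List.idxOf_append, hi, hj]

theorem List.ord_append_lr {l m : List α} {i j : α} (hi : i ∈ l) (hj : j ∉ l) :
    (l ++ m).ord i j = 1 := by
  have := List.idxOf_lt_length_of_mem hi
  simp [List.ord, List.idxOf_append, hi, hj]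
  omega

theorem List.ord_append_rl {l m : List α} {i j : α} (hi : i ∉ l) (hj : j ∈ l) :
    (l ++ m).ord i j = 0 := by
  have := List.idxOf_lt_length_of_mem hj
  simp [List.ord, List.idxOf_append, hi, hj]
  omega

theorem List.ord_swap {l : List α} {i j : α} (hi : i ∈ l) (hij : i ≠ j) :
    l.ord j i = l.ord i j + 1 := by
  have h : l.idxOf i ≠ l.idxOf j := fun h => hij ((List.idxOf_inj hi).1 h)
  unfold List.ord
  split_ifs <;> first | omega | decide

theorem List.ord_reverse {l : List α} (hl : l.Nodup) {i j : α} (hi : i ∈ l) (hj : j ∈ l)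
    (hij : i ≠ j) : l.reverse.ord i j = l.ord i j + 1 := by
  induction l with
  | nil => simp at hi
  | cons a l ih =>
    have ha : a ∉ l := (List.nodup_cons.1 hl).1
    rw [List.reverse_cons, ← List.singleton_append (l := l)]
    by_cases hia : i = a
    · subst hia
      have hj' : j ∈ l := by simpa [hij.symm] using hj
      rw [List.ord_append_rl (by simpa using ha) (by simpa using hj'),
        List.ord_append_lr (by simp) (by simp [hij.symm])]
      rfl
    · have hi' : i ∈ l := by simpa [hia] using hi
      by_cases hja : j = a
      · subst hja
        rw [List.ord_append_lr (by simpa using hi') (by simpa using ha),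
          List.ord_append_rl (by simpa using hia) (by simp)]
        rfl
      · have hj' : j ∈ l := by simpa [hja] using hj
        rw [List.ord_append_left (by simpa using hi') (by simpa using hj'),
          List.ord_append_right (by simpa using hia) (by simpa using hja),
          ih (List.nodup_cons.1 hl).2 hi' hj']

theorem List.ord_eq_one_iff {l : List α} {i j : α} : l.ord i j = 1 ↔ l.idxOf i < l.idxOf j := by
  unfold List.ord
  split_ifs with h <;> simp [h]

theorem List.ord_eq_zero_iff {l : List α} {i j : α} : l.ord i j = 0 ↔ l.idxOf j ≤ l.idxOf i := by
  unfold List.ord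
  split_ifs with h <;> simp [h] ; omega

theorem List.pairwise_ord {l : List α} (hl : l.Nodup) : l.Pairwise (fun i j => l.ord i j = 1) := by
  rw [List.pairwise_iff_getElem]
  intro i j hi hj hij
  rw [List.ord_eq_one_iff, hl.idxOf_getElem, hl.idxOf_getElem]
  exact hij

/-- "Standing before in `l`" is antisymmetric, so a list has only one rearrangement sorted by it. -/
theorem List.eq_of_perm_of_pairwise_ord {l m : List α} (hl : l.Nodup) (hp : m.Perm l)
    (hm : m.Pairwise (fun i j => l.ord i j = 1)) : m = l := by
  refine hp.eq_of_pairwise (le := fun i j => l.ord i j = 1) ?_ hm (List.pairwise_ord hl)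
  intro a b _ _ h1 h2
  rw [List.ord_eq_one_iff] at h1 h2
  omega

theorem List.eq_of_ord_eq {l m : List α} (hl : l.Nodup) (hm : m.Nodup)
    (h : ∀ a, a ∈ m ↔ a ∈ l) (ho : ∀ i ∈ m, ∀ j ∈ m, i ≠ j → m.ord i j = l.ord i j) : m = l := by
  refine List.eq_of_perm_of_pairwise_ord hl ((List.perm_ext_iff_of_nodup hm hl).2 h) ?_
  refine ((List.pairwise_ord hm).and hm).imp_of_mem ?_
  rintro a b ha hb ⟨h1, h2⟩
  rw [← ho a ha b hb h2, h1]

end Order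

/-! ### Laminarity of the internal edges, and the effect of flips on the leaf order -/

namespace Cactus

open CubeCx

/-- `1` if both `i` and `j` belong to `A`, and `0` otherwise. -/
def both {n : ℕ} (i j : Fin n) (A : Finset (Fin n)) : ZMod 2 := if i ∈ A ∧ j ∈ A then 1 else 0

namespace Forest

variable {n : ℕ}

theorem mem_labels {f : Forest n} {a : Fin n} : a ∈ f.labels ↔ a ∈ f.leaves := by simp [labels]

theorem leaves_eq_flatMap (f : Forest n) : f.leaves = f.trees.flatMap leaves := by
  induction f with
  | nil => rfl
  | leaf a r ih => simp [leaves, trees, ih]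
  | node c r _ ih => simp [leaves, trees, ih]

theorem labels_node (c r : Forest n) : (node c r).labels = c.labels ∪ r.labels := by
  simp [labels, leaves]

theorem labels_leaf (a : Fin n) (r : Forest n) : (leaf a r).labels = insert a r.labels := by
  simp [labels, leaves]

theorem subset_labels {f : Forest n} {A : Finset (Fin n)} (hA : A ∈ f.edges) : A ⊆ f.labels := by
  induction f with
  | nil => simp [edges] at hA
  | leaf a r ih => rw [labels_leaf]; exact (ih hA).trans (Finset.subset_insert _ _)
  | node c r ihc ih =>
    rw [labels_node]
    simp only [edges, Finset.mem_insert, Finset.mem_union] at hA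
    rcases hA with rfl | hA | hA
    · exact Finset.subset_union_left
    · exact (ihc hA).trans Finset.subset_union_left
    · exact (ih hA).trans Finset.subset_union_right

/-- Every tree of a branching forest carries a leaf. -/
theorem length_trees_le {f : Forest n} (hf : f.Branching) : f.trees.length ≤ f.leaves.length := by
  induction f with
  | nil => simp [trees]
  | leaf a r ih => simpa [trees, leaves] using ih hf
  | node c r ihc ih =>
    have h1 := ihc hf.2.1
    have h2 := ih hf.2.2
    have h3 := hf.1
    simp only [trees, leaves, List.length_cons, List.length_append]
    omega

theorem disjoint_of_nodup {c r : Forest n} (h : (node c r).leaves.Nodup) :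
    Disjoint c.labels r.labels := by
  rw [Finset.disjoint_left]
  intro a ha hb
  exact List.disjoint_of_nodup_append h (mem_labels.1 ha) (mem_labels.1 hb)

theorem nodup_left {c r : Forest n} (h : (node c r).leaves.Nodup) : c.leaves.Nodup :=
  (List.nodup_append.1 h).1

theorem nodup_right {c r : Forest n} (h : (node c r).leaves.Nodup) : r.leaves.Nodup :=
  (List.nodup_append.1 h).2.1

theorem two_le_card {f : Forest n} (hf : f.Branching) (hn : f.leaves.Nodup) {A : Finset (Fin n)}
    (hA : A ∈ f.edges) : 2 ≤ A.card := by
  induction f with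
  | nil => simp [edges] at hA
  | leaf a r ih => exact ih hf (List.nodup_cons.1 hn).2 hA
  | node c r ihc ih =>
    simp only [edges, Finset.mem_insert, Finset.mem_union] at hA
    rcases hA with rfl | hA | hA
    · rw [labels, List.toFinset_card_of_nodup (nodup_left hn)]
      exact hf.1.trans (length_trees_le hf.2.1)
    · exact ihc hf.2.1 (nodup_left hn) hA
    · exact ih hf.2.2 (nodup_right hn) hA

/-- The two leaves are taken from different trees, and no internal edge has leaves of two trees
above it. -/
theorem exists_two_leaves {f : Forest n} (hf : f.Branching) (hn : f.leaves.Nodup)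
    (h2 : 2 ≤ f.trees.length) :
    ∃ i ∈ f.labels, ∃ j ∈ f.labels, i ≠ j ∧ ∀ B ∈ f.edges, i ∈ B → j ∈ B → False := by
  have key : ∀ r : Forest n, r.Branching → 1 ≤ r.trees.length → ∃ j, j ∈ r.labels := by
    intro r hr h
    have := h.trans (length_trees_le hr)
    obtain ⟨j, hj⟩ := List.exists_mem_of_length_pos this
    exact ⟨j, mem_labels.2 hj⟩
  cases f with
  | nil => simp [trees] at h2
  | leaf a r =>
    obtain ⟨j, hj⟩ := key r hf (by simpa [trees] using h2)
    have ha : a ∉ r.labels := by rw [mem_labels]; exact (List.nodup_cons.1 hn).1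
    refine ⟨a, by simp [labels_leaf], j, by simp [labels_leaf, hj], ?_, ?_⟩
    · rintro rfl; exact ha hj
    · intro B hB hi _
      exact ha (subset_labels (f := r) hB hi)
  | node c r =>
    obtain ⟨i, hi⟩ := key c hf.2.1 (le_trans (by norm_num) hf.1)
    obtain ⟨j, hj⟩ := key r hf.2.2 (by simpa [trees] using h2)
    have hd := Finset.disjoint_left.1 (disjoint_of_nodup hn)
    refine ⟨i, by simp [labels_node, hi], j, by simp [labels_node, hj], ?_, ?_⟩
    · rintro rfl; exact hd hi hj
    · intro B hB hiB hjB
      simp only [edges, Finset.mem_insert, Finset.mem_union] at hB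
      rcases hB with rfl | hB | hB
      · exact hd hjB hj
      · exact hd (subset_labels hB hjB) hj
      · exact hd hi (subset_labels hB hiB)

/-- Two leaves which are separated just above the upper end of the edge `A`. -/
theorem exists_separated {f : Forest n} (hf : f.Branching) (hn : f.leaves.Nodup)
    {A : Finset (Fin n)} (hA : A ∈ f.edges) :
    ∃ i ∈ A, ∃ j ∈ A, i ≠ j ∧ ∀ B ∈ f.edges, i ∈ B → j ∈ B → A ⊆ B := by
  induction f with
  | nil => simp [edges] at hA
  | leaf a r ih => exact ih hf (List.nodup_cons.1 hn).2 hA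
  | node c r ihc ih =>
    have hd := Finset.disjoint_left.1 (disjoint_of_nodup hn)
    simp only [edges, Finset.mem_insert, Finset.mem_union] at hA ⊢
    rcases hA with rfl | hA | hA
    · obtain ⟨i, hi, j, hj, hij, h⟩ := exists_two_leaves hf.2.1 (nodup_left hn) hf.1
      refine ⟨i, hi, j, hj, hij, ?_⟩
      rintro B (rfl | hB | hB) hiB hjB
      · exact subset_rfl
      · exact (h B hB hiB hjB).elim
      · exact (hd hi (subset_labels hB hiB)).elim
    · obtain ⟨i, hi, j, hj, hij, h⟩ := ihc hf.2.1 (nodup_left hn) hA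
      refine ⟨i, hi, j, hj, hij, ?_⟩
      rintro B (rfl | hB | hB) hiB hjB
      · exact subset_labels hA
      · exact h B hB hiB hjB
      · exact (hd (subset_labels hA hi) (subset_labels hB hiB)).elim
    · obtain ⟨i, hi, j, hj, hij, h⟩ := ih hf.2.2 (nodup_right hn) hA
      refine ⟨i, hi, j, hj, hij, ?_⟩
      rintro B (rfl | hB | hB) hiB hjB
      · exact (hd hiB (subset_labels hA hi)).elim
      · exact (hd (subset_labels hB hiB) (subset_labels hA hi)).elim
      · exact h B hB hiB hjB

/-- With `labels_notMem_edges_right`, this shows that no other internal edge has the same label set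
as the first root edge. Sums over label sets are thus sums over edges. -/
theorem labels_notMem_edges {c : Forest n} (hf : c.Branching) (hn : c.leaves.Nodup)
    (h2 : 2 ≤ c.trees.length) : c.labels ∉ c.edges := by
  intro h
  obtain ⟨i, hi, j, hj, _, h'⟩ := exists_two_leaves hf hn h2
  exact h' _ h hi hj

theorem labels_notMem_edges_right {c r : Forest n} (hf : (node c r).Branching)
    (hn : (node c r).leaves.Nodup) : c.labels ∉ r.edges := by
  intro h
  have h2 := two_le_card hf.2.2 (nodup_right hn) h
  obtain ⟨i, hi⟩ := Finset.card_pos.1 (lt_of_lt_of_le (by norm_num) h2)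
  exact Finset.disjoint_left.1 (disjoint_of_nodup hn) hi (subset_labels h hi)

theorem edges_laminar {f : Forest n} (hn : f.leaves.Nodup) {A B : Finset (Fin n)}
    (hA : A ∈ f.edges) (hB : B ∈ f.edges) : Disjoint A B ∨ A ⊆ B ∨ B ⊆ A := by
  induction f with
  | nil => simp [edges] at hA
  | leaf a r ih => exact ih (List.nodup_cons.1 hn).2 hA hB
  | node c r ihc ih =>
    have hd := disjoint_of_nodup hn
    simp only [edges, Finset.mem_insert, Finset.mem_union] at hA hB
    rcases hA with rfl | hA | hA <;> rcases hB with rfl | hB | hB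
    · exact Or.inr (Or.inl subset_rfl)
    · exact Or.inr (Or.inr (subset_labels hB))
    · exact Or.inl (hd.mono_right (subset_labels hB))
    · exact Or.inr (Or.inl (subset_labels hA))
    · exact ihc (nodup_left hn) hA hB
    · exact Or.inl (hd.mono (subset_labels hA) (subset_labels hB))
    · exact Or.inl (hd.symm.mono_left (subset_labels hA))
    · exact Or.inl (hd.symm.mono (subset_labels hA) (subset_labels hB))
    · exact ih (nodup_right hn) hA hB

/-- The leaves above an edge are consecutive. -/
theorem ord_eq_of_mem_edges {f : Forest n} (hn : f.leaves.Nodup) {A : Finset (Fin n)}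
    (hA : A ∈ f.edges) {i j k : Fin n} (hi : i ∈ A) (hj : j ∈ A) (hk : k ∉ A) (hkf : k ∈ f.leaves) :
    f.leaves.ord i k = f.leaves.ord j k := by
  induction f with
  | nil => simp [edges] at hA
  | leaf a r ih =>
    have hn' := List.nodup_cons.1 hn
    have hi' : i ∈ r.leaves := mem_labels.1 (subset_labels (f := r) hA hi)
    have hj' : j ∈ r.leaves := mem_labels.1 (subset_labels (f := r) hA hj)
    have hia : i ∉ [a] := by rintro h; rw [List.mem_singleton] at h; exact hn'.1 (h ▸ hi')
    have hja : j ∉ [a] := by rintro h; rw [List.mem_singleton] at h; exact hn'.1 (h ▸ hj')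
    simp only [leaves, ← List.singleton_append (l := r.leaves)]
    by_cases hka : k ∈ [a]
    · rw [List.ord_append_rl hia hka, List.ord_append_rl hja hka]
    · rw [List.ord_append_right hia hka, List.ord_append_right hja hka]
      exact ih hn'.2 hA (by simpa [leaves, List.mem_singleton.not.1 hka] using hkf)
  | node c r ihc ih =>
    have hd := Finset.disjoint_left.1 (disjoint_of_nodup hn)
    simp only [edges, Finset.mem_insert, Finset.mem_union] at hA
    simp only [leaves]
    rcases hA with rfl | hA | hA
    · rw [List.ord_append_lr (mem_labels.1 hi) (mem_labels.not.1 hk),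
        List.ord_append_lr (mem_labels.1 hj) (mem_labels.not.1 hk)]
    · have hi' := mem_labels.1 (subset_labels hA hi)
      have hj' := mem_labels.1 (subset_labels hA hj)
      by_cases hkc : k ∈ c.leaves
      · rw [List.ord_append_left hi' hkc, List.ord_append_left hj' hkc]
        exact ihc (nodup_left hn) hA hkc
      · rw [List.ord_append_lr hi' hkc, List.ord_append_lr hj' hkc]
    · have hi' : i ∉ c.leaves := fun h => hd (mem_labels.2 h) (subset_labels hA hi)
      have hj' : j ∉ c.leaves := fun h => hd (mem_labels.2 h) (subset_labels hA hj)
      by_cases hkc : k ∈ c.leaves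
      · rw [List.ord_append_rl hi' hkc, List.ord_append_rl hj' hkc]
      · rw [List.ord_append_right hi' hkc, List.ord_append_right hj' hkc]
        refine ih (nodup_right hn) hA ?_
        simpa [leaves, hkc] using hkf

/-- Each label set belongs to only one internal edge, so collapsing that edge removes it from the
set and nothing else. -/
theorem edges_delete {f : Forest n} (hf : f.Branching) (hn : f.leaves.Nodup) (e : Finset (Fin n)) :
    (f.delete e).edges = f.edges.erase e := by
  induction f with
  | nil => simp [delete, edges]
  | leaf a r ih => exact ih hf (List.nodup_cons.1 hn).2
  | node c r ihc ih =>
    unfold delete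
    split_ifs with h
    · subst h
      have h1 := labels_notMem_edges hf.2.1 (nodup_left hn) hf.1
      have h2 := labels_notMem_edges_right hf hn
      rw [edges_append]
      simp only [edges]
      rw [Finset.erase_insert]
      simp [h1, h2]
    · simp only [edges, labels_delete, ihc hf.2.1 (nodup_left hn), ih hf.2.2 (nodup_right hn)]
      rw [Finset.erase_insert_of_ne h, Finset.erase_union_distrib]

theorem both_eq_zero_of_labels {f : Forest n} {i j : Fin n} (h : i ∉ f.labels ∨ j ∉ f.labels)
    {A : Finset (Fin n)} (hA : A ∈ f.edges) : both i j A = 0 := by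
  unfold both
  rw [if_neg]
  rintro ⟨h1, h2⟩
  have := subset_labels hA
  rcases h with h | h
  · exact h (this h1)
  · exact h (this h2)

/-- A flip at A reverses the block of leaves above A, so it toggles the order of exactly the pairs
inside A. Nested flips add up modulo 2. -/
theorem ord_reflect {f : Forest n} (hf : f.Branching) (hn : f.leaves.Nodup)
    (S : Finset (Finset (Fin n))) {i j : Fin n} (hij : i ≠ j) (hi : i ∈ f.leaves)
    (hj : j ∈ f.leaves) :
    (f.reflect S).leaves.ord i j = f.leaves.ord i j + ∑ A ∈ f.edges, if A ∈ S then both i j A else 0 := by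
  induction f with
  | nil => simp [leaves] at hi
  | leaf a r ih =>
    have hn' := List.nodup_cons.1 hn
    simp only [reflect, leaves, edges]
    simp only [leaves, List.mem_cons] at hi hj
    rw [← List.singleton_append (l := r.leaves), ← List.singleton_append (l := (r.reflect S).leaves)]
    have h0 : (i ∉ r.leaves ∨ j ∉ r.leaves) →
        (∑ A ∈ r.edges, if A ∈ S then both i j A else 0) = 0 := by
      intro h
      refine Finset.sum_eq_zero fun A hA => ?_
      rw [both_eq_zero_of_labels (f := r) (by simpa only [mem_labels] using h) hA, ite_self]
    by_cases hia : i = a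
    · subst hia
      rw [List.ord_append_lr (by simp) (by simpa using hij.symm),
        List.ord_append_lr (by simp) (by simpa using hij.symm), h0 (Or.inl hn'.1), add_zero]
    · by_cases hja : j = a
      · subst hja
        rw [List.ord_append_rl (by simpa using hij) (by simp),
          List.ord_append_rl (by simpa using hij) (by simp), h0 (Or.inr hn'.1), add_zero]
      · rw [List.ord_append_right (by simpa using hia) (by simpa using hja),
          List.ord_append_right (by simpa using hia) (by simpa using hja)]
        exact ih hf hn'.2 (hi.resolve_left hia) (hj.resolve_left hja)
  | node c r ihc ih =>
    have hd := Finset.disjoint_left.1 (disjoint_of_nodup hn)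
    have hmc : ∀ b, b ∈ (c.reflect S).leaves ↔ b ∈ c.leaves := fun b => (leaves_reflect S c).mem_iff
    have hncr : (c.reflect S).leaves.Nodup := (leaves_reflect S c).nodup_iff.2 (nodup_left hn)
    have h1 := labels_notMem_edges hf.2.1 (nodup_left hn) hf.1
    have h2 := labels_notMem_edges_right hf hn
    have hdE : Disjoint c.edges r.edges := by
      rw [Finset.disjoint_left]
      intro A hA hA'
      obtain ⟨i, hi⟩ := Finset.card_pos.1
        (lt_of_lt_of_le (by norm_num) (two_le_card hf.2.1 (nodup_left hn) hA))
      exact hd (subset_labels hA hi) (subset_labels hA' hi)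
    have hsum : (∑ A ∈ (node c r).edges, if A ∈ S then both i j A else 0) =
        (if c.labels ∈ S then both i j c.labels else 0) +
        ((∑ A ∈ c.edges, if A ∈ S then both i j A else 0) +
        ∑ A ∈ r.edges, if A ∈ S then both i j A else 0) := by
      simp only [edges]
      rw [Finset.sum_insert (by simp [h1, h2]), Finset.sum_union hdE]
    have h0c : (i ∉ c.leaves ∨ j ∉ c.leaves) →
        (∑ A ∈ c.edges, if A ∈ S then both i j A else 0) = 0 := by
      intro h
      refine Finset.sum_eq_zero fun A hA => ?_
      rw [both_eq_zero_of_labels (f := c) (by simpa only [mem_labels] using h) hA, ite_self]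
    have h0l : (i ∉ c.leaves ∨ j ∉ c.leaves) →
        (if c.labels ∈ S then both i j c.labels else 0) = 0 := by
      intro h
      have : both i j c.labels = 0 := by
        unfold both; simp only [mem_labels]; rw [if_neg]; tauto
      rw [this, ite_self]
    have h0r : (i ∉ r.leaves ∨ j ∉ r.leaves) →
        (∑ A ∈ r.edges, if A ∈ S then both i j A else 0) = 0 := by
      intro h
      refine Finset.sum_eq_zero fun A hA => ?_
      rw [both_eq_zero_of_labels (f := r) (by simpa only [mem_labels] using h) hA, ite_self]
    have hlv : ((node c r).reflect S).leaves =
        (if c.labels ∈ S then (c.reflect S).leaves.reverse else (c.reflect S).leaves) ++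
          (r.reflect S).leaves := by
      simp only [reflect]; split_ifs <;> simp [leaves, leaves_mirror]
    have hml : ∀ b, b ∈ (if c.labels ∈ S then (c.reflect S).leaves.reverse
        else (c.reflect S).leaves) ↔ b ∈ c.leaves := by
      intro b; split_ifs <;> simp [hmc]
    rw [hlv, hsum]
    simp only [leaves, List.mem_append] at hi hj ⊢
    -- Only when both leaves lie above the root edge can its flip, or a flip above it, change their
    -- order; if one lies outside, the position of the blocks decides.
    by_cases hic : i ∈ c.leaves <;> by_cases hjc : j ∈ c.leaves
    · rw [List.ord_append_left ((hml _).2 hic) ((hml _).2 hjc), List.ord_append_left hic hjc,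
        h0r (Or.inl fun h => hd (mem_labels.2 hic) (mem_labels.2 h))]
      have hb : both i j c.labels = 1 := by simp [both, mem_labels, hic, hjc]
      have ih' := ihc hf.2.1 (nodup_left hn) hic hjc
      split_ifs with hS
      · rw [List.ord_reverse hncr ((hmc _).2 hic) ((hmc _).2 hjc) hij, ih', hb]; ring
      · rw [ih']; ring
    · rw [List.ord_append_lr ((hml _).2 hic) ((hml _).not.2 hjc), List.ord_append_lr hic hjc,
        h0c (Or.inr hjc), h0l (Or.inr hjc),
        h0r (Or.inl fun h => hd (mem_labels.2 hic) (mem_labels.2 h))]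
      simp
    · rw [List.ord_append_rl ((hml _).not.2 hic) ((hml _).2 hjc), List.ord_append_rl hic hjc,
        h0c (Or.inl hic), h0l (Or.inl hic),
        h0r (Or.inr fun h => hd (mem_labels.2 hjc) (mem_labels.2 h))]
      simp
    · rw [List.ord_append_right ((hml _).not.2 hic) ((hml _).not.2 hjc),
        List.ord_append_right hic hjc, h0c (Or.inl hic), h0l (Or.inl hic),
        ih hf.2.2 (nodup_right hn) (hi.resolve_left hic) (hj.resolve_left hjc)]
      simp

end Forest
end Cactus

/-- A list sorted by the order of `l` induces the order of `l` on its own entries, even if `l` has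
further entries. -/
theorem List.ord_eq_of_pairwise {α : Type*} [DecidableEq α] {l m : List α}
    (hm : m.Pairwise (fun i j => l.ord i j = 1)) {i j : α} (hi : i ∈ m) (hj : j ∈ m) (hij : i ≠ j) :
    m.ord i j = l.ord i j := by
  rw [List.pairwise_iff_getElem] at hm
  have hi' := List.idxOf_lt_length_of_mem hi
  have hj' := List.idxOf_lt_length_of_mem hj
  have hne : m.idxOf i ≠ m.idxOf j := fun h => hij ((List.idxOf_inj hi).1 h)
  rcases lt_or_gt_of_ne hne with h | h
  · have := hm _ _ hi' hj' h
    simp only [List.getElem_idxOf] at this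
    rw [this, List.ord_eq_one_iff]
    exact h
  · have := hm _ _ hj' hi' h
    simp only [List.getElem_idxOf, List.ord_eq_one_iff] at this
    rw [List.ord_eq_zero_iff.2 h.le, List.ord_eq_zero_iff.2 this.le]

/-! ### Recovering and constructing forests from edges and leaf orders -/

namespace Cactus

open CubeCx

namespace Forest

variable {n : ℕ}

theorem leaves_ne_nil {f : Forest n} (hf : f.Branching) (h : f.trees ≠ []) : f.leaves ≠ [] := by
  intro h'
  have := length_trees_le hf
  rw [h'] at this
  simp at this
  exact h this

theorem exists_mem_labels_of_node {c r : Forest n} (hf : (node c r).Branching) :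
    ∃ a, a ∈ c.leaves := by
  have := hf.1.trans (length_trees_le hf.2.1)
  exact List.exists_mem_of_length_pos (lt_of_lt_of_le (by norm_num) this)

/-- Here and in `edges_right` the edges of the two parts are recovered from all edges and from
`c.labels` alone, so that two decompositions can be compared in an induction. -/
theorem edges_left {c r : Forest n} (hf : (node c r).Branching) (hn : (node c r).leaves.Nodup)
    (A : Finset (Fin n)) :
    A ∈ c.edges ↔ A ∈ (node c r).edges ∧ A ⊆ c.labels ∧ A ≠ c.labels := by
  have hd := Finset.disjoint_left.1 (disjoint_of_nodup hn)
  simp only [edges, Finset.mem_insert, Finset.mem_union]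
  constructor
  · intro h
    refine ⟨Or.inr (Or.inl h), subset_labels h, ?_⟩
    rintro rfl
    exact labels_notMem_edges hf.2.1 (nodup_left hn) hf.1 h
  · rintro ⟨rfl | h | h, h1, h2⟩
    · exact absurd rfl h2
    · exact h
    · obtain ⟨i, hi⟩ := Finset.card_pos.1
        (lt_of_lt_of_le (by norm_num) (two_le_card hf.2.2 (nodup_right hn) h))
      exact (hd (h1 hi) (subset_labels h hi)).elim

theorem edges_right {c r : Forest n} (hf : (node c r).Branching) (hn : (node c r).leaves.Nodup)
    (A : Finset (Fin n)) : A ∈ r.edges ↔ A ∈ (node c r).edges ∧ ¬ A ⊆ c.labels := by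
  have hd := Finset.disjoint_left.1 (disjoint_of_nodup hn)
  simp only [edges, Finset.mem_insert, Finset.mem_union]
  constructor
  · intro h
    refine ⟨Or.inr (Or.inr h), fun h1 => ?_⟩
    obtain ⟨i, hi⟩ := Finset.card_pos.1
        (lt_of_lt_of_le (by norm_num) (two_le_card hf.2.2 (nodup_right hn) h))
    exact (hd (h1 hi) (subset_labels h hi)).elim
  · rintro ⟨rfl | h | h, h1⟩
    · exact absurd subset_rfl h1
    · exact absurd (subset_labels h) h1
    · exact h

/-- `c.labels` is the largest internal edge through any of its leaves; one leaf therefore suffices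
to find it. -/
theorem subset_of_mem_edges_node {c r : Forest n} (hn : (node c r).leaves.Nodup)
    {A : Finset (Fin n)} (hA : A ∈ (node c r).edges) {a : Fin n} (ha : a ∈ A) (hac : a ∈ c.leaves) :
    A ⊆ c.labels := by
  simp only [edges, Finset.mem_insert, Finset.mem_union] at hA
  rcases hA with rfl | h | h
  · exact subset_rfl
  · exact subset_labels h
  · exact (Finset.disjoint_left.1 (disjoint_of_nodup hn) (mem_labels.2 hac)
      (subset_labels h ha)).elim

/-- A planar forest is determined by the sequence of its leaves and by its internal edges. -/
theorem eq_of_leaves_eq {f g : Forest n} (hf : f.Branching) (hg : g.Branching)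
    (hn : f.leaves.Nodup) (hl : f.leaves = g.leaves) (he : f.edges = g.edges) : f = g := by
  -- A first tree that is a single leaf differs from one with an internal root edge: the latter's
  -- root edge contains the first leaf a, which lies in no edge of the former forest.
  have hleaf : ∀ (a : Fin n) (r c' r' : Forest n), (leaf a r).leaves.Nodup → (node c' r').Branching →
      (leaf a r).leaves = (node c' r').leaves → (leaf a r).edges ≠ (node c' r').edges := by
    intro a r c' r' hn hg hl he
    have h1 : c'.labels ∈ r.edges := by
      have : c'.labels ∈ (node c' r').edges := by simp [edges]
      rwa [← he] at this
    obtain ⟨b, hb⟩ := exists_mem_labels_of_node hg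
    simp only [leaves] at hl
    obtain ⟨x, t, hx⟩ := List.exists_cons_of_ne_nil (List.ne_nil_of_mem hb)
    rw [hx, List.cons_append, List.cons.injEq] at hl
    have : a ∈ c'.labels := by rw [mem_labels, hx, hl.1]; simp
    exact (List.nodup_cons.1 hn).1 (mem_labels.1 (subset_labels h1 this))
  induction f generalizing g with
  | nil =>
    cases g with
    | nil => rfl
    | leaf a r => simp [leaves] at hl
    | node c r =>
      obtain ⟨b, hb⟩ := exists_mem_labels_of_node hg
      simp only [leaves] at hl
      have : b ∈ c.leaves ++ r.leaves := by simp [hb]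
      rw [← hl] at this
      simp at this
  | leaf a r ih =>
    cases g with
    | nil => simp [leaves] at hl
    | leaf a' r' =>
      simp only [leaves, List.cons.injEq] at hl
      rw [hl.1, ih (g := r') hf hg (List.nodup_cons.1 hn).2 hl.2 he]
    | node c' r' => exact (hleaf a r c' r' hn hg hl he).elim
  | node c r ihc ih =>
    cases g with
    | nil =>
      obtain ⟨b, hb⟩ := exists_mem_labels_of_node hf
      simp only [leaves] at hl
      have : b ∈ c.leaves ++ r.leaves := by simp [hb]
      rw [hl] at this
      simp at this
    | leaf a' r' => exact (hleaf a' r' c r (hl ▸ hn) hf hl.symm he.symm).elim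
    | node c' r' =>
      have hn' : (node c' r').leaves.Nodup := hl ▸ hn
      obtain ⟨b, hb⟩ := exists_mem_labels_of_node hf
      obtain ⟨b', hb'⟩ := exists_mem_labels_of_node hg
      obtain ⟨x, t, hx⟩ := List.exists_cons_of_ne_nil (List.ne_nil_of_mem hb)
      obtain ⟨x', t', hx'⟩ := List.exists_cons_of_ne_nil (List.ne_nil_of_mem hb')
      have hxx : x = x' := by
        have := hl
        simp only [leaves, hx, hx', List.cons_append, List.cons.injEq] at this
        exact this.1
      subst hxx
      have hxc : x ∈ c.leaves := by rw [hx]; simp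
      have hxc' : x ∈ c'.leaves := by rw [hx']; simp
      -- Both sets are the largest internal edge containing the common first leaf x.
      have hc : c.labels = c'.labels := by
        apply Finset.Subset.antisymm
        · refine subset_of_mem_edges_node hn' (a := x) ?_ (mem_labels.2 hxc) hxc'
          rw [← he]; simp [edges]
        · refine subset_of_mem_edges_node hn (a := x) ?_ (mem_labels.2 hxc') hxc
          rw [he]; simp [edges]
      -- Equal lengths cut the common leaf list at the same place, which separates `c` from `r`.
      have hlen : c.leaves.length = c'.leaves.length := by
        rw [← List.toFinset_card_of_nodup (nodup_left hn),
          ← List.toFinset_card_of_nodup (nodup_left hn')]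
        exact congrArg _ hc
      obtain ⟨h1, h2⟩ := List.append_inj (show c.leaves ++ r.leaves = c'.leaves ++ r'.leaves from hl) hlen
      rw [ihc hf.2.1 hg.2.1 (nodup_left hn) h1, ih hf.2.2 hg.2.2 (nodup_right hn) h2]
      · ext A; rw [edges_right hf hn, edges_right hg hn', he, hc]
      · ext A; rw [edges_left hf hn, edges_left hg hn', he, hc]

/-! The trees of a forest -/

theorem tree_cases {f T : Forest n} (hT : T ∈ f.trees) :
    (∃ a, T = leaf a nil) ∨ ∃ c, T = node c nil := by
  induction f with
  | nil => simp [trees] at hT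
  | leaf a r ih =>
    simp only [trees, List.mem_cons] at hT
    exact hT.elim (fun h => Or.inl ⟨a, h⟩) ih
  | node c r _ ih =>
    simp only [trees, List.mem_cons] at hT
    exact hT.elim (fun h => Or.inr ⟨c, h⟩) ih

theorem trees_of_mem {f T : Forest n} (hT : T ∈ f.trees) : T.trees = [T] := by
  rcases tree_cases hT with ⟨a, rfl⟩ | ⟨c, rfl⟩ <;> rfl

theorem branching_tree {f T : Forest n} (hf : f.Branching) (hT : T ∈ f.trees) : T.Branching := by
  induction f with
  | nil => simp [trees] at hT
  | leaf a r ih =>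
    simp only [trees, List.mem_cons] at hT
    exact hT.elim (fun h => h ▸ trivial) (ih hf)
  | node c r _ ih =>
    simp only [trees, List.mem_cons] at hT
    exact hT.elim (fun h => h ▸ ⟨hf.1, hf.2.1, trivial⟩) (ih hf.2.2)

theorem leaves_tree_ne_nil {f T : Forest n} (hf : f.Branching) (hT : T ∈ f.trees) :
    T.leaves ≠ [] :=
  leaves_ne_nil (branching_tree hf hT) (by rw [trees_of_mem hT]; simp)

theorem mem_leaves_iff {f : Forest n} {a : Fin n} : a ∈ f.leaves ↔ ∃ T ∈ f.trees, a ∈ T.leaves := by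
  rw [leaves_eq_flatMap]; simp

theorem nodup_tree {f T : Forest n} (hn : f.leaves.Nodup) (hT : T ∈ f.trees) : T.leaves.Nodup := by
  rw [leaves_eq_flatMap, List.nodup_flatMap] at hn
  exact hn.1 T hT

theorem pairwise_disjoint_trees {f : Forest n} (hn : f.leaves.Nodup) :
    f.trees.Pairwise (fun T T' => List.Disjoint T.leaves T'.leaves) := by
  rw [leaves_eq_flatMap, List.nodup_flatMap] at hn
  exact hn.2

theorem nodup_trees {f : Forest n} (hf : f.Branching) (hn : f.leaves.Nodup) : f.trees.Nodup := by
  refine (pairwise_disjoint_trees hn).imp_of_mem ?_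
  rintro T T' hT _ h rfl
  obtain ⟨a, ha⟩ := List.exists_mem_of_ne_nil _ (leaves_tree_ne_nil hf hT)
  exact h ha ha

theorem tree_eq_of_mem {f T T' : Forest n} (hn : f.leaves.Nodup) (hT : T ∈ f.trees)
    (hT' : T' ∈ f.trees) {a : Fin n} (ha : a ∈ T.leaves) (ha' : a ∈ T'.leaves) : T = T' := by
  by_contra hne
  have : Std.Symm (fun T T' : Forest n => List.Disjoint T.leaves T'.leaves) := ⟨fun _ _ h => h.symm⟩
  exact (pairwise_disjoint_trees hn).forall hT hT' hne ha ha'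

theorem ord_tree {f T : Forest n} (hn : f.leaves.Nodup) (hT : T ∈ f.trees) {i j : Fin n}
    (hi : i ∈ T.leaves) (hj : j ∈ T.leaves) : f.leaves.ord i j = T.leaves.ord i j := by
  rw [leaves_eq_flatMap] at hn ⊢
  obtain ⟨l, m, h⟩ := List.append_of_mem hT
  rw [h, List.flatMap_append, List.flatMap_cons] at hn ⊢
  have hd := List.disjoint_of_nodup_append hn
  rw [List.ord_append_right, List.ord_append_left hi hj]
  · exact fun h => hd h (by simp [hi])
  · exact fun h => hd h (by simp [hj])

theorem mem_edges_tree {f T : Forest n} (hn : f.leaves.Nodup) (hT : T ∈ f.trees)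
    {A : Finset (Fin n)} (hA : A ∈ f.edges) {a : Fin n} (ha : a ∈ A) (haT : a ∈ T.leaves) :
    A ∈ T.edges := by
  obtain ⟨T', hT', hA'⟩ := (mem_edges_iff f A).1 hA
  rwa [tree_eq_of_mem hn hT hT' haT (mem_labels.1 (subset_labels hA' ha))]

theorem ord_eq_of_perm {f g : Forest n} (hf : f.leaves.Nodup) (hg : g.leaves.Nodup)
    (h : f.trees.Perm g.trees) {A : Finset (Fin n)} (hA : A ∈ f.edges) {i j : Fin n} (hi : i ∈ A)
    (hj : j ∈ A) : f.leaves.ord i j = g.leaves.ord i j := by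
  obtain ⟨T, hT, hA'⟩ := (mem_edges_iff f A).1 hA
  have hi' := mem_labels.1 (subset_labels hA' hi)
  have hj' := mem_labels.1 (subset_labels hA' hj)
  rw [ord_tree hf hT hi' hj', ord_tree hg (h.mem_iff.1 hT) hi' hj']

/-- The trees of a forest are distinct, so it suffices that both forests have the same trees. A tree
with internal root edge is determined by its label set, the edges inside that set and the order on
it; the label set is the maximal edge through any of its leaves. -/
theorem perm_trees_of_ord_eq {f g : Forest n} (hf : f.Branching) (hg : g.Branching)
    (hnf : f.leaves.Nodup) (hng : g.leaves.Nodup) (hl : ∀ a, a ∈ f.leaves ↔ a ∈ g.leaves)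
    (he : f.edges = g.edges)
    (ho : ∀ A ∈ f.edges, ∀ i ∈ A, ∀ j ∈ A, i ≠ j → f.leaves.ord i j = g.leaves.ord i j) :
    f.trees.Perm g.trees := by
  have key : ∀ f g : Forest n, f.Branching → g.Branching → f.leaves.Nodup → g.leaves.Nodup →
      (∀ a, a ∈ f.leaves ↔ a ∈ g.leaves) → f.edges = g.edges →
      (∀ A ∈ f.edges, ∀ i ∈ A, ∀ j ∈ A, i ≠ j → f.leaves.ord i j = g.leaves.ord i j) →
      ∀ T ∈ f.trees, T ∈ g.trees := by
    intro f g hf hg hnf hng hl he ho T hT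
    obtain ⟨a, ha⟩ := List.exists_mem_of_ne_nil _ (leaves_tree_ne_nil hf hT)
    obtain ⟨T', hT', ha'⟩ := mem_leaves_iff.1 ((hl a).1 (mem_leaves_iff.2 ⟨T, hT, ha⟩))
    suffices h : T = T' by rwa [h]
    have hE : ∀ A, A ∈ T.edges ↔ A ∈ f.edges ∧ A ⊆ T.labels := by
      intro A
      refine ⟨fun h => ⟨(mem_edges_iff f A).2 ⟨T, hT, h⟩, subset_labels h⟩, fun ⟨h, h'⟩ => ?_⟩
      obtain ⟨i, hi⟩ := Finset.card_pos.1 (lt_of_lt_of_le (by norm_num) (two_le_card hf hnf h))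
      exact mem_edges_tree hnf hT h hi (mem_labels.1 (h' hi))
    have hE' : ∀ A, A ∈ T'.edges ↔ A ∈ g.edges ∧ A ⊆ T'.labels := by
      intro A
      refine ⟨fun h => ⟨(mem_edges_iff g A).2 ⟨T', hT', h⟩, subset_labels h⟩, fun ⟨h, h'⟩ => ?_⟩
      obtain ⟨i, hi⟩ := Finset.card_pos.1 (lt_of_lt_of_le (by norm_num) (two_le_card hg hng h))
      exact mem_edges_tree hng hT' h hi (mem_labels.1 (h' hi))
    -- The mixed cases are impossible: the root edge of one tree is an edge of the other forest
    -- through a, but a single leaf has no internal edge.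
    rcases tree_cases hT with ⟨b, rfl⟩ | ⟨c, rfl⟩ <;> rcases tree_cases hT' with ⟨b', rfl⟩ | ⟨c', rfl⟩
    · simp only [leaves, List.mem_singleton] at ha ha'
      rw [← ha, ← ha']
    · have h1 : (node c' nil).labels ∈ f.edges := by
        rw [he, mem_edges_iff]; exact ⟨_, hT', by simp [edges, labels, leaves]⟩
      have := mem_edges_tree hnf hT h1 (mem_labels.2 ha') ha
      simp [edges] at this
    · have h1 : (node c nil).labels ∈ g.edges := by
        rw [← he, mem_edges_iff]; exact ⟨_, hT, by simp [edges, labels, leaves]⟩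
      have := mem_edges_tree hng hT' h1 (mem_labels.2 ha) ha'
      simp [edges] at this
    · have h1 : (node c' nil).labels ∈ f.edges := by
        rw [he, mem_edges_iff]; exact ⟨_, hT', by simp [edges, labels, leaves]⟩
      have h2 : (node c nil).labels ∈ f.edges := by
        rw [mem_edges_iff]; exact ⟨_, hT, by simp [edges, labels, leaves]⟩
      have h3 := subset_labels (mem_edges_tree hnf hT h1 (mem_labels.2 ha') ha)
      have h4 := subset_labels (mem_edges_tree hng hT' (he ▸ h2) (mem_labels.2 ha) ha')
      have hlab := Finset.Subset.antisymm h4 h3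
      refine eq_of_leaves_eq (branching_tree hf hT) (branching_tree hg hT') (nodup_tree hnf hT) ?_ ?_
      · refine List.eq_of_ord_eq (nodup_tree hng hT') (nodup_tree hnf hT) ?_ ?_
        · intro x; rw [← mem_labels, ← mem_labels, hlab]
        · intro i hi j hj hij
          have hi' := mem_labels.1 (hlab ▸ mem_labels.2 hi)
          have hj' := mem_labels.1 (hlab ▸ mem_labels.2 hj)
          rw [← ord_tree hnf hT hi hj, ← ord_tree hng hT' hi' hj']
          exact ho _ h2 i (mem_labels.2 hi) j (mem_labels.2 hj) hij
      · ext A; rw [hE, hE', he, hlab]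
  rw [List.perm_ext_iff_of_nodup (nodup_trees hf hnf) (nodup_trees hg hng)]
  intro T
  exact ⟨key f g hf hg hnf hng hl he ho T, key g f hg hf hng hnf (fun a => (hl a).symm) he.symm
    (fun A hA i hi j hj hij => (ho A (he ▸ hA) i hi j hj hij).symm) T⟩

/-! Construction of forests -/

/-- The forest with the given sequence of trees. -/
def ofTrees (l : List (Forest n)) : Forest n := l.foldr append nil

theorem trees_ofTrees {l : List (Forest n)} (hl : ∀ T ∈ l, T.trees = [T]) :
    (ofTrees l).trees = l := by
  induction l with
  | nil => rfl
  | cons T l ih =>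
    rw [List.forall_mem_cons] at hl
    rw [show ofTrees (T :: l) = T.append (ofTrees l) from rfl, trees_append, hl.1, ih hl.2]
    rfl

theorem leaves_ofTrees (l : List (Forest n)) : (ofTrees l).leaves = l.flatMap leaves := by
  induction l with
  | nil => rfl
  | cons T l ih =>
    rw [show ofTrees (T :: l) = T.append (ofTrees l) from rfl, leaves_append, ih]
    rfl

theorem mem_edges_ofTrees (l : List (Forest n)) (A : Finset (Fin n)) :
    A ∈ (ofTrees l).edges ↔ ∃ T ∈ l, A ∈ T.edges := by
  induction l with
  | nil => simp [ofTrees, edges]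
  | cons T l ih =>
    rw [show ofTrees (T :: l) = T.append (ofTrees l) from rfl, edges_append]
    simp [ih]

theorem branching_ofTrees {l : List (Forest n)} (hl : ∀ T ∈ l, T.Branching) :
    (ofTrees l).Branching := by
  induction l with
  | nil => trivial
  | cons T l ih =>
    rw [List.forall_mem_cons] at hl
    exact branching_append hl.1 (ih hl.2)

/-- Sort the trees by the position in `l` of their first leaves. Since each tree is convex for `l`
among the listed leaves, comparing first leaves decides the comparison of any leaves of two trees.
-/
theorem exists_sorted_trees {l : List (Fin n)} (hmem : ∀ a, a ∈ l) {ts : List (Forest n)}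
    (hne : ∀ T ∈ ts, T.leaves ≠ []) (hnd : (ts.flatMap leaves).Nodup)
    (hord : ∀ T ∈ ts, ∀ i ∈ T.leaves, ∀ j ∈ T.leaves, i ≠ j → T.leaves.ord i j = l.ord i j)
    (hconv : ∀ T ∈ ts, ∀ i ∈ T.leaves, ∀ j ∈ T.leaves, ∀ k ∈ ts.flatMap leaves, k ∉ T.leaves →
      l.ord i k = l.ord j k) :
    ∃ ts' : List (Forest n), ts'.Perm ts ∧ (ts'.flatMap leaves).Pairwise (fun i j => l.ord i j = 1) := by
  -- The default 0 is never used, because every tree of `ts` has a leaf.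
  let key : Forest n → ℕ := fun T => T.leaves.head?.elim 0 (fun a => l.idxOf a)
  have hkey : ∀ T ∈ ts, ∃ a ∈ T.leaves, key T = l.idxOf a := by
    intro T hT
    obtain ⟨a, t, h⟩ := List.exists_cons_of_ne_nil (hne T hT)
    exact ⟨a, by simp [h], by simp [key, h]⟩
  have hp := List.perm_insertionSort (fun T T' => key T ≤ key T') ts
  refine ⟨_, hp, ?_⟩
  have : Std.Total (fun T T' => key T ≤ key T') := ⟨fun a b => le_total _ _⟩
  have : IsTrans _ (fun T T' => key T ≤ key T') := ⟨fun a b c => le_trans⟩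
  have hs := List.pairwise_insertionSort (fun T T' => key T ≤ key T') ts
  have hnd' := (List.nodup_flatMap.1 ((hp.flatMap_right _).nodup_iff.2 hnd))
  rw [List.pairwise_flatMap]
  constructor
  · intro T hT
    refine (List.pairwise_ord (hnd'.1 T hT)).and (hnd'.1 T hT) |>.imp_of_mem ?_
    rintro i j hi hj ⟨h, hij⟩
    rw [← hord T (hp.mem_iff.1 hT) i hi j hj hij, h]
  · refine (hs.and hnd'.2).imp_of_mem ?_
    rintro T T' hT hT' ⟨hle, hdis⟩ i hi j hj
    have hT := hp.mem_iff.1 hT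
    have hT' := hp.mem_iff.1 hT'
    obtain ⟨a, ha, hka⟩ := hkey T hT
    obtain ⟨b, hb, hkb⟩ := hkey T' hT'
    have hflat : ∀ T ∈ ts, ∀ x ∈ T.leaves, x ∈ ts.flatMap leaves := by
      intro T hT x hx; simp only [List.mem_flatMap]; exact ⟨T, hT, hx⟩
    have hab : a ≠ b := by rintro rfl; exact hdis ha hb
    have hij : i ≠ j := by rintro rfl; exact hdis hi hj
    have hib : i ≠ b := by rintro rfl; exact hdis hi hb
    have h1 : l.ord a b = 1 := by
      rw [List.ord_eq_one_iff]
      rw [hka, hkb] at hle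
      exact lt_of_le_of_ne hle fun h => hab ((List.idxOf_inj (hmem a)).1 h)
    -- Convexity of T replaces a by i, then convexity of T' replaces b by j.
    have h2 : l.ord i b = 1 := by
      rw [← h1]; exact hconv T hT i hi a ha b (hflat T' hT' b hb) (fun h => hdis h hb)
    have h3 : l.ord j i = l.ord b i :=
      hconv T' hT' j hj b hb i (hflat T hT i hi) (fun h => hdis hi h)
    rw [List.ord_swap (hmem i) hib, h2, List.ord_swap (hmem i) hij] at h3
    exact add_right_cancel h3

end Forest

/-- The forest is built from below in size: adding a set A of largest cardinality, the trees with
labels inside A are sorted by the order of A and grafted onto a new internal edge. The order `o A`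
is a list of all labels, but only its restriction to A matters. -/
theorem PF.exists_of_compatible {n : ℕ} (F : Finset (Finset (Fin n))) (o : Finset (Fin n) → List (Fin n))
    (hmem : ∀ A ∈ F, ∀ a, a ∈ o A) (h2 : ∀ A ∈ F, 2 ≤ A.card)
    (hlam : ∀ A ∈ F, ∀ B ∈ F, Disjoint A B ∨ A ⊆ B ∨ B ⊆ A)
    (hord : ∀ A ∈ F, ∀ B ∈ F, A ⊆ B → ∀ i ∈ A, ∀ j ∈ A, i ≠ j → (o A).ord i j = (o B).ord i j)
    (hconv : ∀ A ∈ F, ∀ B ∈ F, A ⊆ B → ∀ i ∈ A, ∀ j ∈ A, ∀ k ∈ B, k ∉ A →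
      (o B).ord i k = (o B).ord j k) :
    ∃ τ : PF n, τ.E = F ∧
      ∀ A ∈ F, ∀ i ∈ A, ∀ j ∈ A, i ≠ j → τ.forest.leaves.ord i j = (o A).ord i j := by
  induction F using Finset.induction_on_max_value (fun A : Finset (Fin n) => A.card) with
  | empty =>
    have hl : (Forest.ofTrees ((List.finRange n).map fun a => Forest.leaf a .nil)).leaves =
        List.finRange n := by
      rw [Forest.leaves_ofTrees, List.flatMap_map]
      simp [Forest.leaves]
    refine ⟨⟨Forest.ofTrees ((List.finRange n).map fun a => Forest.leaf a .nil), ?_, ?_, ?_⟩, ?_, ?_⟩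
    · refine Forest.branching_ofTrees fun T hT => ?_
      obtain ⟨a, _, rfl⟩ := List.mem_map.1 hT
      trivial
    · rw [hl]; exact List.nodup_finRange n
    · rw [hl]; exact List.mem_finRange
    · ext A
      simp only [PF.E, Forest.mem_edges_ofTrees, List.mem_map]
      simp [Forest.edges]
    · simp
  | insert A F hAF hmax ih =>
    obtain ⟨τ, hE, ho⟩ := ih (fun B hB => hmem B (Finset.mem_insert_of_mem hB))
      (fun B hB => h2 B (Finset.mem_insert_of_mem hB))
      (fun B hB C hC => hlam B (Finset.mem_insert_of_mem hB) C (Finset.mem_insert_of_mem hC))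
      (fun B hB C hC => hord B (Finset.mem_insert_of_mem hB) C (Finset.mem_insert_of_mem hC))
      (fun B hB C hC => hconv B (Finset.mem_insert_of_mem hB) C (Finset.mem_insert_of_mem hC))
    have hAA : A ∈ insert A F := Finset.mem_insert_self A F
    have hE' : τ.forest.edges = F := hE
    -- By the choice of A no earlier set properly contains it.
    have hFA : ∀ B ∈ F, Disjoint B A ∨ B ⊆ A := by
      intro B hB
      rcases hlam B (Finset.mem_insert_of_mem hB) A hAA with h | h | h
      · exact Or.inl h
      · exact Or.inr h
      · exact Or.inr (Finset.eq_of_subset_of_card_le h (hmax B hB)).symm.subset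
    have htree : ∀ T ∈ τ.forest.trees, (∃ a, T = Forest.leaf a .nil) ∨ T.labels ∈ F := by
      intro T hT
      rcases Forest.tree_cases hT with h | ⟨c, rfl⟩
      · exact Or.inl h
      · right
        rw [← hE', Forest.mem_edges_iff]
        exact ⟨_, hT, by simp [Forest.edges, Forest.labels, Forest.leaves]⟩
    have hTA : ∀ T ∈ τ.forest.trees, ∀ a ∈ T.leaves, a ∈ A → T.labels ⊆ A := by
      intro T hT a ha haA
      rcases htree T hT with ⟨b, rfl⟩ | h
      · simp only [Forest.leaves, List.mem_singleton] at ha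
        simpa [Forest.labels, Forest.leaves, ← ha] using haA
      · exact (hFA _ h).resolve_left fun hd =>
          Finset.disjoint_left.1 hd (Forest.mem_labels.2 ha) haA
    -- `ts` are the trees to be collected above the new edge, `us` those left untouched; by `hTA`
    -- every tree that meets A belongs to `ts`.
    set ts := τ.forest.trees.filter (fun T => T.labels ⊆ A) with hts
    set us := τ.forest.trees.filter (fun T => ¬ T.labels ⊆ A) with hus
    have hperm : (ts ++ us).Perm τ.forest.trees := by
      have := List.filter_append_perm (fun T : Forest n => decide (T.labels ⊆ A)) τ.forest.trees
      simpa [hts, hus] using this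
    have hts' : ∀ T ∈ ts, T ∈ τ.forest.trees ∧ T.labels ⊆ A := by
      intro T hT; simpa [hts] using hT
    have hndt : (ts.flatMap Forest.leaves ++ us.flatMap Forest.leaves).Nodup := by
      rw [← List.flatMap_append, (hperm.flatMap_right _).nodup_iff, ← Forest.leaves_eq_flatMap]
      exact τ.nodup
    have hmemA : ∀ a, a ∈ ts.flatMap Forest.leaves ↔ a ∈ A := by
      intro a
      rw [List.mem_flatMap]
      constructor
      · rintro ⟨T, hT, ha⟩
        exact (hts' T hT).2 (Forest.mem_labels.2 ha)
      · intro ha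
        obtain ⟨T, hT, haT⟩ := Forest.mem_leaves_iff.1 (τ.complete a)
        refine ⟨T, ?_, haT⟩
        rw [hts, List.mem_filter]
        exact ⟨hT, by simpa using hTA T hT a haT ha⟩
    obtain ⟨vs, hvs, hpw⟩ := Forest.exists_sorted_trees (l := o A) (hmem A hAA) (ts := ts)
      (fun T hT => Forest.leaves_tree_ne_nil τ.branching (hts' T hT).1)
      (List.nodup_append.1 hndt).1
      (by
        intro T hT i hi j hj hij
        rcases htree T (hts' T hT).1 with ⟨b, rfl⟩ | h
        · simp only [Forest.leaves, List.mem_singleton] at hi hj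
          exact absurd (hi.trans hj.symm) hij
        · have hi' := Forest.mem_labels.2 hi
          have hj' := Forest.mem_labels.2 hj
          rw [← Forest.ord_tree τ.nodup (hts' T hT).1 hi hj, ho _ h i hi' j hj' hij]
          exact hord _ (Finset.mem_insert_of_mem h) A hAA (hts' T hT).2 i hi' j hj' hij)
      (by
        intro T hT i hi j hj k hk hkT
        rcases htree T (hts' T hT).1 with ⟨b, rfl⟩ | h
        · simp only [Forest.leaves, List.mem_singleton] at hi hj
          rw [hi, hj]
        · exact hconv _ (Finset.mem_insert_of_mem h) A hAA (hts' T hT).2 i (Forest.mem_labels.2 hi) j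
            (Forest.mem_labels.2 hj) k ((hmemA k).1 hk) (Forest.mem_labels.not.2 hkT))
    have hvst : ∀ T ∈ vs, T ∈ τ.forest.trees ∧ T.labels ⊆ A := fun T hT => hts' T (hvs.mem_iff.1 hT)
    have hust : ∀ T ∈ us, T ∈ τ.forest.trees := fun T hT => (List.mem_filter.1 hT).1
    have hvl : (Forest.ofTrees vs).trees = vs :=
      Forest.trees_ofTrees fun T hT => Forest.trees_of_mem (hvst T hT).1
    have hul : (Forest.ofTrees us).trees = us :=
      Forest.trees_ofTrees fun T hT => Forest.trees_of_mem (hust T hT)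
    have hmemA' : ∀ a, a ∈ (Forest.ofTrees vs).leaves ↔ a ∈ A := by
      intro a
      rw [Forest.leaves_ofTrees, ← hmemA a]
      exact (hvs.flatMap_right _).mem_iff
    have hlabA : (Forest.ofTrees vs).labels = A := by
      ext a; rw [Forest.mem_labels, hmemA']
    have hlp : (Forest.node (Forest.ofTrees vs) (Forest.ofTrees us)).leaves.Perm τ.forest.leaves := by
      rw [Forest.leaves_eq_flatMap τ.forest]
      simp only [Forest.leaves, Forest.leaves_ofTrees]
      rw [← List.flatMap_append]
      exact ((hvs.append_right us).trans hperm).flatMap_right _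
    have hnd' := hlp.nodup_iff.2 τ.nodup
    have hbr : (Forest.node (Forest.ofTrees vs) (Forest.ofTrees us)).Branching := by
      refine ⟨?_, Forest.branching_ofTrees fun T hT => Forest.branching_tree τ.branching (hvst T hT).1,
        Forest.branching_ofTrees fun T hT => Forest.branching_tree τ.branching (hust T hT)⟩
      rw [hvl]
      by_contra hlt
      have hA2 := h2 A hAA
      -- No tree would make A empty. A single tree would make A a singleton or an earlier member of
      -- F.
      match vs, hlabA, hvst, hlt with
      | [], hlabA, _, _ => rw [← hlabA] at hA2; simp [Forest.ofTrees, Forest.labels, Forest.leaves] at hA2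
      | [T], hlabA, hvst, _ =>
        have hTl : T.labels = A := by
          rw [← hlabA]; simp [Forest.labels, Forest.leaves_ofTrees]
        rcases htree T (hvst T (by simp)).1 with ⟨b, rfl⟩ | h
        · rw [← hTl] at hA2; simp [Forest.labels, Forest.leaves] at hA2
        · exact hAF (hTl ▸ h)
      | _ :: _ :: _, _, _, hlt => simp at hlt
    refine ⟨⟨Forest.node (Forest.ofTrees vs) (Forest.ofTrees us), hbr, hnd',
      fun a => hlp.mem_iff.2 (τ.complete a)⟩, ?_, ?_⟩
    · ext B
      simp only [PF.E, Forest.edges, hlabA, Finset.mem_insert, Finset.mem_union,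
        Forest.mem_edges_ofTrees]
      rw [← hE', Forest.mem_edges_iff]
      simp only [← hperm.mem_iff, List.mem_append, ← hvs.mem_iff]
      refine or_congr_right ?_
      constructor
      · rintro (⟨T, h, h'⟩ | ⟨T, h, h'⟩)
        · exact ⟨T, Or.inl h, h'⟩
        · exact ⟨T, Or.inr h, h'⟩
      · rintro ⟨T, h | h, h'⟩
        · exact Or.inl ⟨T, h, h'⟩
        · exact Or.inr ⟨T, h, h'⟩
    · intro B hB i hi j hj hij
      rcases Finset.mem_insert.1 hB with rfl | hB
      · have hi' := (hmemA' i).2 hi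
        have hj' := (hmemA' j).2 hj
        simp only [Forest.leaves]
        rw [List.ord_append_left hi' hj']
        rw [Forest.leaves_ofTrees] at hi' hj' ⊢
        exact List.ord_eq_of_pairwise hpw hi' hj' hij
      -- An earlier set B lies in one tree, which has only been moved as a whole.
      · rw [← ho B hB i hi j hj hij]
        obtain ⟨T, hT, hBT⟩ := (Forest.mem_edges_iff _ _).1 (show B ∈ τ.forest.edges from hE' ▸ hB)
        have hi' := Forest.mem_labels.1 (Forest.subset_labels hBT hi)
        have hj' := Forest.mem_labels.1 (Forest.subset_labels hBT hj)
        rw [Forest.ord_tree τ.nodup hT hi' hj']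
        rcases List.mem_append.1 (hperm.mem_iff.2 hT) with h | h
        · have hTv : T ∈ (Forest.ofTrees vs).trees := by rw [hvl]; exact hvs.mem_iff.2 h
          simp only [Forest.leaves]
          rw [List.ord_append_left (Forest.mem_leaves_iff.2 ⟨T, hTv, hi'⟩)
            (Forest.mem_leaves_iff.2 ⟨T, hTv, hj'⟩), Forest.ord_tree (Forest.nodup_left hnd') hTv hi' hj']
        · refine Forest.ord_tree hnd' ?_ hi' hj'
          simp only [Forest.trees, List.mem_cons, hul]
          exact Or.inr h

end Cactus

/-! ### The gluing relation in closed form -/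

namespace Cactus

open CubeCx

/-- The number modulo `2` of those members of `D` to which both `i` and `j` belong. -/
def countBoth {n : ℕ} (D : Finset (Finset (Fin n))) (i j : Fin n) : ZMod 2 := ∑ A ∈ D, both i j A

/-- The common members are counted twice on the right, and twice is zero. -/
theorem sum_symmDiff_of_add_self {α H : Type*} [DecidableEq α] [AddCommGroup H] {f : α → H}
    (hf : ∀ a, f a + f a = 0) (S T : Finset α) :
    ∑ a ∈ symmDiff S T, f a = ∑ a ∈ S, f a + ∑ a ∈ T, f a := by
  have h1 : ∑ a ∈ symmDiff S T, f a = ∑ a ∈ S \ T, f a + ∑ a ∈ T \ S, f a := by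
    rw [symmDiff_def, Finset.sup_eq_union, Finset.sum_union disjoint_sdiff_sdiff]
  have h2 : ∑ a ∈ S ∩ T, f a + ∑ a ∈ S ∩ T, f a = 0 := by
    rw [← Finset.sum_add_distrib]; exact Finset.sum_eq_zero fun a _ => hf a
  have h3 := Finset.sum_inter_add_sum_sdiff S T f
  have h4 := Finset.sum_inter_add_sum_sdiff T S f
  rw [Finset.inter_comm] at h4
  rw [h1, ← h3, ← h4, add_add_add_comm, h2, zero_add]

theorem add_four_of_add_self {H : Type*} [AddCommGroup H] {a b c d : H} (h : b + b = 0) :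
    a + c + d = a + b + (b + c + d) := by
  have : a + b + (b + c + d) = (b + b) + (a + c + d) := by abel
  rw [this, h, zero_add]

theorem countBoth_symmDiff {n : ℕ} (D D' : Finset (Finset (Fin n))) (i j : Fin n) :
    countBoth (symmDiff D D') i j = countBoth D i j + countBoth D' i j :=
  sum_symmDiff_of_add_self (fun _ => CharTwo.add_self_eq_zero _) D D'

namespace PF

variable {n : ℕ}

/-- The order of the leaves of `τ`. -/
def ord (τ : PF n) (i j : Fin n) : ZMod 2 := τ.forest.leaves.ord i j

theorem ord_reflect (τ : PF n) {S : Finset (Finset (Fin n))} (hS : S ⊆ τ.E) {i j : Fin n}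
    (hij : i ≠ j) : (τ.reflect S).ord i j = τ.ord i j + countBoth S i j := by
  have h := Forest.ord_reflect τ.branching τ.nodup S hij (τ.complete i) (τ.complete j)
  rw [← Finset.sum_filter, Finset.filter_mem_eq_inter, Finset.inter_eq_right.2 hS] at h
  exact h

theorem E_delete (τ : PF n) (e : Finset (Fin n)) : (τ.delete e).E = τ.E.erase e :=
  Forest.edges_delete τ.branching τ.nodup e

theorem ord_delete (τ : PF n) (e : Finset (Fin n)) (i j : Fin n) :
    (τ.delete e).ord i j = τ.ord i j := by
  unfold ord delete
  simp only [Forest.leaves_delete]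

theorem SameTrees.ord_eq {τ τ' : PF n} (h : τ.SameTrees τ') {A : Finset (Fin n)} (hA : A ∈ τ.E)
    {i j : Fin n} (hi : i ∈ A) (hj : j ∈ A) : τ.ord i j = τ'.ord i j :=
  Forest.ord_eq_of_perm τ.nodup τ'.nodup h hA hi hj

theorem sameTrees_of_ord_eq {τ τ' : PF n} (hE : τ.E = τ'.E)
    (ho : ∀ A ∈ τ.E, ∀ i ∈ A, ∀ j ∈ A, i ≠ j → τ.ord i j = τ'.ord i j) : τ.SameTrees τ' :=
  Forest.perm_trees_of_ord_eq τ.branching τ'.branching τ.nodup τ'.nodup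
    (fun a => iff_of_true (τ.complete a) (τ'.complete a)) hE ho

/-- Collapse the edges outside F one at a time; this never moves a leaf. -/
theorem exists_restrict (τ : PF n) {F : Finset (Finset (Fin n))} (hF : F ⊆ τ.E) :
    ∃ τ' : PF n, τ'.E = F ∧ ∀ i j, τ'.ord i j = τ.ord i j := by
  induction hk : (τ.E \ F).card generalizing τ with
  | zero =>
    rw [Finset.card_eq_zero, Finset.sdiff_eq_empty_iff_subset] at hk
    exact ⟨τ, hk.antisymm hF, fun _ _ => rfl⟩
  | succ k ih =>
    obtain ⟨e, he⟩ := Finset.card_pos.1 (by rw [hk]; exact Nat.succ_pos k)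
    have he' := Finset.mem_sdiff.1 he
    obtain ⟨τ', h1, h2⟩ := ih (τ.delete e) (by
        rw [E_delete]; exact fun A hA => Finset.mem_erase.2 ⟨fun h => he'.2 (h ▸ hA), hF hA⟩) (by
        rw [E_delete, Finset.erase_sdiff_comm, Finset.card_erase_of_mem he, hk]; rfl)
    exact ⟨τ', h1, fun i j => (h2 i j).trans (ord_delete τ e i j)⟩

end PF

section Points

variable {n : ℕ} {G : Type}

/-- The coordinate of a point of a subcube which belongs to the label set `A`; it is `1` if `A` does
not belong to an internal edge. -/
def coord (p : Subcubes n G) (A : Finset (Fin n)) : ℝ :=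
  if h : A ∈ p.1.1.E then (p.2 ⟨A, h⟩).1 else 1

theorem coord_of_mem (p : Subcubes n G) {A : Finset (Fin n)} (h : A ∈ p.1.1.E) :
    coord p A = (p.2 ⟨A, h⟩).1 := dif_pos h

theorem coord_of_notMem (p : Subcubes n G) {A : Finset (Fin n)} (h : A ∉ p.1.1.E) :
    coord p A = 1 := dif_neg h

theorem mem_of_coord_ne_one {p : Subcubes n G} {A : Finset (Fin n)} (h : coord p A ≠ 1) :
    A ∈ p.1.1.E := by
  by_contra h'
  exact h (coord_of_notMem p h')

theorem coord_mk (τ : PF n) (s : G) (t : τ.E → Set.Icc (0 : ℝ) 1) (A : Finset (Fin n)) :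
    coord ⟨(τ, s), t⟩ A = if h : A ∈ τ.E then (t ⟨A, h⟩).1 else 1 := rfl

/-- The coordinate of a point of `[-1,1]^{E(τ)}` which belongs to the label set `A`; it is `1` if `A`
does not belong to an internal edge. -/
def signedCoord {τ : PF n} (x : τ.E → J) (A : Finset (Fin n)) : ℝ :=
  if h : A ∈ τ.E then (x ⟨A, h⟩).1 else 1

theorem signedCoord_of_mem {τ : PF n} (x : τ.E → J) {A : Finset (Fin n)} (h : A ∈ τ.E) :
    signedCoord x A = (x ⟨A, h⟩).1 := dif_pos h

theorem signedCoord_of_notMem {τ : PF n} (x : τ.E → J) {A : Finset (Fin n)} (h : A ∉ τ.E) :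
    signedCoord x A = 1 := dif_neg h

theorem mem_negCoords {τ : PF n} {x : τ.E → J} {A : Finset (Fin n)} :
    A ∈ negCoords x ↔ signedCoord x A < 0 := by
  unfold negCoords signedCoord
  by_cases h : A ∈ τ.E
  · simp [h]
  · simp only [Finset.mem_map, Finset.mem_filter, h]
    simp only [dite_false]
    constructor
    · rintro ⟨a, _, rfl⟩; exact absurd a.2 h
    · intro h; norm_num at h

theorem negCoords_subset {τ : PF n} (x : τ.E → J) : negCoords x ⊆ τ.E := by
  intro A hA
  by_contra h
  rw [mem_negCoords, signedCoord_of_notMem x h] at hA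
  norm_num at hA

theorem coord_cubeMap (τ : PF n) (s : G) (x : τ.E → J) (A : Finset (Fin n)) :
    coord ⟨(τ.reflect (negCoords x), s),
      fun f => absJ (x ⟨f.1, τ.E_reflect_subset (negCoords x) f.2⟩)⟩ A = |signedCoord x A| := by
  simp only [coord_mk, signedCoord, PF.E_reflect, absJ]
  split_ifs <;> simp

variable [AddCommGroup G] {w : Finset (Fin n) → G}

variable (w) in
/-- The description of the identifications made in `Glued w`. -/
def Rel (p q : Subcubes n G) : Prop :=
  ∃ D : Finset (Finset (Fin n)), (∀ A ∈ D, coord p A = 0) ∧ (∀ A, coord q A = coord p A) ∧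
    q.1.2 = p.1.2 + ∑ A ∈ D, w A ∧
    ∀ i j, i ≠ j → (∃ A, i ∈ A ∧ j ∈ A ∧ coord p A ≠ 1) →
      q.1.1.ord i j = p.1.1.ord i j + countBoth D i j

theorem Rel.refl (p : Subcubes n G) : Rel w p p :=
  ⟨∅, by simp, fun _ => rfl, by simp, by simp [countBoth]⟩

theorem add_sum_cancel (hw : ∀ e, w e + w e = 0) {a b : G} {D : Finset (Finset (Fin n))}
    (h : a = b + ∑ A ∈ D, w A) : b = a + ∑ A ∈ D, w A := by
  rw [h, add_assoc, ← Finset.sum_add_distrib, Finset.sum_eq_zero fun A _ => hw A, add_zero]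

theorem Rel.symm (hw : ∀ e, w e + w e = 0) {p q : Subcubes n G} (h : Rel w p q) : Rel w q p := by
  obtain ⟨D, h1, h2, h3, h4⟩ := h
  refine ⟨D, fun A hA => (h2 A).trans (h1 A hA), fun A => (h2 A).symm, add_sum_cancel hw h3, ?_⟩
  rintro i j hij ⟨A, hi, hj, hA⟩
  rw [h4 i j hij ⟨A, hi, hj, h2 A ▸ hA⟩, add_assoc, CharTwo.add_self_eq_zero, add_zero]

/-- Successive flips combine by symmetric difference, since flipping twice along an edge has no
effect on the order, and none on the index because w e + w e = 0. -/
theorem Rel.trans (hw : ∀ e, w e + w e = 0) {p q r : Subcubes n G} (h : Rel w p q)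
    (h' : Rel w q r) : Rel w p r := by
  obtain ⟨D, h1, h2, h3, h4⟩ := h
  obtain ⟨D', h1', h2', h3', h4'⟩ := h'
  refine ⟨symmDiff D D', ?_, fun A => (h2' A).trans (h2 A), ?_, ?_⟩
  · intro A hA
    rcases Finset.mem_symmDiff.1 hA with h | h
    · exact h1 A h.1
    · rw [← h2 A]; exact h1' A h.1
  · rw [sum_symmDiff_of_add_self hw, h3', h3, add_assoc]
  · rintro i j hij ⟨A, hi, hj, hA⟩
    rw [countBoth_symmDiff, h4' i j hij ⟨A, hi, hj, (h2 A).symm ▸ hA⟩, h4 i j hij ⟨A, hi, hj, hA⟩,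
      add_assoc]

/-- The default coordinate 1 makes a deletion invisible. Deletions and permutations correspond to D
= ∅, a flip at e to D = {e}. -/
theorem Rel.of_glue {p q : Subcubes n G} (h : Glue w p q) : Rel w p q := by
  rcases h with ⟨τ, s, t, e, h⟩ | ⟨τ, τ', s, t, h⟩ | ⟨τ, s, t, e, h⟩
  · refine ⟨∅, by simp, fun A => ?_, by simp, fun i j _ _ => ?_⟩
    · simp only [coord_mk, PF.E_delete, Finset.mem_erase]
      by_cases hA : A ∈ τ.E
      · by_cases hAe : A = e.1
        · subst hAe; simp [h]
        · simp [hA, hAe]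
      · simp [hA]
    · simp only [countBoth, Finset.sum_empty, add_zero]
      exact PF.ord_delete τ e i j
  · refine ⟨∅, by simp, fun A => ?_, by simp, ?_⟩
    · simp only [coord_mk, h.E_eq]
    · rintro i j _ ⟨A, hi, hj, hA⟩
      simp only [countBoth, Finset.sum_empty, add_zero]
      exact (h.ord_eq (mem_of_coord_ne_one hA) hi hj).symm
  · refine ⟨{e.1}, ?_, fun A => ?_, by simp, fun i j hij _ => ?_⟩
    · intro A hA
      rw [Finset.mem_singleton] at hA
      subst hA
      rw [coord_of_mem _ e.2]
      exact h
    · simp only [coord_mk, PF.E_reflect]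
    · exact PF.ord_reflect τ (Finset.singleton_subset_iff.2 e.2) hij

theorem Rel.of_mk_eq (hw : ∀ e, w e + w e = 0) {p q : Subcubes n G}
    (h : Quot.mk (Glue w) p = Quot.mk (Glue w) q) : Rel w p q := by
  have := Quot.eqvGen_exact h
  clear h
  induction this with
  | rel _ _ h => exact Rel.of_glue h
  | refl _ => exact Rel.refl _
  | symm _ _ _ ih => exact ih.symm hw
  | trans _ _ _ _ _ ih ih' => exact ih.trans hw ih'

theorem exists_delete_of_coord_eq_one (p : Subcubes n G) {F : Finset (Finset (Fin n))}
    (hF : F ⊆ p.1.1.E) (h : ∀ A, A ∉ F → coord p A = 1) :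
    ∃ q : Subcubes n G, Quot.mk (Glue w) p = Quot.mk (Glue w) q ∧ (∀ A, coord q A = coord p A) ∧
      q.1.2 = p.1.2 ∧ q.1.1.E = F ∧ ∀ i j, q.1.1.ord i j = p.1.1.ord i j := by
  induction hk : (p.1.1.E \ F).card generalizing p with
  | zero =>
    rw [Finset.card_eq_zero, Finset.sdiff_eq_empty_iff_subset] at hk
    exact ⟨p, rfl, fun _ => rfl, rfl, hk.antisymm hF, fun _ _ => rfl⟩
  | succ k ih =>
    obtain ⟨e, he⟩ := Finset.card_pos.1 (by rw [hk]; exact Nat.succ_pos k)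
    have he' := Finset.mem_sdiff.1 he
    obtain ⟨⟨τ, s⟩, t⟩ := p
    have ht : (t ⟨e, he'.1⟩).1 = 1 := by
      have := h e he'.2
      rwa [coord_of_mem _ he'.1] at this
    have hg := Glue.outward (w := w) τ s t ⟨e, he'.1⟩ ht
    obtain ⟨D, hD, hc, -, -⟩ := Rel.of_glue hg
    obtain ⟨q, h1, h2, h3, h4, h5⟩ := ih _ (by
        rw [PF.E_delete]; exact fun A hA => Finset.mem_erase.2 ⟨fun h => he'.2 ((show A = e from h) ▸ hA), hF hA⟩)
      (fun A hA => (hc A).trans (h A hA)) (by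
        rw [PF.E_delete, Finset.erase_sdiff_comm, Finset.card_erase_of_mem he, hk]; rfl)
    refine ⟨q, (Quot.sound hg).trans h1, fun A => (h2 A).trans (hc A), h3, h4, fun i j => ?_⟩
    rw [h5, PF.ord_delete]

/-- Repeated inward gluings; the coordinates do not change, so each edge of D keeps coordinate 0
until its turn. -/
theorem exists_flip (p : Subcubes n G) {D : Finset (Finset (Fin n))}
    (h : ∀ A ∈ D, coord p A = 0) :
    ∃ q : Subcubes n G, Quot.mk (Glue w) p = Quot.mk (Glue w) q ∧ (∀ A, coord q A = coord p A) ∧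
      q.1.2 = p.1.2 + ∑ A ∈ D, w A ∧ q.1.1.E = p.1.1.E ∧
      ∀ i j, i ≠ j → q.1.1.ord i j = p.1.1.ord i j + countBoth D i j := by
  induction D using Finset.induction_on with
  | empty => exact ⟨p, rfl, fun _ => rfl, by simp, rfl, by simp [countBoth]⟩
  | insert e D he ih =>
    obtain ⟨⟨⟨τ, s⟩, t⟩, h1, h2, h3, h4, h5⟩ := ih fun A hA => h A (Finset.mem_insert_of_mem hA)
    have h0 : coord ⟨(τ, s), t⟩ e = 0 := (h2 e).trans (h e (Finset.mem_insert_self _ _))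
    have heE : e ∈ τ.E := mem_of_coord_ne_one (p := ⟨(τ, s), t⟩) (by rw [h0]; norm_num)
    have hg := Glue.inward (w := w) τ s t ⟨e, heE⟩ (by rw [coord_of_mem _ heE] at h0; exact h0)
    obtain ⟨D', -, hc, -, -⟩ := Rel.of_glue hg
    refine ⟨_, h1.trans (Quot.sound hg), fun A => (hc A).trans (h2 A), ?_, ?_, fun i j hij => ?_⟩
    · rw [Finset.sum_insert he, add_comm (w e), ← add_assoc, ← h3]
    · exact (PF.E_reflect τ {e}).trans h4
    · rw [countBoth, Finset.sum_insert he, add_comm (both i j e), ← add_assoc, ← countBoth,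
        ← h5 i j hij]
      refine (PF.ord_reflect τ (Finset.singleton_subset_iff.2 heE) hij).trans ?_
      simp [countBoth]

theorem mk_eq_of_sameTrees {p q : Subcubes n G} (hE : p.1.1.E = q.1.1.E) (hs : q.1.2 = p.1.2)
    (hc : ∀ A, coord q A = coord p A)
    (ho : ∀ A ∈ p.1.1.E, ∀ i ∈ A, ∀ j ∈ A, i ≠ j → p.1.1.ord i j = q.1.1.ord i j) :
    Quot.mk (Glue w) p = Quot.mk (Glue w) q := by
  obtain ⟨⟨τ, s⟩, t⟩ := p
  obtain ⟨⟨τ', s'⟩, t'⟩ := q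
  dsimp only at hE hs ho
  subst hs
  have h := PF.sameTrees_of_ord_eq hE ho
  refine (Quot.sound (Glue.perm (w := w) τ τ' s' t h)).trans ?_
  congr 2
  funext f
  have := hc f.1
  rw [coord_of_mem _ f.2, coord_of_mem _ (h.E_eq.subset f.2)] at this
  exact Subtype.ext this.symm

/-- Flip p along D, then collapse in both points every edge with coordinate 1. The resulting forests
have the same edges and the same order above each of them, so they differ by a permutation of trees.
-/
theorem mk_eq_of_rel {p q : Subcubes n G} (h : Rel w p q) :
    Quot.mk (Glue w) p = Quot.mk (Glue w) q := by
  obtain ⟨D, h1, h2, h3, h4⟩ := h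
  obtain ⟨p', hp1, hp2, hp3, hp4, hp5⟩ := exists_flip (w := w) p h1
  have hsub : ∀ p : Subcubes n G, (p.1.1.E.filter fun A => coord p A ≠ 1) ⊆ p.1.1.E :=
    fun p => Finset.filter_subset _ _
  have hnot : ∀ (p : Subcubes n G) (A), A ∉ (p.1.1.E.filter fun A => coord p A ≠ 1) →
      coord p A = 1 := by
    intro p A hA
    by_contra h
    exact hA (Finset.mem_filter.2 ⟨mem_of_coord_ne_one h, h⟩)
  obtain ⟨a, ha1, ha2, ha3, ha4, ha5⟩ := exists_delete_of_coord_eq_one (w := w) p' (hsub p') (hnot p')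
  obtain ⟨b, hb1, hb2, hb3, hb4, hb5⟩ := exists_delete_of_coord_eq_one (w := w) q (hsub q) (hnot q)
  rw [hp1, ha1, hb1]
  apply mk_eq_of_sameTrees
  · rw [ha4, hb4]
    ext A
    simp only [Finset.mem_filter]
    constructor
    · rintro ⟨_, h⟩
      have : coord q A ≠ 1 := by rwa [h2, ← hp2]
      exact ⟨mem_of_coord_ne_one this, this⟩
    · rintro ⟨_, h⟩
      have : coord p' A ≠ 1 := by rwa [hp2, ← h2]
      exact ⟨mem_of_coord_ne_one this, this⟩
  · rw [ha3, hb3, hp3, h3]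
  · intro A; rw [ha2, hb2, hp2, h2]
  · intro A hA i hi j hj hij
    rw [ha4, Finset.mem_filter] at hA
    rw [ha5, hb5, hp5 i j hij, h4 i j hij ⟨A, hi, hj, hp2 A ▸ hA.2⟩]

theorem mk_eq_iff (hw : ∀ e, w e + w e = 0) {p q : Subcubes n G} :
    Quot.mk (Glue w) p = Quot.mk (Glue w) q ↔ Rel w p q :=
  ⟨Rel.of_mk_eq hw, mk_eq_of_rel⟩

/-- The identifications between points of cubes. -/
theorem cubeMap_eq_iff (hw : ∀ e, w e + w e = 0) {τ τ' : PF n} {s s' : G} {x : τ.E → J}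
    {x' : τ'.E → J} :
    cubeMap w τ s x = cubeMap w τ' s' x' ↔ ∃ D : Finset (Finset (Fin n)),
      (∀ A, signedCoord x' A = if A ∈ D then -signedCoord x A else signedCoord x A) ∧
      s' = s + ∑ A ∈ D, w A ∧
      ∀ i j, i ≠ j → (∃ A, i ∈ A ∧ j ∈ A ∧ |signedCoord x A| ≠ 1) →
        τ'.ord i j = τ.ord i j + countBoth D i j := by
  refine (mk_eq_iff hw).trans ?_
  simp only [Rel, coord_cubeMap]
  constructor
  · rintro ⟨D, h1, h2, h3, h4⟩
    -- `cubeMap` has already flipped each forest along the negative coordinates. Passing between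
    -- flips of unsigned points and sign changes of signed points thus adds both sets of negative
    -- coordinates modulo 2; the same formula serves for the converse.
    refine ⟨symmDiff (symmDiff (negCoords x) D) (negCoords x'), ?_, ?_, ?_⟩
    · intro A
      have h2 := h2 A
      by_cases hD : A ∈ D
      · have h1 := h1 A hD
        rw [h1, abs_eq_zero] at h2
        rw [abs_eq_zero] at h1
        simp [h1, h2]
      · simp only [Finset.mem_symmDiff, mem_negCoords, hD]
        rcases lt_or_ge (signedCoord x A) 0 with h | h <;>
          rcases lt_or_ge (signedCoord x' A) 0 with h' | h'
        · rw [abs_of_neg h, abs_of_neg h', neg_inj] at h2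
          simp [h, h2]
        · rw [abs_of_neg h, abs_of_nonneg h'] at h2
          simp [h, h2, h.le]
        · rw [abs_of_nonneg h, abs_of_neg h'] at h2
          rw [← h2]
          simp [h']
          intro h''
          linarith
        · rw [abs_of_nonneg h, abs_of_nonneg h'] at h2
          simp [h2, not_lt.2 h]
    · rw [sum_symmDiff_of_add_self hw, sum_symmDiff_of_add_self hw, ← add_assoc, ← add_assoc, ← h3]
      exact add_sum_cancel hw rfl
    · intro i j hij h
      have := h4 i j hij h
      rw [PF.ord_reflect _ (negCoords_subset x) hij, PF.ord_reflect _ (negCoords_subset x') hij] at this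
      rw [countBoth_symmDiff, countBoth_symmDiff, ← add_assoc, ← add_assoc, ← this, add_assoc,
        CharTwo.add_self_eq_zero, add_zero]
  · rintro ⟨D, h1, h2, h3⟩
    refine ⟨symmDiff (symmDiff (negCoords x) D) (negCoords x'), ?_, ?_, ?_, ?_⟩
    · intro A hA
      have h1 := h1 A
      simp only [Finset.mem_symmDiff, mem_negCoords] at hA
      rw [abs_eq_zero]
      by_cases hD : A ∈ D <;> simp only [hD, if_true, if_false] at h1 <;>
        rw [h1] at hA <;> simp only [hD] at hA
      · rcases lt_trichotomy (signedCoord x A) 0 with h | h | h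
        · simp [h, h.le] at hA
          linarith
        · exact h
        · simp [h, h.le] at hA
      · simp at hA; linarith
    · intro A
      rw [h1 A]
      split_ifs <;> simp
    · rw [sum_symmDiff_of_add_self hw, sum_symmDiff_of_add_self hw, h2]
      have h : ∑ A ∈ negCoords x, w A + ∑ A ∈ negCoords x, w A = 0 := by
        rw [← Finset.sum_add_distrib]; exact Finset.sum_eq_zero fun a _ => hw a
      exact add_four_of_add_self h
    · intro i j hij h
      rw [PF.ord_reflect _ (negCoords_subset x) hij, PF.ord_reflect _ (negCoords_subset x') hij,
        countBoth_symmDiff, countBoth_symmDiff, h3 i j hij h]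
      have h : countBoth (negCoords x) i j + countBoth (negCoords x) i j = 0 :=
        CharTwo.add_self_eq_zero _
      exact add_four_of_add_self h

/-- The inclusion of `[0,1]` into `[-1,1]`. -/
def unitToJ (t : Set.Icc (0 : ℝ) 1) : J := ⟨t.1, (by norm_num : (-1 : ℝ) ≤ 0).trans t.2.1, t.2.2⟩

/-- A subcube is the part of its cube with nonnegative coordinates, where nothing is flipped. -/
theorem mk_eq_cubeMap (p : Subcubes n G) :
    (Quot.mk (Glue w) p : Glued w) = cubeMap w p.1.1 p.1.2 (fun e => unitToJ (p.2 e)) := by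
  have hs : ∀ A, signedCoord (fun e => unitToJ (p.2 e)) A = coord p A := fun A => rfl
  have hp : ∀ A, 0 ≤ coord p A := by
    intro A
    unfold coord
    split_ifs
    · exact (p.2 _).2.1
    · norm_num
  have hN : negCoords (fun e => unitToJ (p.2 e)) = ∅ := by
    rw [Finset.eq_empty_iff_forall_notMem]
    intro A hA
    rw [mem_negCoords, hs] at hA
    exact absurd hA (not_lt.2 (hp A))
  refine mk_eq_of_rel ⟨∅, by simp, fun A => ?_, by simp [hN], fun i j hij _ => ?_⟩
  · rw [coord_cubeMap, hs, abs_of_nonneg (hp A)]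
  · rw [PF.ord_reflect _ (negCoords_subset _) hij, hN]

end Points

end Cactus

/-! ### The cubes form a cube complex -/

namespace Cactus

open CubeCx

section CubeComplex

variable {n : ℕ} {G : Type} [AddCommGroup G] {w : Finset (Fin n) → G}

theorem coe_neg (x : J) : (J.neg x).1 = -x.1 := rfl

theorem J.neg_neg (x : J) : J.neg (J.neg x) = x := Subtype.ext (by simp [coe_neg])

/-- The sufficient half of `cubeMap_eq_iff` for forests with the same internal edges, where D is the
set of reflected coordinates. -/
theorem cubeMap_eq_of_E_eq (hw : ∀ e, w e + w e = 0) {τ τ' : PF n} {s s' : G} {x : τ.E → J}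
    {x' : τ'.E → J} (hE : τ'.E = τ.E) {D : Finset (Finset (Fin n))} (hD : D ⊆ τ.E)
    (hs : s' = s + ∑ A ∈ D, w A)
    (ho : ∀ A ∈ τ.E, ∀ i ∈ A, ∀ j ∈ A, i ≠ j → τ'.ord i j = τ.ord i j + countBoth D i j)
    (hx : ∀ A (h : A ∈ τ.E) (h' : A ∈ τ'.E),
      x' ⟨A, h'⟩ = if A ∈ D then (x ⟨A, h⟩).neg else x ⟨A, h⟩) :
    cubeMap w τ s x = cubeMap w τ' s' x' := by
  rw [cubeMap_eq_iff hw]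
  refine ⟨D, fun A => ?_, hs, ?_⟩
  · by_cases h : A ∈ τ.E
    · have h' := hE.symm ▸ h
      rw [signedCoord_of_mem x h, signedCoord_of_mem x' h', hx A h h']
      split_ifs <;> rfl
    · have h' := hE.symm ▸ h
      rw [signedCoord_of_notMem x h, signedCoord_of_notMem x' h', if_neg fun hA => h (hD hA)]
  · rintro i j hij ⟨A, hi, hj, hA⟩
    refine ho A ?_ i hi j hj hij
    by_contra h
    rw [signedCoord_of_notMem x h, abs_one] at hA
    exact hA rfl

/-- Sign changes on D are absorbed by flipping τ along D and shifting s; a permutation of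
coordinates only changes the indexing of the edges. -/
theorem gluedCubes_isometry_mem (hw : ∀ e, w e + w e = 0) {k : ℕ} {φ : Cube k → Glued w}
    (hφ : φ ∈ (gluedCubes w).cubes k) (σ : Fin k ≃ Fin k) (ε : Fin k → Bool) :
    (fun x => φ (cubeIso σ ε x)) ∈ (gluedCubes w).cubes k := by
  obtain ⟨τ, s, b, rfl⟩ := hφ
  let D : Finset (Finset (Fin n)) :=
    (Finset.univ.filter fun e : τ.E => ε (b e)).map (Function.Embedding.subtype _)
  have hD : ∀ A (h : A ∈ τ.E), A ∈ D ↔ ε (b ⟨A, h⟩) = true := by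
    intro A h
    simp only [D, Finset.mem_map, Finset.mem_filter, Finset.mem_univ, true_and]
    constructor
    · rintro ⟨a, ha, rfl⟩; exact ha
    · intro h'; exact ⟨_, h', rfl⟩
  have hDE : D ⊆ τ.E := by
    intro A hA
    obtain ⟨a, _, rfl⟩ := Finset.mem_map.1 hA
    exact a.2
  refine ⟨τ.reflect D, s + ∑ A ∈ D, w A,
    ((Equiv.subtypeEquivRight fun A => by rw [PF.E_reflect]).trans b).trans σ, ?_⟩
  funext x
  refine cubeMap_eq_of_E_eq hw (PF.E_reflect τ D) hDE rfl ?_ ?_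
  · intro A _ i _ j _ hij
    exact PF.ord_reflect τ hDE hij
  · intro A h h'
    change x (σ (b ⟨A, h⟩)) = if A ∈ D then (if ε (b ⟨A, h⟩) then (x (σ (b ⟨A, h⟩))).neg
      else x (σ (b ⟨A, h⟩))).neg else if ε (b ⟨A, h⟩) then (x (σ (b ⟨A, h⟩))).neg
      else x (σ (b ⟨A, h⟩))
    simp only [hD A h]
    split_ifs <;> simp [J.neg_neg]

theorem exists_equiv_of_image {k : ℕ} {E : Finset (Finset (Fin n))} {a : Fin k → Finset (Fin n)}
    (ha : Function.Injective a) (hE : ∀ A, A ∈ E ↔ ∃ m, a m = A) :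
    ∃ b : E ≃ Fin k, ∀ m, (b.symm m).1 = a m := by
  refine ⟨(Equiv.ofBijective (fun m => (⟨a m, (hE _).2 ⟨m, rfl⟩⟩ : E)) ⟨?_, ?_⟩).symm, fun m => rfl⟩
  · intro m m' h
    exact ha (congrArg Subtype.val h)
  · rintro ⟨A, hA⟩
    obtain ⟨m, rfl⟩ := (hE A).1 hA
    exact ⟨m, rfl⟩

/-- The face where the coordinate of e is 1 is the cube of d_e(τ), because 1 is the default
coordinate of a missing edge. -/
theorem gluedCubes_face_top_mem (hw : ∀ e, w e + w e = 0) {k : ℕ} {φ : Cube (k + 1) → Glued w}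
    (hφ : φ ∈ (gluedCubes w).cubes (k + 1)) (i : Fin (k + 1)) :
    (fun x : Cube k => φ (Fin.insertNth (α := fun _ => J) i J.top x)) ∈ (gluedCubes w).cubes k := by
  obtain ⟨τ, s, b, rfl⟩ := hφ
  obtain ⟨b', hb'⟩ := exists_equiv_of_image (k := k) (E := (τ.delete (b.symm i).1).E)
    (a := fun m => (b.symm (i.succAbove m)).1)
    (fun m m' h => Fin.succAbove_right_injective (b.symm.injective (Subtype.ext h))) (by
      intro A
      rw [PF.E_delete, Finset.mem_erase]
      constructor
      · rintro ⟨h1, h2⟩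
        obtain ⟨m, hm⟩ := Fin.exists_succAbove_eq (x := b ⟨A, h2⟩) (y := i) (by
          rintro rfl; simp at h1)
        exact ⟨m, by rw [hm, Equiv.symm_apply_apply]⟩
      · rintro ⟨m, rfl⟩
        refine ⟨fun h => ?_, Subtype.property _⟩
        exact Fin.succAbove_ne i m (b.symm.injective (Subtype.ext h)))
  refine ⟨τ.delete (b.symm i).1, s, b', ?_⟩
  funext x
  rw [cubeMap_eq_iff hw]
  refine ⟨∅, fun A => ?_, by simp, fun i j _ _ => by simp [countBoth, PF.ord_delete]⟩
  by_cases h : A ∈ τ.E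
  · by_cases h' : A ∈ (τ.delete (b.symm i).1).E
    · have : b ⟨A, h⟩ = i.succAbove (b' ⟨A, h'⟩) := by
        rw [← Equiv.eq_symm_apply]
        apply Subtype.ext
        rw [← hb', Equiv.symm_apply_apply]
      rw [signedCoord_of_mem _ h, signedCoord_of_mem _ h', this]
      simp
    · have : A = (b.symm i).1 := by
        rw [PF.E_delete, Finset.mem_erase] at h'
        by_contra h''
        exact h' ⟨h'', h⟩
      subst this
      rw [signedCoord_of_mem _ h, signedCoord_of_notMem _ h']
      simp [J.top]
  · have h' : A ∉ (τ.delete (b.symm i).1).E := fun h' => h (τ.E_delete_subset _ h')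
    rw [signedCoord_of_notMem _ h, signedCoord_of_notMem _ h']
    simp

theorem gluedCubes_face_mem (hw : ∀ e, w e + w e = 0) {k : ℕ} {φ : Cube (k + 1) → Glued w}
    (hφ : φ ∈ (gluedCubes w).cubes (k + 1)) (i : Fin (k + 1)) {c : J} (hc : c = J.bot ∨ c = J.top) :
    (fun x : Cube k => φ (Fin.insertNth (α := fun _ => J) i c x)) ∈ (gluedCubes w).cubes k := by
  rcases hc with rfl | rfl
  -- A bottom face is the top face of the cube reflected in the i-th coordinate.
  · have h := gluedCubes_face_top_mem hw
      (gluedCubes_isometry_mem hw hφ (Equiv.refl _) (fun m => decide (m = i))) i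
    convert h using 3 with x
    funext m
    by_cases hm : m = i
    · subst hm
      simp [cubeIso, J.bot, J.top, J.neg]
    · obtain ⟨m, rfl⟩ := Fin.exists_succAbove_eq hm
      simp [cubeIso, hm]
  · exact gluedCubes_face_top_mem hw hφ i

theorem gluedCubes_cover (p : Glued w) :
    ∃ (k : ℕ) (φ : Cube k → Glued w), φ ∈ (gluedCubes w).cubes k ∧ p ∈ Set.range φ := by
  obtain ⟨p⟩ := p
  let b := Fintype.equivFin p.1.1.E
  refine ⟨_, _, ⟨p.1.1, p.1.2, b, rfl⟩, fun m => unitToJ (p.2 (b.symm m)), ?_⟩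
  refine Eq.trans ?_ (mk_eq_cubeMap p).symm
  simp

theorem PF.exists_separated (τ : PF n) {A : Finset (Fin n)} (hA : A ∈ τ.E) :
    ∃ i ∈ A, ∃ j ∈ A, i ≠ j ∧ ∀ B ∈ τ.E, i ∈ B → j ∈ B → A ⊆ B :=
  Forest.exists_separated τ.branching τ.nodup hA

/-- A set of internal edges is empty if each pair of leaves lies above an even number of its
members. -/
theorem PF.eq_empty_of_countBoth (τ : PF n) {D : Finset (Finset (Fin n))} (hD : D ⊆ τ.E)
    (h : ∀ A ∈ D, ∀ i ∈ A, ∀ j ∈ A, i ≠ j → countBoth D i j = 0) : D = ∅ := by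
  by_contra hne
  -- Two leaves separated just above A lie only in edges containing A. As A is largest in D, it is
  -- the only member of D containing both, so the count is 1.
  obtain ⟨A, hA, hmax⟩ := Finset.exists_max_image D Finset.card (Finset.nonempty_iff_ne_empty.2 hne)
  obtain ⟨i, hi, j, hj, hij, hs⟩ := τ.exists_separated (hD hA)
  have := h A hA i hi j hj hij
  rw [countBoth, Finset.sum_eq_single_of_mem A hA] at this
  · simp [both, hi, hj] at this
  · intro B hB hBA
    unfold both
    rw [if_neg]
    rintro ⟨h1, h2⟩
    exact hBA (Finset.eq_of_subset_of_card_le (hs B (hD hB) h1 h2) (hmax B hB)).symm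

theorem abs_lt_one_iff_of_openCube {k : ℕ} {τ : PF n} {b : τ.E ≃ Fin k} {x : Cube k}
    (hx : x ∈ openCube k) {A : Finset (Fin n)} :
    |signedCoord (fun e => x (b e)) A| ≠ 1 ↔ A ∈ τ.E := by
  constructor
  · intro h
    by_contra h'
    rw [signedCoord_of_notMem _ h', abs_one] at h
    exact h rfl
  · intro h
    rw [signedCoord_of_mem _ h]
    exact (abs_lt.2 (hx (b ⟨A, h⟩))).ne

/-- In the open cube every edge has a coordinate other than ±1, so the order above every edge is
compared and found unchanged. Parity then forces D = ∅. -/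
theorem gluedCubes_injOn (hw : ∀ e, w e + w e = 0) {k : ℕ} {φ : Cube k → Glued w}
    (hφ : φ ∈ (gluedCubes w).cubes k) : Set.InjOn φ (openCube k) := by
  obtain ⟨τ, s, b, rfl⟩ := hφ
  intro x hx y hy hxy
  obtain ⟨D, h1, -, h3⟩ := (cubeMap_eq_iff hw).1 hxy
  have hD : D ⊆ τ.E := by
    intro A hA
    by_contra h
    have := h1 A
    rw [signedCoord_of_notMem _ h, signedCoord_of_notMem _ h, if_pos hA] at this
    norm_num at this
  have hD0 : D = ∅ := by
    refine τ.eq_empty_of_countBoth hD fun A hA i hi j hj hij => ?_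
    have := h3 i j hij ⟨A, hi, hj, (abs_lt_one_iff_of_openCube hx).2 (hD hA)⟩
    simpa using this
  funext m
  have := h1 (b.symm m).1
  rw [signedCoord_of_mem _ (b.symm m).2, signedCoord_of_mem _ (b.symm m).2, hD0] at this
  simpa [Subtype.ext_iff] using this.symm

/-- An interior point determines the edges, as the sets with coordinate other than ±1, and the set D
that identifies it in the two cubes identifies the whole cubes. -/
theorem gluedCubes_eq_of_meet (hw : ∀ e, w e + w e = 0) {k l : ℕ} {φ : Cube k → Glued w}
    {ψ : Cube l → Glued w} (hφ : φ ∈ (gluedCubes w).cubes k) (hψ : ψ ∈ (gluedCubes w).cubes l)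
    {x : Cube k} (hx : x ∈ openCube k) {y : Cube l} (hy : y ∈ openCube l) (hxy : φ x = ψ y) :
    ∃ (σ : Fin l ≃ Fin k) (ε : Fin l → Bool), φ = fun z => ψ (cubeIso σ ε z) := by
  obtain ⟨τ, s, b, rfl⟩ := hφ
  obtain ⟨τ', s', b', rfl⟩ := hψ
  obtain ⟨D, h1, h2, h3⟩ := (cubeMap_eq_iff hw).1 hxy
  have hE : τ'.E = τ.E := by
    ext A
    rw [← abs_lt_one_iff_of_openCube (b := b) hx, ← abs_lt_one_iff_of_openCube (b := b') hy, h1]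
    split_ifs <;> simp
  have hD : D ⊆ τ.E := by
    intro A hA
    by_contra h
    have := h1 A
    rw [signedCoord_of_notMem _ h, signedCoord_of_notMem _ (hE.symm ▸ h), if_pos hA] at this
    norm_num at this
  refine ⟨(b'.symm.trans (Equiv.subtypeEquivRight fun A => by rw [hE])).trans b,
    fun m => decide ((b'.symm m).1 ∈ D), ?_⟩
  funext z
  refine cubeMap_eq_of_E_eq hw hE hD h2 ?_ ?_
  · intro A hA i hi j hj hij
    exact h3 i j hij ⟨A, hi, hj, (abs_lt_one_iff_of_openCube hx).2 hA⟩
  · intro A h h'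
    simp [cubeIso]
    rfl

variable (w) in
/-- The projection of the disjoint union of the subcubes to the glued space. -/
def Glued.mk (p : Subcubes n G) : Glued w := Quot.mk _ p

variable (w) in
theorem Glued.isQuotientMap_mk : Topology.IsQuotientMap (Glued.mk w) :=
  isQuotientMap_quot_mk

theorem continuous_mk (τ : PF n) (s : G) :
    Continuous fun t : τ.E → Set.Icc (0 : ℝ) 1 => Glued.mk w ⟨(τ, s), t⟩ :=
  (Glued.isQuotientMap_mk w).continuous.comp (continuous_sigmaMk (σ := fun p : PF n × G => p.1.E → Set.Icc (0 : ℝ) 1)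
    (i := (τ, s)))

theorem continuous_cubeMap (hw : ∀ e, w e + w e = 0) (τ : PF n) (s : G) :
    Continuous (cubeMap w τ s) := by
  -- The closed orthants form a finite cover, and on each of them the map factors through a single
  -- subcube. On the overlaps the choices agree, by the gluing along zero coordinates.
  let F : Finset (Finset (Fin n)) → Set (τ.E → J) := fun D =>
    {x | ∀ e : τ.E, if e.1 ∈ D then (x e).1 ≤ 0 else 0 ≤ (x e).1}
  refine (locallyFinite_of_finite F).continuous (Set.eq_univ_of_forall fun x => ?_) (fun D => ?_)
    (fun D => ?_)
  · rw [Set.mem_iUnion]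
    refine ⟨negCoords x, fun e => ?_⟩
    simp only [mem_negCoords, signedCoord_of_mem x e.2]
    split_ifs with h
    · exact h.le
    · exact not_lt.1 h
  · simp only [F, Set.ofPred_forall]
    refine isClosed_iInter fun e => ?_
    have hc : Continuous fun x : τ.E → J => (x e).1 := continuous_subtype_val.comp (continuous_apply e)
    split_ifs
    · exact isClosed_le hc continuous_const
    · exact isClosed_le continuous_const hc
  · have habs : Continuous absJ :=
      Continuous.subtype_mk (continuous_subtype_val.abs) _
    have hcont : Continuous fun x : τ.E → J =>
        Glued.mk w ⟨(τ.reflect (D ∩ τ.E), s + ∑ A ∈ D ∩ τ.E, w A),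
          fun f => absJ (x ⟨f.1, τ.E_reflect_subset (D ∩ τ.E) f.2⟩)⟩ :=
      (continuous_mk (w := w) _ _).comp
        (continuous_pi fun f => habs.comp (continuous_apply _))
    refine hcont.continuousOn.congr fun x hx => ?_
    refine Eq.trans ?_ (mk_eq_cubeMap _).symm
    refine cubeMap_eq_of_E_eq hw (PF.E_reflect τ _) Finset.inter_subset_right rfl ?_ ?_
    · intro A _ i _ j _ hij
      exact PF.ord_reflect τ Finset.inter_subset_right hij
    · intro A h h'
      have hA := hx ⟨A, h⟩
      apply Subtype.ext
      by_cases hD : A ∈ D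
      · simp only [hD, if_true] at hA
        simp [unitToJ, absJ, hD, h, coe_neg, abs_of_nonpos hA]
      · simp only [hD, if_false] at hA
        simp [unitToJ, absJ, hD, abs_of_nonneg hA]

theorem gluedCubes_isOpen_iff (hw : ∀ e, w e + w e = 0) (U : Set (Glued w)) :
    IsOpen U ↔ ∀ (k : ℕ) (φ : Cube k → Glued w), φ ∈ (gluedCubes w).cubes k → IsOpen (φ ⁻¹' U) := by
  constructor
  · rintro hU k _ ⟨τ, s, b, rfl⟩
    exact hU.preimage ((continuous_cubeMap hw τ s).comp (continuous_pi fun e => continuous_apply (b e)))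
  · intro h
    rw [← (Glued.isQuotientMap_mk w).isOpen_preimage, isOpen_sigma_iff]
    rintro ⟨τ, s⟩
    let b := Fintype.equivFin τ.E
    have hc : Continuous fun t : τ.E → Set.Icc (0 : ℝ) 1 => (fun m => unitToJ (t (b.symm m)) : Cube _) :=
      continuous_pi fun m => Continuous.subtype_mk
        (continuous_subtype_val.comp (continuous_apply _)) _
    convert (h _ _ ⟨τ, s, b, rfl⟩).preimage hc using 1
    ext t
    simp only [Set.mem_preimage, Equiv.symm_apply_apply, Glued.mk]
    rw [mk_eq_cubeMap]

theorem gluedCubes_isCubeComplex (hw : ∀ e, w e + w e = 0) : IsCubeComplex (gluedCubes w) where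
  isometry_mem _ hφ σ ε := gluedCubes_isometry_mem hw hφ σ ε
  face_mem _ hφ i _ hc := gluedCubes_face_mem hw hφ i hc
  cover := gluedCubes_cover
  injOn_openCube _ hφ := gluedCubes_injOn hw hφ
  eq_of_meet _ _ hφ hψ _ hx _ hy hxy := gluedCubes_eq_of_meet hw hφ hψ hx hy hxy
  isOpen_iff := gluedCubes_isOpen_iff hw

end CubeComplex

end Cactus

/-! ### Links of vertices and the flag condition -/

namespace Cactus

open CubeCx CubeCx.Cubulation

section Links

variable {n : ℕ} {G : Type} [AddCommGroup G] {w : Finset (Fin n) → G}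

/-- The point `-x` of the cube `[-1,1]^{E(τ)}`. -/
def cornerCoord {k : ℕ} {τ : PF n} (b : τ.E ≃ Fin k) (x : Cube k) : τ.E → J := fun e => (x (b e)).neg

theorem coe_cornerCoord {k : ℕ} {τ : PF n} (b : τ.E ≃ Fin k) (x : Cube k) (e : τ.E) :
    (cornerCoord b x e).1 = -(x (b e)).1 := rfl

theorem cubeIso_refl_true {k : ℕ} (x : Cube k) :
    cubeIso (Equiv.refl _) (fun _ => true) x = fun m => (x m).neg := rfl

variable (w) in
/-- The parametrization of the cube of `(τ, s)` which sends `(-1,…,-1)` to the vertex of the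
subcube `(τ, s)` at which all coordinates are `1`. -/
noncomputable def cornerCube {k : ℕ} (τ : PF n) (s : G) (b : τ.E ≃ Fin k) : Cube k → Glued w :=
  fun x => cubeMap w τ s (cornerCoord b x)

theorem exists_cornerCube (hw : ∀ e, w e + w e = 0) {k : ℕ} {φ : Cube k → Glued w}
    (hφ : φ ∈ (gluedCubes w).cubes k) : ∃ τ s b, φ = cornerCube w τ s b := by
  obtain ⟨τ, s, b, h⟩ := gluedCubes_isometry_mem hw hφ (Equiv.refl _) (fun _ => true)
  refine ⟨τ, s, b, funext fun x => ?_⟩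
  have := congrFun h (fun m => (x m).neg)
  simp only [cubeIso_refl_true, J.neg_neg] at this
  exact this

theorem cornerCube_mem (hw : ∀ e, w e + w e = 0) {k : ℕ} (τ : PF n) (s : G) (b : τ.E ≃ Fin k) :
    cornerCube w τ s b ∈ (gluedCubes w).cubes k := by
  exact gluedCubes_isometry_mem hw (φ := fun x => cubeMap w τ s (fun e => x (b e)))
    ⟨τ, s, b, rfl⟩ (Equiv.refl _) (fun _ => true)

theorem signedCoord_symm {k : ℕ} {τ : PF n} (b : τ.E ≃ Fin k) (x : Cube k) (m : Fin k) :
    signedCoord (cornerCoord b x) (b.symm m).1 = -(x m).1 := by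
  rw [signedCoord_of_mem _ (b.symm m).2, coe_cornerCoord]
  simp

/-- A cube with a chosen corner is recorded by the index of that corner and, for each direction, an
ordered label set. Evaluation at suitable points recovers these data. -/
theorem cornerCube_eq_iff (hw : ∀ e, w e + w e = 0) {k : ℕ} {τ τ' : PF n} {s s' : G}
    {b : τ.E ≃ Fin k} {b' : τ'.E ≃ Fin k} :
    cornerCube w τ s b = cornerCube w τ' s' b' ↔ s = s' ∧ (∀ m, (b.symm m).1 = (b'.symm m).1) ∧
      ∀ m, ∀ i ∈ (b.symm m).1, ∀ j ∈ (b.symm m).1, i ≠ j → τ.ord i j = τ'.ord i j := by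
  constructor
  · intro h
    have hlab : ∀ m, (b.symm m).1 = (b'.symm m).1 := by
      intro m
      by_contra hne
      -- At the midpoint of the m-th edge the only coordinate other than ±1 is the one at the m-th
      -- label set.
      obtain ⟨D, h1, -, -⟩ := (cubeMap_eq_iff hw).1 (congrFun h (fun m' =>
        if m' = m then ⟨0, by norm_num, by norm_num⟩ else J.bot))
      have := h1 (b'.symm m).1
      rw [signedCoord_symm] at this
      by_cases hE : (b'.symm m).1 ∈ τ.E
      · have hm : b ⟨_, hE⟩ ≠ m := by
          intro hm
          rw [← Equiv.eq_symm_apply, Subtype.ext_iff] at hm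
          exact hne hm.symm
        rw [signedCoord_of_mem _ hE, coe_cornerCoord] at this
        simp only [hm, if_false, if_true] at this
        split_ifs at this <;> simp [J.bot] at this
      · rw [signedCoord_of_notMem _ hE] at this
        simp only [if_true] at this
        split_ifs at this <;> simp at this
    -- After the sign change in `cornerCoord` the coordinates on the edges become 1/2: positive, so
    -- no sign can change and D = ∅, and different from 1, so all orders are compared.
    obtain ⟨D, h1, h2, h3⟩ := (cubeMap_eq_iff hw).1 (congrFun h (fun m' =>
        ⟨-(1 / 2), by norm_num, by norm_num⟩))
    have hD : D = ∅ := by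
      rw [Finset.eq_empty_iff_forall_notMem]
      intro A hA
      have h1 := h1 A
      rw [if_pos hA] at h1
      unfold signedCoord at h1
      split_ifs at h1 <;> norm_num [coe_cornerCoord] at h1
    subst hD
    refine ⟨by simpa using h2.symm, hlab, fun m i hi j hj hij => ?_⟩
    have := h3 i j hij ⟨_, hi, hj, by rw [signedCoord_symm]; norm_num [abs_of_pos]⟩
    simpa [countBoth] using this.symm
  · rintro ⟨rfl, hlab, ho⟩
    funext x
    refine cubeMap_eq_of_E_eq hw ?_ (Finset.empty_subset _) (by simp) ?_ ?_
    · ext A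
      constructor
      · intro h
        have := hlab (b' ⟨A, h⟩)
        simp only [Equiv.symm_apply_apply] at this
        rw [← this]
        exact Subtype.property _
      · intro h
        have := hlab (b ⟨A, h⟩)
        simp only [Equiv.symm_apply_apply] at this
        rw [this]
        exact Subtype.property _
    · intro A hA i hi j hj hij
      have := ho (b ⟨A, hA⟩) i (by simpa using hi) j (by simpa using hj) hij
      simp [this, countBoth]
    · intro A h h'
      have : b ⟨A, h⟩ = b' ⟨A, h'⟩ := by
        rw [← Equiv.eq_symm_apply]
        apply Subtype.ext
        rw [hlab]
        simp
      simp [cornerCoord, this]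

/-- At a corner all signed coordinates are 1, so no order is compared and only the index is left.
The vertices thus correspond to the elements of G. -/
theorem corner_cornerCube_eq_iff (hw : ∀ e, w e + w e = 0) {k l : ℕ} {τ τ' : PF n} {s s' : G}
    {b : τ.E ≃ Fin k} {b' : τ'.E ≃ Fin l} :
    corner (cornerCube w τ s b) = corner (cornerCube w τ' s' b') ↔ s = s' := by
  have h1 : ∀ {k : ℕ} {τ : PF n} {b : τ.E ≃ Fin k} (A),
      signedCoord (cornerCoord b (fun _ => J.bot : Cube k)) A = 1 := by
    intro k τ b A
    unfold signedCoord
    split_ifs <;> simp [coe_cornerCoord, J.bot]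
  unfold corner cornerCube
  rw [cubeMap_eq_iff hw]
  simp only [h1]
  constructor
  · rintro ⟨D, h1, h2, -⟩
    have hD : D = ∅ := by
      rw [Finset.eq_empty_iff_forall_notMem]
      intro A hA
      have h1 := h1 A
      rw [if_pos hA] at h1
      norm_num at h1
    rw [h2, hD]
    simp
  · rintro rfl
    exact ⟨∅, by simp, by simp, by simp⟩

theorem cornerEdge_cornerCube (hw : ∀ e, w e + w e = 0) {k : ℕ} {τ τ' : PF n} {s : G}
    {b : τ.E ≃ Fin k} {b' : τ'.E ≃ Fin 1} {m : Fin k} (hb : (b'.symm 0).1 = (b.symm m).1)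
    (ho : ∀ i ∈ (b.symm m).1, ∀ j ∈ (b.symm m).1, i ≠ j → τ'.ord i j = τ.ord i j) :
    cornerEdge (cornerCube w τ s b) m = cornerCube w τ' s b' := by
  funext x
  unfold cornerEdge cornerCube
  rw [cubeMap_eq_iff hw]
  have h1 : ∀ A, signedCoord (cornerCoord b (Function.update (fun _ => J.bot) m (x 0))) A =
      if A = (b.symm m).1 then -(x 0).1 else 1 := by
    intro A
    split_ifs with h
    · rw [h, signedCoord_symm]
      simp
    · unfold signedCoord
      split_ifs with h'
      · rw [coe_cornerCoord, Function.update_of_ne]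
        · simp [J.bot]
        · rintro rfl; simp at h
      · rfl
  refine ⟨∅, fun A => ?_, by simp, ?_⟩
  · simp only [h1, Finset.notMem_empty, if_false]
    split_ifs with h
    · rw [h, ← hb, signedCoord_symm]
    · refine signedCoord_of_notMem _ fun h' => h ?_
      rw [← hb, Subsingleton.elim 0 (b' ⟨A, h'⟩)]
      simp
  · rintro i j hij ⟨A, hi, hj, hA⟩
    rw [h1] at hA
    split_ifs at hA with h
    · subst h
      simp [countBoth, ho i hi j hj hij]
    · simp at hA

/-- The edge in direction m is obtained by collapsing all other internal edges of τ, which leaves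
the order unchanged. -/
theorem exists_cornerEdge_eq (hw : ∀ e, w e + w e = 0) {k : ℕ} (τ : PF n) (s : G)
    (b : τ.E ≃ Fin k) (m : Fin k) :
    ∃ (τ' : PF n) (b' : τ'.E ≃ Fin 1), (b'.symm 0).1 = (b.symm m).1 ∧
      (∀ i j, τ'.ord i j = τ.ord i j) ∧
      cornerEdge (cornerCube w τ s b) m = cornerCube w τ' s b' := by
  obtain ⟨τ', hE, ho⟩ := τ.exists_restrict (F := {(b.symm m).1})
    (Finset.singleton_subset_iff.2 (b.symm m).2)
  obtain ⟨b', hb'⟩ := exists_equiv_of_image (k := 1) (E := τ'.E) (a := fun _ => (b.symm m).1)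
    (fun _ _ _ => Subsingleton.elim _ _) (by simp [hE, eq_comm])
  exact ⟨τ', b', hb' 0, ho, cornerEdge_cornerCube hw (hb' 0) fun i _ j _ _ => ho i j⟩

theorem gluedCubes_link_edges_injective (hw : ∀ e, w e + w e = 0) {k : ℕ} {φ : Cube k → Glued w}
    (hφ : φ ∈ (gluedCubes w).cubes k) : Function.Injective (cornerEdge φ) := by
  obtain ⟨τ, s, b, rfl⟩ := exists_cornerCube hw hφ
  intro m m' h
  obtain ⟨τ₁, b₁, h₁, -, h₁'⟩ := exists_cornerEdge_eq hw τ s b m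
  obtain ⟨τ₂, b₂, h₂, -, h₂'⟩ := exists_cornerEdge_eq hw τ s b m'
  rw [h₁', h₂', cornerCube_eq_iff hw] at h
  have := h.2.1 0
  rw [h₁, h₂] at this
  exact b.symm.injective (Subtype.ext this)

theorem gluedCubes_link_simplex_unique (hw : ∀ e, w e + w e = 0) {k : ℕ} {φ ψ : Cube k → Glued w}
    (hφ : φ ∈ (gluedCubes w).cubes k) (hψ : ψ ∈ (gluedCubes w).cubes k)
    (hc : corner φ = corner ψ) (he : cornerEdge φ = cornerEdge ψ) : φ = ψ := by
  obtain ⟨τ, s, b, rfl⟩ := exists_cornerCube hw hφ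
  obtain ⟨τ', s', b', rfl⟩ := exists_cornerCube hw hψ
  rw [corner_cornerCube_eq_iff hw] at hc
  have key : ∀ m, (b.symm m).1 = (b'.symm m).1 ∧
      ∀ i ∈ (b.symm m).1, ∀ j ∈ (b.symm m).1, i ≠ j → τ.ord i j = τ'.ord i j := by
    intro m
    obtain ⟨τ₁, b₁, h₁, ho₁, h₁'⟩ := exists_cornerEdge_eq hw τ s b m
    obtain ⟨τ₂, b₂, h₂, ho₂, h₂'⟩ := exists_cornerEdge_eq hw τ' s' b' m
    have h := congrFun he m
    rw [h₁', h₂', cornerCube_eq_iff hw] at h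
    refine ⟨by rw [← h₁, ← h₂, h.2.1 0], fun i hi j hj hij => ?_⟩
    rw [← ho₁, ← ho₂]
    exact h.2.2 0 i (h₁ ▸ hi) j (h₁ ▸ hj) hij
  exact (cornerCube_eq_iff hw).2 ⟨hc, fun m => (key m).1, fun m => (key m).2⟩

/-- The leaves of `A` form an interval of those of `B ⊇ A`, and they are ordered in the same way. -/
def PF.Nested (τ τ' : PF n) (A B : Finset (Fin n)) : Prop :=
  (∀ i ∈ A, ∀ j ∈ A, i ≠ j → τ.ord i j = τ'.ord i j) ∧
    ∀ i ∈ A, ∀ j ∈ A, ∀ k ∈ B, k ∉ A → τ'.ord i k = τ'.ord j k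

/-- The condition for the existence of a forest with edges `A` and `B` above which the leaves are
ordered as in `τ` and in `τ'`, respectively. -/
def PF.Compatible (τ τ' : PF n) (A B : Finset (Fin n)) : Prop :=
  Disjoint A B ∨ (A ⊆ B ∧ τ.Nested τ' A B) ∨ (B ⊆ A ∧ τ'.Nested τ B A)

theorem PF.two_le_card (τ : PF n) {A : Finset (Fin n)} (hA : A ∈ τ.E) : 2 ≤ A.card :=
  Forest.two_le_card τ.branching τ.nodup hA

theorem PF.ord_eq_of_mem (τ : PF n) {A : Finset (Fin n)} (hA : A ∈ τ.E) {i j k : Fin n} (hi : i ∈ A)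
    (hj : j ∈ A) (hk : k ∉ A) : τ.ord i k = τ.ord j k :=
  Forest.ord_eq_of_mem_edges τ.nodup hA hi hj hk (τ.complete k)

/-- Laminarity gives the three alternatives, and consecutiveness of the leaves above an edge gives
the interval condition. -/
theorem PF.compatible_of_mem {τ τ₁ τ₂ : PF n} {A B : Finset (Fin n)} (hA : A ∈ τ.E) (hB : B ∈ τ.E)
    (h₁ : ∀ i ∈ A, ∀ j ∈ A, i ≠ j → τ₁.ord i j = τ.ord i j)
    (h₂ : ∀ i ∈ B, ∀ j ∈ B, i ≠ j → τ₂.ord i j = τ.ord i j) : τ₁.Compatible τ₂ A B := by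
  have key : ∀ {A B : Finset (Fin n)} {τ₁ τ₂ : PF n}, A ∈ τ.E → A ⊆ B →
      (∀ i ∈ A, ∀ j ∈ A, i ≠ j → τ₁.ord i j = τ.ord i j) →
      (∀ i ∈ B, ∀ j ∈ B, i ≠ j → τ₂.ord i j = τ.ord i j) → τ₁.Nested τ₂ A B := by
    intro A B τ₁ τ₂ hA h h₁ h₂
    constructor
    · intro i hi j hj hij
      rw [h₁ i hi j hj hij, h₂ i (h hi) j (h hj) hij]
    · intro i hi j hj k hk hkA
      rw [h₂ i (h hi) k hk (ne_of_mem_of_not_mem hi hkA),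
        h₂ j (h hj) k hk (ne_of_mem_of_not_mem hj hkA)]
      exact τ.ord_eq_of_mem hA hi hj hkA
  rcases Forest.edges_laminar τ.nodup hA hB with h | h | h
  · exact Or.inl h
  · exact Or.inr (Or.inl ⟨h, key hA h h₁ h₂⟩)
  · exact Or.inr (Or.inr ⟨h, key hB h h₂ h₁⟩)

/-- This is the combinatorial flag property: all hypotheses of `PF.exists_of_compatible` involve at
most two sets. -/
theorem PF.exists_of_pairwise_compatible {k : ℕ} {A : Fin k → Finset (Fin n)} (τ : Fin k → PF n)
    (hA : Function.Injective A) (h2 : ∀ m, 2 ≤ (A m).card)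
    (hc : ∀ m m', m ≠ m' → (τ m).Compatible (τ m') (A m) (A m')) :
    ∃ (σ : PF n) (b : σ.E ≃ Fin k), (∀ m, (b.symm m).1 = A m) ∧
      ∀ m, ∀ i ∈ A m, ∀ j ∈ A m, i ≠ j → σ.ord i j = (τ m).ord i j := by
  classical
  let o : Finset (Fin n) → List (Fin n) := fun B =>
    if h : ∃ m, A m = B then (τ h.choose).forest.leaves else []
  have ho : ∀ m, o (A m) = (τ m).forest.leaves := by
    intro m
    have h : ∃ m', A m' = A m := ⟨m, rfl⟩
    simp only [o, dif_pos h]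
    rw [hA h.choose_spec]
  have hnest : ∀ m m', A m ⊆ A m' → m ≠ m' → (τ m).Nested (τ m') (A m) (A m') := by
    intro m m' h hne
    rcases hc m m' hne with h' | h' | h'
    · obtain ⟨i, hi⟩ := Finset.card_pos.1 (lt_of_lt_of_le (by norm_num) (h2 m))
      exact (Finset.disjoint_left.1 h' hi (h hi)).elim
    · exact h'.2
    · exact (hne (hA (Finset.Subset.antisymm h h'.1))).elim
  obtain ⟨σ, hE, hσ⟩ := PF.exists_of_compatible (Finset.univ.image A) o
    (by simp only [Finset.mem_image, Finset.mem_univ, true_and]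
        rintro _ ⟨m, rfl⟩ a; rw [ho]; exact (τ m).complete a)
    (by simp only [Finset.mem_image, Finset.mem_univ, true_and]
        rintro _ ⟨m, rfl⟩; exact h2 m)
    (by simp only [Finset.mem_image, Finset.mem_univ, true_and]
        rintro _ ⟨m, rfl⟩ _ ⟨m', rfl⟩
        by_cases h : m = m'
        · exact Or.inr (Or.inl (h ▸ subset_rfl))
        · exact (hc m m' h).imp_right (Or.imp And.left And.left))
    (by simp only [Finset.mem_image, Finset.mem_univ, true_and]
        rintro _ ⟨m, rfl⟩ _ ⟨m', rfl⟩ h i hi j hj hij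
        by_cases hm : m = m'
        · rw [hm]
        · rw [ho, ho]; exact (hnest m m' h hm).1 i hi j hj hij)
    (by simp only [Finset.mem_image, Finset.mem_univ, true_and]
        rintro _ ⟨m, rfl⟩ _ ⟨m', rfl⟩ h i hi j hj k hk hkA
        by_cases hm : m = m'
        · subst hm; exact absurd hk hkA
        · rw [ho]; exact (hnest m m' h hm).2 i hi j hj k hk hkA)
  obtain ⟨b, hb⟩ := exists_equiv_of_image hA (E := σ.E) (by simp [hE])
  refine ⟨σ, b, hb, fun m i hi j hj hij => ?_⟩
  have := hσ (A m) (by simp) i hi j hj hij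
  rwa [ho] at this

theorem formCorner_iff (hw : ∀ e, w e + w e = 0) {e e' : (gluedCubes w).OEdge} {τ τ' : PF n}
    {s s' : G} {b : τ.E ≃ Fin 1} {b' : τ'.E ≃ Fin 1} (he : e.1 = cornerCube w τ s b)
    (he' : e'.1 = cornerCube w τ' s' b') :
    FormCorner e e' ↔ s = s' ∧ (b.symm 0).1 ≠ (b'.symm 0).1 ∧
      τ.Compatible τ' (b.symm 0).1 (b'.symm 0).1 := by
  constructor
  · rintro ⟨φ, hφ, h, h'⟩
    have hne : e.1 ≠ e'.1 := by
      rw [← h, ← h']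
      exact (gluedCubes_link_edges_injective hw hφ).ne (by decide)
    obtain ⟨σ, r, c, rfl⟩ := exists_cornerCube hw hφ
    obtain ⟨τ₁, b₁, h₁, ho₁, h₁'⟩ := exists_cornerEdge_eq hw σ r c 0
    obtain ⟨τ₂, b₂, h₂, ho₂, h₂'⟩ := exists_cornerEdge_eq hw σ r c 1
    rw [h₁', he, cornerCube_eq_iff hw] at h
    rw [h₂', he', cornerCube_eq_iff hw] at h'
    have hA : (b.symm 0).1 = (c.symm 0).1 := by rw [← h₁, h.2.1 0]
    have hA' : (b'.symm 0).1 = (c.symm 1).1 := by rw [← h₂, h'.2.1 0]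
    refine ⟨h.1.symm.trans h'.1, ?_, ?_⟩
    · rw [hA, hA']
      exact fun h => absurd (c.symm.injective (Subtype.ext h)) (by decide)
    · rw [hA, hA']
      refine PF.compatible_of_mem (c.symm 0).2 (c.symm 1).2 ?_ ?_
      · intro i hi j hj hij
        rw [← ho₁]
        exact (h.2.2 0 i (h₁ ▸ hi) j (h₁ ▸ hj) hij).symm
      · intro i hi j hj hij
        rw [← ho₂]
        exact (h'.2.2 0 i (h₂ ▸ hi) j (h₂ ▸ hj) hij).symm
  · rintro ⟨rfl, hne, hc⟩
    have hsymm : τ'.Compatible τ (b'.symm 0).1 (b.symm 0).1 := by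
      rcases hc with h | h | h
      · exact Or.inl h.symm
      · exact Or.inr (Or.inr h)
      · exact Or.inr (Or.inl h)
    obtain ⟨σ, c, hc1, hc2⟩ := PF.exists_of_pairwise_compatible (k := 2)
      (A := ![(b.symm 0).1, (b'.symm 0).1]) ![τ, τ']
      (by intro m m' h; fin_cases m <;> fin_cases m' <;> simp_all)
      (by intro m; fin_cases m
          · exact τ.two_le_card (b.symm 0).2
          · exact τ'.two_le_card (b'.symm 0).2)
      (by intro m m' h; fin_cases m <;> fin_cases m'
          · exact absurd rfl h
          · exact hc
          · exact hsymm
          · exact absurd rfl h)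
    refine ⟨cornerCube w σ s c, cornerCube_mem hw σ s c, ?_, ?_⟩
    · rw [he]
      have h0 := hc1 0
      refine cornerEdge_cornerCube hw h0.symm fun i hi j hj hij => ?_
      rw [h0] at hi hj
      exact (hc2 0 i hi j hj hij).symm
    · rw [he']
      have h0 := hc1 1
      refine cornerEdge_cornerCube hw h0.symm fun i hi j hj hij => ?_
      rw [h0] at hi hj
      exact (hc2 1 i hi j hj hij).symm

theorem gluedCubes_npc (hw : ∀ e, w e + w e = 0) : (gluedCubes w).NPC where
  link_edges_injective φ hφ := gluedCubes_link_edges_injective hw hφ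
  link_simplex_unique φ hφ ψ hψ hc he := gluedCubes_link_simplex_unique hw hφ hψ hc he
  link_flag p hp k e hinj horig hcorner := by
    obtain ⟨τ₀, s₀, b₀, rfl⟩ := exists_cornerCube hw hp
    choose τ s b he using fun m => exists_cornerCube hw (e m).2
    have hs : ∀ m, s m = s₀ := by
      intro m
      have h := horig m
      unfold OEdge.origin at h
      rw [he] at h
      exact (corner_cornerCube_eq_iff hw).1 h
    have hc := fun m m' (h : m ≠ m') => (formCorner_iff hw (he m) (he m')).1 (hcorner m m' h)
    obtain ⟨σ, c, hc1, hc2⟩ := PF.exists_of_pairwise_compatible (A := fun m => ((b m).symm 0).1) τ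
      (by
        intro m m' h
        by_contra hne
        exact (hc m m' hne).2.1 h)
      (fun m => (τ m).two_le_card ((b m).symm 0).2) (fun m m' h => (hc m m' h).2.2)
    refine ⟨cornerCube w σ s₀ c, cornerCube_mem hw σ s₀ c, (corner_cornerCube_eq_iff hw).2 rfl, ?_⟩
    intro m
    rw [he m, hs m]
    refine cornerEdge_cornerCube hw (hc1 m).symm fun i hi j hj hij => ?_
    rw [hc1 m] at hi hj
    exact (hc2 m i hi j hj hij).symm

end Links

end Cactus

/-! ### The translation action on `M n` and the covering `P` -/

namespace Cactus

open CubeCx CubeCx.Cubulation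

section Translation

variable {n : ℕ} {G : Type} [AddCommGroup G] {w : Finset (Fin n) → G}

/-- The translations of the indices of the subcubes. -/
instance : AddAction G (Glued w) where
  vadd g := Quot.map (fun p => ⟨(p.1.1, g + p.1.2), p.2⟩) (by
    rintro _ _ (⟨τ, s, t, e, h⟩ | ⟨τ, τ', s, t, h⟩ | ⟨τ, s, t, e, h⟩)
    · exact Glue.outward τ (g + s) t e h
    · exact Glue.perm τ τ' (g + s) t h
    · have := Glue.inward (w := w) τ (g + s) t e h
      rwa [add_assoc] at this)
  zero_vadd := by
    rintro ⟨⟨⟨τ, s⟩, t⟩⟩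
    exact congrArg (fun z => Glued.mk w ⟨(τ, z), t⟩) (zero_add s)
  add_vadd := by
    rintro g g' ⟨⟨⟨τ, s⟩, t⟩⟩
    exact congrArg (fun z => Glued.mk w ⟨(τ, z), t⟩) (add_assoc g g' s)

theorem Glued.mk_surjective : Function.Surjective (Glued.mk w) := Quot.mk_surjective

theorem Glued.continuous_iff {Y : Type*} [TopologicalSpace Y] {f : Glued w → Y} :
    Continuous f ↔ ∀ τ s, Continuous fun t : τ.E → Set.Icc (0 : ℝ) 1 => f (Glued.mk w ⟨(τ, s), t⟩) := by
  rw [(Glued.isQuotientMap_mk w).continuous_iff, continuous_sigma_iff, Prod.forall]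
  rfl

instance : ContinuousConstVAdd G (Glued w) where
  continuous_const_vadd g := by
    rw [Glued.continuous_iff]
    intro τ s
    exact continuous_mk τ (g + s)

end Translation

section Covering

variable {n : ℕ}

theorem unitVec_add_self (e : Finset (Fin n)) : unitVec e + unitVec e = 0 :=
  funext fun _ => CharTwo.add_self_eq_zero _

theorem sum_unitVec_apply (D : Finset (Finset (Fin n))) (A : L n) :
    (∑ B ∈ D, unitVec B) A = if A.1 ∈ D then 1 else 0 := by
  rw [Finset.sum_apply]
  simp [unitVec]

/-- The sum of the coordinates of `s` at the label sets to which both `i` and `j` belong. -/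
def twist (s : L n → ZMod 2) (i j : Fin n) : ZMod 2 := ∑ A : L n, both i j A.1 * s A

theorem twist_add (s s' : L n → ZMod 2) (i j : Fin n) :
    twist (s + s') i j = twist s i j + twist s' i j := by
  simp [twist, mul_add, Finset.sum_add_distrib]

theorem mem_of_both_ne_zero {A : Finset (Fin n)} {i j : Fin n} (h : both i j A ≠ 0) :
    i ∈ A ∧ j ∈ A := by
  unfold both at h
  by_contra h'
  exact h (if_neg h')

/-- A set containing two distinct labels belongs to L, so the restriction of `twist` to L loses no
set that counts. -/
theorem twist_sum_unitVec (D : Finset (Finset (Fin n))) {i j : Fin n} (hij : i ≠ j) :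
    twist (∑ A ∈ D, unitVec A) i j = countBoth D i j := by
  have h := Finset.sum_subtype (Finset.univ.filter fun A : Finset (Fin n) => A.Nonempty ∧ A.card ≠ 1)
    (F := inferInstance) (p := fun A => A.Nonempty ∧ A.card ≠ 1) (by simp) (fun A => if A ∈ D then both i j A else 0)
  rw [Finset.sum_filter_of_ne] at h
  · unfold twist countBoth
    simp only [sum_unitVec_apply, mul_ite, mul_one, mul_zero]
    rw [← h]
    simp
  · intro A _ hA
    have hb : both i j A ≠ 0 := fun h => hA (by rw [h, ite_self])
    obtain ⟨hi, hj⟩ := mem_of_both_ne_zero hb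
    refine ⟨⟨i, hi⟩, fun h1 => ?_⟩
    obtain ⟨a, rfl⟩ := Finset.card_eq_one.1 h1
    exact hij ((Finset.mem_singleton.1 hi).trans (Finset.mem_singleton.1 hj).symm)

/-- The character `ℤ/2 → {1, -1}`. -/
def sign (z : ZMod 2) : ℝ := if z = 0 then 1 else -1

theorem sign_add (z z' : ZMod 2) : sign (z + z') = sign z * sign z' := by
  have h : ∀ z : ZMod 2, z = 0 ∨ z = 1 := by decide
  rcases h z with rfl | rfl <;> rcases h z' with rfl | rfl <;>
    simp [sign, CharTwo.add_self_eq_zero]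

theorem Glued.rel_lift {G : Type} [AddCommGroup G] {w : Finset (Fin n) → G} {Y : Type*}
    {f : Subcubes n G → Y} (hf : ∀ p q, Rel w p q → f q = f p) (p q : Subcubes n G)
    (h : Glue w p q) : f p = f q := (hf p q (Rel.of_glue h)).symm

/-- The coordinate of a point of `M n` at the label set `A`, with the sign determined by its index. -/
def coordFun (A : L n) : M n → ℝ :=
  Quot.lift (fun p => sign (p.1.2 A) * coord p A.1) (Glued.rel_lift (by
    rintro p q ⟨D, h1, h2, h3, -⟩
    rw [h2, h3, Pi.add_apply, sum_unitVec_apply]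
    -- The sign changes only at members of D, where the coordinate is 0.
    split_ifs with h
    · rw [h1 _ h]; simp
    · rw [add_zero]))

/-- A function which is sensitive to the order of the leaves `i` and `j`. -/
def orderFun (i j : Fin n) (hij : i ≠ j) : M n → ℝ :=
  Quot.lift (fun p => sign (p.1.1.ord i j + twist p.1.2 i j) *
    ∑ A ∈ Finset.univ.filter (fun A => i ∈ A ∧ j ∈ A), (1 - coord p A)) (Glued.rel_lift (by
    rintro p q ⟨D, h1, h2, h3, h4⟩
    simp only [h2]
    -- If some set containing i and j has coordinate other than 1, the order and the `twist` change
    -- by the same count, which cancels. Otherwise nothing controls the sign, but the sum is zero.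
    by_cases h : ∃ A, i ∈ A ∧ j ∈ A ∧ coord p A ≠ 1
    · rw [h4 i j hij h, h3, twist_add, twist_sum_unitVec D hij]
      have : p.1.1.ord i j + countBoth D i j + (twist p.1.2 i j + countBoth D i j) =
          p.1.1.ord i j + twist p.1.2 i j + (countBoth D i j + countBoth D i j) := by ring
      rw [this, CharTwo.add_self_eq_zero, add_zero]
    · push Not at h
      rw [Finset.sum_eq_zero, mul_zero, mul_zero]
      intro A hA
      have hA := (Finset.mem_filter.1 hA).2
      rw [h A hA.1 hA.2, sub_self]))

theorem continuous_coord {G : Type} (τ : PF n) (s : G) (A : Finset (Fin n)) :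
    Continuous fun t : τ.E → Set.Icc (0 : ℝ) 1 => coord ⟨(τ, s), t⟩ A := by
  simp only [coord_mk]
  split_ifs with h
  · exact continuous_subtype_val.comp (continuous_apply (⟨A, h⟩ : τ.E))
  · exact continuous_const

theorem continuous_coordFun (A : L n) : Continuous (coordFun A) :=
  Glued.continuous_iff.2 fun τ s => show Continuous fun t : τ.E → Set.Icc (0 : ℝ) 1 =>
      sign (s A) * coord (⟨(τ, s), t⟩ : Subcubes n (L n → ZMod 2)) A.1 from
    continuous_const.mul (continuous_coord τ s A.1)

theorem continuous_orderFun {i j : Fin n} (hij : i ≠ j) : Continuous (orderFun i j hij) :=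
  Glued.continuous_iff.2 fun τ s => show Continuous fun t : τ.E → Set.Icc (0 : ℝ) 1 =>
      sign (τ.ord i j + twist s i j) * ∑ A ∈ Finset.univ.filter (fun A => i ∈ A ∧ j ∈ A),
        (1 - coord (⟨(τ, s), t⟩ : Subcubes n (L n → ZMod 2)) A) from
    continuous_const.mul
      (continuous_finsetSum _ fun A _ => continuous_const.sub (continuous_coord τ s A))

theorem coordFun_vadd (g : L n → ZMod 2) (x : M n) (A : L n) :
    coordFun A (g +ᵥ x) = sign (g A) * coordFun A x := by
  obtain ⟨p, rfl⟩ := Glued.mk_surjective x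
  change sign ((g + p.1.2) A) * coord p A.1 = sign (g A) * (sign (p.1.2 A) * coord p A.1)
  rw [Pi.add_apply, sign_add, mul_assoc]

theorem orderFun_vadd (g : L n → ZMod 2) (x : M n) {i j : Fin n} (hij : i ≠ j) :
    orderFun i j hij (g +ᵥ x) = sign (twist g i j) * orderFun i j hij x := by
  obtain ⟨p, rfl⟩ := Glued.mk_surjective x
  change sign (p.1.1.ord i j + twist (g + p.1.2) i j) * _ =
    sign (twist g i j) * (sign (p.1.1.ord i j + twist p.1.2 i j) * _)
  rw [twist_add, ← mul_assoc, ← sign_add]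
  congr 2
  ring

theorem eq_zero_of_sign_mul_pos {z : ZMod 2} {a b : ℝ} (h : 0 < a * b) (h' : 0 < sign z * a * b) :
    z = 0 := by
  unfold sign at h'
  split_ifs at h' with hz
  · exact hz
  · linarith

theorem coord_mem {G : Type} (p : Subcubes n G) (A : Finset (Fin n)) : 0 ≤ coord p A ∧ coord p A ≤ 1 := by
  unfold coord
  split_ifs
  · exact (p.2 _).2
  · norm_num

theorem sign_ne_zero (z : ZMod 2) : sign z ≠ 0 := by
  unfold sign; split_ifs <;> norm_num

/-- Near x the finitely many functions `coordFun` and `orderFun` that do not vanish at x keep their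
signs. A translation g that returns to this neighbourhood is therefore supported on edges with
coordinate 0 at x and leaves all compared orders alone, so parity gives g = 0. -/
theorem exists_nhds_vadd_disjoint (x : M n) :
    ∃ U ∈ nhds x, ∀ g : L n → ZMod 2, ((fun y => g +ᵥ y) '' U ∩ U).Nonempty → g = 0 := by
  refine ⟨{y | ∀ A, coordFun A x ≠ 0 → 0 < coordFun A y * coordFun A x} ∩
    {y | ∀ i j, ∀ hij : i ≠ j, orderFun i j hij x ≠ 0 →
      0 < orderFun i j hij y * orderFun i j hij x}, ?_, ?_⟩
  · refine Filter.inter_mem (Filter.eventually_all.2 fun A => Filter.eventually_imp_distrib_left.2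
      fun h => ?_) (Filter.eventually_all.2 fun i => Filter.eventually_all.2 fun j =>
      Filter.eventually_all.2 fun hij => Filter.eventually_imp_distrib_left.2 fun h => ?_)
    · exact (((continuous_coordFun A).mul continuous_const).tendsto x).eventually
        (lt_mem_nhds (mul_self_pos.2 h))
    · exact (((continuous_orderFun hij).mul continuous_const).tendsto x).eventually
        (lt_mem_nhds (mul_self_pos.2 h))
  · rintro g ⟨_, ⟨y, hy, rfl⟩, hgy⟩
    obtain ⟨p, rfl⟩ := Glued.mk_surjective x
    have h1 : ∀ A : L n, coord p A.1 ≠ 0 → g A = 0 := by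
      intro A hA
      have hne : coordFun A (Glued.mk _ p) ≠ 0 := mul_ne_zero (sign_ne_zero _) hA
      have := hgy.1 A hne
      rw [coordFun_vadd] at this
      exact eq_zero_of_sign_mul_pos (hy.1 A hne) this
    have h2 : ∀ i j, i ≠ j → (∃ A, i ∈ A ∧ j ∈ A ∧ coord p A ≠ 1) → twist g i j = 0 := by
      rintro i j hij ⟨A, hi, hj, hA⟩
      have hne : orderFun i j hij (Glued.mk _ p) ≠ 0 := by
        refine mul_ne_zero (sign_ne_zero _) (ne_of_gt (Finset.sum_pos' (fun B _ => ?_) ⟨A, ?_, ?_⟩))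
        · linarith [(coord_mem p B).2]
        · simp [hi, hj]
        · have := lt_of_le_of_ne (coord_mem p A).2 hA
          linarith
      have := hgy.2 i j hij hne
      rw [orderFun_vadd] at this
      exact eq_zero_of_sign_mul_pos (hy.2 i j hij hne) this
    -- D is the support of g, so that g is the sum of the unit vectors over D.
    let D : Finset (Finset (Fin n)) := (Finset.univ.filter fun A : L n => g A ≠ 0).map
      (Function.Embedding.subtype _)
    have hmem : ∀ A : L n, A.1 ∈ D ↔ g A ≠ 0 := by
      intro A
      simp only [D, Finset.mem_map, Finset.mem_filter, Finset.mem_univ, true_and]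
      constructor
      · rintro ⟨B, hB, h⟩
        rwa [← Subtype.ext h]
      · intro h; exact ⟨A, h, rfl⟩
    have hg : g = ∑ A ∈ D, unitVec A := by
      funext A
      rw [sum_unitVec_apply]
      split_ifs with h
      · rw [hmem] at h
        generalize g A = z at h
        fin_cases z
        · exact absurd rfl h
        · rfl
      · rw [hmem, not_not] at h
        exact h
    have hD : ∀ A ∈ D, coord p A = 0 := by
      intro A hA
      obtain ⟨B, hB, rfl⟩ := Finset.mem_map.1 hA
      by_contra h
      exact (Finset.mem_filter.1 hB).2 (h1 B h)
    have hDE : D ⊆ p.1.1.E := fun A hA => mem_of_coord_ne_one (by rw [hD A hA]; norm_num)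
    have : D = ∅ := by
      refine p.1.1.eq_empty_of_countBoth hDE fun A hA i hi j hj hij => ?_
      rw [← twist_sum_unitVec D hij, ← hg]
      exact h2 i j hij ⟨A, hi, hj, by rw [hD A hA]; norm_num⟩
    rw [hg, this]
    rfl

theorem continuous_P : Continuous (P n) :=
  Glued.continuous_iff.2 fun τ _ => continuous_mk τ ()

/-- The closed form of the gluing of D̂_n is that of M_n without the condition on indices; a
translation can always restore that condition. -/
theorem P_eq_iff {x y : M n} : P n x = P n y ↔ x ∈ AddAction.orbit (L n → ZMod 2) y := by
  obtain ⟨p, rfl⟩ := Glued.mk_surjective x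
  obtain ⟨q, rfl⟩ := Glued.mk_surjective y
  constructor
  · intro h
    obtain ⟨D, h1, h2, -, h4⟩ := Rel.of_mk_eq (w := fun _ => 0) (fun _ => rfl) h
    refine ⟨p.1.2 + ∑ A ∈ D, unitVec A - q.1.2, ?_⟩
    refine (mk_eq_of_rel (w := unitVec) (p := p)
      (q := ⟨(q.1.1, p.1.2 + ∑ A ∈ D, unitVec A - q.1.2 + q.1.2), q.2⟩) ⟨D, h1, h2, ?_, h4⟩).symm
    simp
  · rintro ⟨g, hg⟩
    rw [← hg]
    rfl

theorem isAddQuotientCoveringMap_P : IsAddQuotientCoveringMap (P n) (L n → ZMod 2) where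
  toIsQuotientMap := by
    -- The subcubes of index 0 already map onto D̂_n by its quotient map, and this factors through
    -- P.
    have hc : Continuous fun p : Subcubes n Unit => (Glued.mk _ ⟨(p.1.1, 0), p.2⟩ : M n) := by
      rw [continuous_sigma_iff]
      rintro ⟨τ, s⟩
      exact continuous_mk τ 0
    exact Topology.IsQuotientMap.of_comp hc continuous_P (Glued.isQuotientMap_mk _)
  continuous_const_vadd := continuous_const_vadd
  apply_eq_iff_mem_orbit := P_eq_iff
  disjoint := exists_nhds_vadd_disjoint

theorem card_L : Fintype.card (L n) = 2 ^ n - n - 1 := by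
  have h1 := Fintype.card_subtype_compl (α := Finset (Fin n)) (fun A => A.card = 0 ∨ A.card = 1)
  rw [Fintype.card_subtype_or_disjoint, Fintype.card_finset_len, Fintype.card_finset_len] at h1
  · rw [Fintype.card_finset, Fintype.card_fin, Nat.choose_zero_right, Nat.choose_one_right] at h1
    rw [Nat.sub_sub, add_comm n 1, ← h1]
    refine Fintype.card_congr (Equiv.subtypeEquivRight fun A => ?_)
    rw [not_or, Finset.card_eq_zero, Finset.nonempty_iff_ne_empty]
  · rw [Pi.disjoint_iff]
    intro A
    simp only [Prop.disjoint_iff]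
    omega

/-- Each fibre is a torsor under (ℤ/2)^L. -/
theorem card_fiber_P (y : Dhat n) : Nat.card (P n ⁻¹' {y}) = 2 ^ (2 ^ n - n - 1) := by
  obtain ⟨x, hx⟩ := (isAddQuotientCoveringMap_P (n := n)).surjective y
  rw [Nat.card_congr ((isAddQuotientCoveringMap_P (n := n)).fiberEquivAddGroup ⟨x, hx⟩), Nat.card_fun,
    Nat.card_zmod, Nat.card_eq_fintype_card, card_L]

theorem P_mem_cubes {k : ℕ} {φ : Cube k → M n} (hφ : φ ∈ (MCubes n).cubes k) :
    (fun x => P n (φ x)) ∈ (DhatCubes n).cubes k := by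
  obtain ⟨τ, s, b, rfl⟩ := hφ
  exact ⟨τ, (), b, rfl⟩

instance : Finite (PF n) := by
  refine Finite.of_injective (β := {l : List (Fin n) // l.Nodup} × Finset (Finset (Fin n)))
    (fun τ => (⟨τ.forest.leaves, τ.nodup⟩, τ.E)) fun τ τ' h => ?_
  simp only [Prod.mk.injEq, Subtype.mk.injEq] at h
  exact PF.ext (Forest.eq_of_leaves_eq τ.branching τ'.branching τ.nodup h.1 h.2)

instance {G : Type} [AddCommGroup G] [Finite G] (w : Finset (Fin n) → G) : CompactSpace (Glued w) :=
  Quot.compactSpace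

end Covering

end Cactus

/-! ### Hyperplanes of `M n` and specialness -/

namespace Cactus

open CubeCx CubeCx.Cubulation

section Special

variable {n : ℕ}

/-- Reversing direction m moves the chosen corner across the hyperplane: τ is flipped at that label
set and its weight is added to the index. -/
theorem cornerCube_flip {G : Type} [AddCommGroup G] {w : Finset (Fin n) → G}
    (hw : ∀ e, w e + w e = 0) {k : ℕ} (τ : PF n) (s : G) (b : τ.E ≃ Fin k) (m : Fin k) :
    ∃ b' : (τ.reflect {(b.symm m).1}).E ≃ Fin k, (∀ m', (b'.symm m').1 = (b.symm m').1) ∧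
      (fun x => cornerCube w τ s b fun m' => if m' = m then (x m').neg else x m') =
        cornerCube w (τ.reflect {(b.symm m).1}) (s + w (b.symm m).1) b' := by
  have hsub : {(b.symm m).1} ⊆ τ.E := Finset.singleton_subset_iff.2 (b.symm m).2
  refine ⟨(Equiv.subtypeEquivRight fun A => by rw [PF.E_reflect]).trans b, fun m' => rfl, ?_⟩
  funext x
  refine cubeMap_eq_of_E_eq hw (PF.E_reflect _ _) hsub (by simp) ?_ ?_
  · intro A _ i _ j _ hij
    exact PF.ord_reflect τ hsub hij
  · intro A h h'
    change (x (b ⟨A, h⟩)).neg = if A ∈ _ then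
      (J.neg (J.neg (if b ⟨A, h⟩ = m then (x (b ⟨A, h⟩)).neg else x (b ⟨A, h⟩))))
      else (J.neg (if b ⟨A, h⟩ = m then (x (b ⟨A, h⟩)).neg else x (b ⟨A, h⟩)))
    have : A ∈ ({(b.symm m).1} : Finset (Finset (Fin n))) ↔ b ⟨A, h⟩ = m := by
      rw [Finset.mem_singleton, ← Equiv.eq_symm_apply, Subtype.ext_iff]
    simp only [this]
    split_ifs <;> simp [J.neg_neg]

theorem exists_data (e : (MCubes n).OEdge) : ∃ d : (τ : PF n) × (L n → ZMod 2) × (τ.E ≃ Fin 1),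
    e.1 = cornerCube unitVec d.1 d.2.1 d.2.2 := by
  obtain ⟨τ, s, b, h⟩ := exists_cornerCube unitVec_add_self e.2
  exact ⟨⟨τ, s, b⟩, h⟩

/-- The label set of an edge of `M n`. -/
noncomputable def edgeLabel (e : (MCubes n).OEdge) : Finset (Fin n) :=
  ((exists_data e).choose.2.2.symm 0).1

/-- The index of the initial vertex of an edge of `M n`. -/
noncomputable def edgeIndex (e : (MCubes n).OEdge) : L n → ZMod 2 := (exists_data e).choose.2.1

/-- The forest of an edge of `M n`. -/
noncomputable def edgeForest (e : (MCubes n).OEdge) : PF n := (exists_data e).choose.1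

theorem edge_spec (e : (MCubes n).OEdge) : ∃ b : (edgeForest e).E ≃ Fin 1,
    (b.symm 0).1 = edgeLabel e ∧ e.1 = cornerCube unitVec (edgeForest e) (edgeIndex e) b :=
  ⟨_, rfl, (exists_data e).choose_spec⟩

/-- Independence of the choices: label and index are those of any presentation of the edge, and the
forest matters only through its order on the label set. -/
theorem edge_eq {e : (MCubes n).OEdge} {τ : PF n} {s : L n → ZMod 2} {b : τ.E ≃ Fin 1}
    (he : e.1 = cornerCube unitVec τ s b) : edgeLabel e = (b.symm 0).1 ∧ edgeIndex e = s ∧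
      ∀ i ∈ (b.symm 0).1, ∀ j ∈ (b.symm 0).1, i ≠ j → (edgeForest e).ord i j = τ.ord i j := by
  obtain ⟨b', hb', he'⟩ := edge_spec e
  rw [he', cornerCube_eq_iff unitVec_add_self] at he
  refine ⟨by rw [← hb', he.2.1], he.1, fun i hi j hj hij => ?_⟩
  rw [← he.2.1] at hi hj
  exact he.2.2 0 i hi j hj hij

theorem edgeLabel_mem (e : (MCubes n).OEdge) : (edgeLabel e).Nonempty ∧ (edgeLabel e).card ≠ 1 := by
  obtain ⟨b, hb, -⟩ := edge_spec e
  have := (edgeForest e).two_le_card (b.symm 0).2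
  rw [hb] at this
  exact ⟨Finset.card_pos.1 (by omega), by omega⟩

/-- Neither of `A`, `B` contains the other one, and they meet. -/
def Crossing (A B : Finset (Fin n)) : Prop := ¬ (Disjoint A B ∨ A ⊆ B ∨ B ⊆ A)

/-- The label set of the edges dual to a hyperplane of `M n`, and the quantities which determine the
order of the leaves above such an edge in terms of the index of its initial vertex. -/
structure SameClass (e e' : (MCubes n).OEdge) : Prop where
  label : edgeLabel e = edgeLabel e'
  order : ∀ i ∈ edgeLabel e, ∀ j ∈ edgeLabel e, i ≠ j →
    (edgeForest e).ord i j + twist (edgeIndex e) i j =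
      (edgeForest e').ord i j + twist (edgeIndex e') i j
  crossing : ∀ B : L n, Crossing (edgeLabel e) B.1 → edgeIndex e B = edgeIndex e' B

theorem SameClass.refl (e : (MCubes n).OEdge) : SameClass e e :=
  ⟨rfl, fun _ _ _ _ _ => rfl, fun _ _ => rfl⟩

theorem SameClass.symm {e e' : (MCubes n).OEdge} (h : SameClass e e') : SameClass e' e :=
  ⟨h.label.symm, fun i hi j hj hij => (h.order i (h.label ▸ hi) j (h.label ▸ hj) hij).symm,
    fun B hB => (h.crossing B (h.label ▸ hB)).symm⟩

theorem SameClass.trans {e e' e'' : (MCubes n).OEdge} (h : SameClass e e') (h' : SameClass e' e'') :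
    SameClass e e'' :=
  ⟨h.label.trans h'.label,
    fun i hi j hj hij => (h.order i hi j hj hij).trans
      (h'.order i (h.label ▸ hi) j (h.label ▸ hj) hij),
    fun B hB => (h.crossing B hB).trans (h'.crossing B (h.label ▸ hB))⟩

theorem twist_unitVec (A : Finset (Fin n)) {i j : Fin n} (hij : i ≠ j) :
    twist (unitVec A) i j = both i j A := by
  have := twist_sum_unitVec {A} hij
  simpa [countBoth] using this

/-- A flip along B changes the order and the `twist` by the same amount, so their sum is unchanged.
The index changes only at B, which does not cross A. -/
theorem SameClass.of_flip {e e' : (MCubes n).OEdge} {A B : Finset (Fin n)}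
    (hAB : Disjoint A B ∨ A ⊆ B ∨ B ⊆ A) (hA : edgeLabel e = A) (hA' : edgeLabel e' = A)
    (hs : edgeIndex e' = edgeIndex e + unitVec B)
    (ho : ∀ i ∈ A, ∀ j ∈ A, i ≠ j →
      (edgeForest e').ord i j = (edgeForest e).ord i j + both i j B) : SameClass e e' := by
  refine ⟨hA.trans hA'.symm, fun i hi j hj hij => ?_, fun C hC => ?_⟩
  · rw [ho i (hA ▸ hi) j (hA ▸ hj) hij, hs, twist_add, twist_unitVec B hij, add_add_add_comm,
      CharTwo.add_self_eq_zero, add_zero]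
  · rw [hs, Pi.add_apply, unitVec, if_neg, add_zero]
    rintro rfl
    rw [hA] at hC
    exact hC hAB

theorem reverse_data {e e' : (MCubes n).OEdge} (h : IsReverse e e') :
    edgeLabel e' = edgeLabel e ∧ edgeIndex e' = edgeIndex e + unitVec (edgeLabel e) ∧
    ∀ i ∈ edgeLabel e, ∀ j ∈ edgeLabel e, i ≠ j →
      (edgeForest e').ord i j = (edgeForest e).ord i j + both i j (edgeLabel e) := by
  obtain ⟨b, hb, he⟩ := edge_spec e
  obtain ⟨b', hb', h'⟩ := cornerCube_flip unitVec_add_self (edgeForest e) (edgeIndex e) b 0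
  have he' : e'.1 = cornerCube unitVec ((edgeForest e).reflect {(b.symm 0).1})
      (edgeIndex e + unitVec (b.symm 0).1) b' := by
    rw [← h', h, he]
    funext x
    congr 1
    funext m
    simp [Subsingleton.elim m 0]
  obtain ⟨h1, h2, h3⟩ := edge_eq he'
  rw [hb'] at h1 h3
  rw [hb] at h1 h2 h3
  refine ⟨h1, h2, fun i hi j hj hij => ?_⟩
  rw [h3 i hi j hj hij, PF.ord_reflect _ _ hij]
  · simp [countBoth]
  · rw [Finset.singleton_subset_iff, ← hb]
    exact (b.symm 0).2

/-- B is the label set of the other direction of the square; being an edge of the same forest, it is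
different from the label of e and does not cross it. -/
theorem opposite_data {e e' : (MCubes n).OEdge} (h : Opposite e e') :
    ∃ B, edgeLabel e ≠ B ∧ (Disjoint (edgeLabel e) B ∨ edgeLabel e ⊆ B ∨ B ⊆ edgeLabel e) ∧
    edgeLabel e' = edgeLabel e ∧ edgeIndex e' = edgeIndex e + unitVec B ∧
    ∀ i ∈ edgeLabel e, ∀ j ∈ edgeLabel e, i ≠ j →
      (edgeForest e').ord i j = (edgeForest e).ord i j + both i j B := by
  obtain ⟨φ, hφ, h, h'⟩ := h
  obtain ⟨σ, r, c, rfl⟩ := exists_cornerCube unitVec_add_self hφ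
  obtain ⟨c', hc', hflip⟩ := cornerCube_flip unitVec_add_self σ r c 1
  obtain ⟨τ₁, b₁, h₁, ho₁, h₁'⟩ := exists_cornerEdge_eq unitVec_add_self σ r c 0
  obtain ⟨τ₂, b₂, h₂, ho₂, h₂'⟩ := exists_cornerEdge_eq unitVec_add_self _ (r + unitVec (c.symm 1).1) c' 0
  have he : e.1 = cornerCube unitVec τ₁ r b₁ := by
    rw [← h₁', h]
    funext x
    unfold cornerEdge
    congr 1
    funext m
    fin_cases m <;> rfl
  have he' : e'.1 = cornerCube unitVec τ₂ (r + unitVec (c.symm 1).1) b₂ := by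
    rw [← h₂', h', ← hflip]
    funext x
    unfold cornerEdge
    congr 1
    funext m
    fin_cases m
    · rfl
    · exact Subtype.ext (by simp [J.top, J.bot, J.neg])
  obtain ⟨h1, h2, h3⟩ := edge_eq he
  obtain ⟨h1', h2', h3'⟩ := edge_eq he'
  rw [h₁] at h1 h3
  rw [h₂, hc'] at h1' h3'
  refine ⟨(c.symm 1).1, ?_, ?_, h1'.trans h1.symm, by rw [h2', h2], ?_⟩
  · rw [h1]
    exact fun h => absurd (c.symm.injective (Subtype.ext h)) (by decide)
  · rw [h1]
    exact Forest.edges_laminar σ.nodup (c.symm 0).2 (c.symm 1).2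
  · rw [h1]
    intro i hi j hj hij
    rw [h3 i hi j hj hij, h3' i hi j hj hij, ho₁, ho₂,
      PF.ord_reflect _ (Finset.singleton_subset_iff.2 (c.symm 1).2) hij]
    simp [countBoth]

theorem SameClass.of_dual {e e' : (MCubes n).OEdge} {H : (MCubes n).Hyperplane} (h : Dual e H)
    (h' : Dual e' H) : SameClass e e' := by
  have := Quot.eqvGen_exact (Eq.trans h (Eq.symm h'))
  clear h h'
  induction this with
  | rel e e' h =>
    rcases h with h | h
    · obtain ⟨B, _, h1, h2, h3, h4⟩ := opposite_data h
      exact SameClass.of_flip h1 rfl h2 h3 h4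
    · obtain ⟨h2, h3, h4⟩ := reverse_data h
      exact SameClass.of_flip (Or.inr (Or.inl subset_rfl)) rfl h2 h3 h4
  | refl e => exact SameClass.refl e
  | symm _ _ _ ih => exact ih.symm
  | trans _ _ _ _ _ ih ih' => exact ih.trans ih'

/-- Passing through a square changes the index only at the other label set. Reversal does change the
entry at the edge's own label, which gives two-sidedness. -/
theorem edgeIndex_eq_of_eqvGen_opposite {e e' : (MCubes n).OEdge}
    (h : Relation.EqvGen Opposite e e') : edgeLabel e = edgeLabel e' ∧
      ∀ A : L n, A.1 = edgeLabel e → edgeIndex e A = edgeIndex e' A := by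
  induction h with
  | rel e e' h =>
    obtain ⟨B, h0, _, h2, h3, _⟩ := opposite_data h
    refine ⟨h2.symm, fun A hA => ?_⟩
    rw [h3, Pi.add_apply, unitVec, if_neg (hA ▸ h0), add_zero]
  | refl e => exact ⟨rfl, fun _ _ => rfl⟩
  | symm _ _ _ ih => exact ⟨ih.1.symm, fun A hA => (ih.2 A (hA.trans ih.1.symm)).symm⟩
  | trans _ _ _ _ _ ih ih' =>
    exact ⟨ih.1.trans ih'.1, fun A hA => (ih.2 A hA).trans (ih'.2 A (hA.trans ih.1))⟩

theorem twoSided (H : (MCubes n).Hyperplane) : TwoSided H := by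
  intro e e' _ hr h
  have h1 := (edgeIndex_eq_of_eqvGen_opposite h).2 ⟨_, edgeLabel_mem e⟩ rfl
  rw [(reverse_data hr).2.1, Pi.add_apply, unitVec, if_pos rfl] at h1
  simp at h1

theorem SameClass.eq_of_edgeIndex_eq {e e' : (MCubes n).OEdge} (h : SameClass e e')
    (hs : edgeIndex e = edgeIndex e') : e = e' := by
  obtain ⟨b, hb, he⟩ := edge_spec e
  obtain ⟨b', hb', he'⟩ := edge_spec e'
  apply Subtype.ext
  rw [he, he', cornerCube_eq_iff unitVec_add_self]
  have hm : ∀ m : Fin 1, m = 0 := fun m => Subsingleton.elim m 0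
  refine ⟨hs, fun m => ?_, fun m i hi j hj hij => ?_⟩
  · rw [hm m, hb, hb', h.label]
  · rw [hm m, hb] at hi hj
    have := h.order i hi j hj hij
    rw [hs] at this
    exact add_right_cancel this

theorem edgeIndex_eq_iff_origin_eq {e e' : (MCubes n).OEdge} :
    edgeIndex e = edgeIndex e' ↔ e.origin = e'.origin := by
  obtain ⟨b, hb, he⟩ := edge_spec e
  obtain ⟨b', hb', he'⟩ := edge_spec e'
  unfold OEdge.origin
  rw [he, he']
  exact (corner_cornerCube_eq_iff unitVec_add_self).symm

theorem formCorner_iff_compatible {e e' : (MCubes n).OEdge} :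
    FormCorner e e' ↔ edgeIndex e = edgeIndex e' ∧ edgeLabel e ≠ edgeLabel e' ∧
      (edgeForest e).Compatible (edgeForest e') (edgeLabel e) (edgeLabel e') := by
  obtain ⟨b, hb, he⟩ := edge_spec e
  obtain ⟨b', hb', he'⟩ := edge_spec e'
  rw [formCorner_iff unitVec_add_self he he', hb, hb']

/-- A set that contains k ∉ A and does not cross A contains all of A or nothing of it, so it cannot
distinguish i from j. -/
theorem twist_eq_of_crossing {A : Finset (Fin n)} {d : L n → ZMod 2}
    (hd : ∀ B : L n, Crossing A B.1 → d B = 0) {i j k : Fin n} (hi : i ∈ A) (hj : j ∈ A)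
    (hk : k ∉ A) : twist d i k = twist d j k := by
  refine Finset.sum_congr rfl fun B _ => ?_
  by_cases hB : Crossing A B.1
  · rw [hd B hB, mul_zero, mul_zero]
  · congr 1
    unfold both
    simp only [Crossing, not_not] at hB
    by_cases hkB : k ∈ B.1
    · have : i ∈ B.1 ↔ j ∈ B.1 := by
        rcases hB with h | h | h
        · exact iff_of_false (Finset.disjoint_left.1 h hi) (Finset.disjoint_left.1 h hj)
        · exact iff_of_true (h hi) (h hj)
        · exact (hk (h hkB)).elim
      simp only [this]
    · simp [hkB]

/-- Both orders change by the `twist` of the same vector, the sum of the old and new index, so they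
still agree on A. This vector vanishes at all sets crossing A, so the interval condition also
persists by `twist_eq_of_crossing`. -/
theorem nested_of_sameClass {e₁ e₂ e₁' e₂' : (MCubes n).OEdge} (h₁ : SameClass e₁ e₁')
    (h₂ : SameClass e₂ e₂') (hs : edgeIndex e₁ = edgeIndex e₂) (hs' : edgeIndex e₁' = edgeIndex e₂')
    (hsub : edgeLabel e₁ ⊆ edgeLabel e₂)
    (h : (edgeForest e₁).Nested (edgeForest e₂) (edgeLabel e₁) (edgeLabel e₂)) :
    (edgeForest e₁').Nested (edgeForest e₂') (edgeLabel e₁) (edgeLabel e₂) := by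
  have key : ∀ {e e' : (MCubes n).OEdge}, SameClass e e' → ∀ i ∈ edgeLabel e, ∀ j ∈ edgeLabel e,
      i ≠ j → (edgeForest e').ord i j =
        (edgeForest e).ord i j + twist (edgeIndex e + edgeIndex e') i j := by
    intro e e' h i hi j hj hij
    rw [twist_add, ← add_assoc, h.order i hi j hj hij, add_assoc, CharTwo.add_self_eq_zero, add_zero]
  constructor
  · intro i hi j hj hij
    rw [key h₁ i hi j hj hij, key h₂ i (hsub hi) j (hsub hj) hij, h.1 i hi j hj hij, hs, hs']
  · intro i hi j hj k hk hkA
    rw [key h₂ i (hsub hi) k hk (ne_of_mem_of_not_mem hi hkA),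
      key h₂ j (hsub hj) k hk (ne_of_mem_of_not_mem hj hkA), h.2 i hi j hj k hk hkA, ← hs, ← hs']
    congr 1
    refine twist_eq_of_crossing (A := edgeLabel e₁) (fun B hB => ?_) hi hj hkA
    rw [Pi.add_apply, h₁.crossing B hB, CharTwo.add_self_eq_zero]

theorem M_special : (MCubes n).Special where
  npc := gluedCubes_npc unitVec_add_self
  two_sided := twoSided
  embedded := by
    rintro H ⟨e, e', he, he', hne, hc⟩
    exact hne ((SameClass.of_dual he he').eq_of_edgeIndex_eq (formCorner_iff_compatible.1 hc).1)
  no_self_osculation := by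
    rintro H ⟨e, e', he, he', hne, ho, -⟩
    exact hne ((SameClass.of_dual he he').eq_of_edgeIndex_eq (edgeIndex_eq_iff_origin_eq.2 ho))
  no_inter_osculation := by
    rintro H₁ H₂ ⟨⟨e₁, e₂, he₁, he₂, -, hc⟩, e₁', e₂', he₁', he₂', -, ho, hnc⟩
    have h₁ := SameClass.of_dual he₁ he₁'
    have h₂ := SameClass.of_dual he₂ he₂'
    have hs' := edgeIndex_eq_iff_origin_eq.2 ho
    obtain ⟨hs, hne, hc⟩ := formCorner_iff_compatible.1 hc
    refine hnc (formCorner_iff_compatible.2 ⟨hs', h₁.label ▸ h₂.label ▸ hne, ?_⟩)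
    rw [← h₁.label, ← h₂.label]
    rcases hc with h | ⟨h, h'⟩ | ⟨h, h'⟩
    · exact Or.inl h
    · exact Or.inr (Or.inl ⟨h, nested_of_sameClass h₁ h₂ hs hs' h h'⟩)
    · exact Or.inr (Or.inr ⟨h, nested_of_sameClass h₂ h₁ hs.symm hs'.symm h h'⟩)

end Special

end Cactus

theorem theorem1 (n : ℕ) :
    -- `D̂_n` is a nonpositively curved cube complex
    CubeCx.IsCubeComplex (Cactus.DhatCubes n) ∧ (Cactus.DhatCubes n).NPC ∧
    -- `P : M_n → D̂_n` is a finite covering of degree `2 ^ (2 ^ n - n - 1)` which maps cubes to cubes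
    IsCoveringMap (Cactus.P n) ∧
    (∀ y : Cactus.Dhat n, Nat.card (Cactus.P n ⁻¹' {y}) = 2 ^ (2 ^ n - n - 1)) ∧
    (∀ k, ∀ φ ∈ (Cactus.MCubes n).cubes k, 
      (fun x => Cactus.P n (φ x)) ∈ (Cactus.DhatCubes n).cubes k) ∧
    -- `M_n` is a compact special cube complex
    CompactSpace (Cactus.M n) ∧
    CubeCx.IsCubeComplex (Cactus.MCubes n) ∧ (Cactus.MCubes n).Special :=
  ⟨Cactus.gluedCubes_isCubeComplex fun _ => rfl, Cactus.gluedCubes_npc fun _ => rfl,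
    Cactus.isAddQuotientCoveringMap_P.isCoveringMap, Cactus.card_fiber_P,
    fun _ _ hφ => Cactus.P_mem_cubes hφ, inferInstance,
    Cactus.gluedCubes_isCubeComplex Cactus.unitVec_add_self, Cactus.M_special⟩
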